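/- **Main reduction from Vertex Cover to DT-Learn.** *Conventions.* Algorithms are programs for a randomized random access machine (registers and arrays of natural numbers; unit-cost addition, truncated subtraction, indirect addressing, drawing a uniform element of $\{0,\dots,y-1\}$, and structured control flow); time is the number of steps in the worst case over all random choices. The size of a decision tree is its number of leaves. A learner for DT-Learn$(s,s',\varepsilon)$ is given $n$ and $s$, can in one step query an unknown $f:\{0,1\}^n\to\{0,1\}$ and in one step draw an example $(x,f(x))$ with $x\sim\mathcal D$. It has to satisfy, for every $f$ computed by a decision tree of size at most $s$ and for every distribution $\mathcal D$ on $\{0,1\}^n$: with probability at least $2/3$ it outputs a decision tree $T$ of size at most $s'$ with $\Pr_{x\sim\mathcal D}[T(x)\ne f(x)]\le\varepsilon$. Its time bound is only required for such $f$. A randomized algorithm $a$-approximates Vertex Cover on degree-$d$ graphs if, given a graph $G$ with $n\ge 1$ vertices and all degrees at most $d$ (as an adjacency matrix) and an integer $k\ge 1$, it always halts within its time bound, answers Yes with probability at least $2/3$ if $G$ has a vertex cover of size at most $k$, and answers No with probability at least $2/3$ if every vertex cover of $G$ has size at least $a\cdot k$. *Theorem.* Let $d\in\mathbb N$, $\delta'\in\mathbb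 R$ and $\eta>0$. There is a constant $K$, and for every $c\in\mathbb N$ there is a constant $C$, such that the following holds for all integers $r\ge1$ and all reals $0<\varepsilon<2^{-3r}$ and $A>1$ with $$\delta'\ \ge\ \bigl(A^{1/r}-1+8\,\varepsilon^{1/r}\bigr)d+A^{1/r}-1+\eta .$$ Let $t(s,1/\varepsilon)$ be a positive integer-valued time bound that is nondecreasing in $s$ and time-constructible in $s$ with constant $c$ (that is, $t(s,1/\varepsilon)$ can be computed from $s$ in at most $c\cdot t(s,1/\varepsilon)$ steps). Suppose that there is a learner that solves DT-Learn$(s,A\cdot s,\varepsilon)$ on $n$-variable functions in time $t(s,1/\varepsilon)$ for all $n,s$ with $n\le K s$ and $s\le (Kn)^r$. Then Vertex Cover can be $(1+\delta')$-approximated on degree-$d$, $n$-vertex graphs in randomized time $$C\, r\, n^2\cdot t\bigl((C n^2)^r,\,1/\varepsilon\bigr).$$ In particular, for every $d$ and every $\delta'>(A^{1/r}-1+8\varepsilon^{1/r})d+A^{1/r}-1$ this applies with $\eta$ the difference of the two sides. -/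

import Mathlib

/-! ### Decision trees -/

/-- Decision trees over the variables `Fin n`. An internal node `node i l r` queries the variable
`i` and continues with `l` if it is `0` and with `r` if it is `1`. -/
inductive DTree (n : ℕ) : Type
  | leaf (b : Bool) : DTree n
  | node (i : Fin n) (l r : DTree n) : DTree n

namespace DTree

/-- The function computed by a decision tree. -/
def eval {n : ℕ} : DTree n → (Fin n → Bool) → Bool
  | leaf b, _ => b
  | node i l r, x => if x i then r.eval x else l.eval x

/-- The size of a decision tree is its number of leaves. -/
def size {n : ℕ} : DTree n → ℕ
  | leaf _ => 1
  | node _ l r => l.size + r.size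

/-- Preorder serialization: `0` and `1` are leaves, and `i + 2` is a node that queries the
variable `i`, followed by its two subtrees. This is a prefix-free code. -/
def encode {n : ℕ} : DTree n → List ℕ
  | leaf b => [b.toNat]
  | node i l r => ((i : ℕ) + 2) :: (l.encode ++ r.encode)

end DTree

/-- `error_D(f, g) = Pr_{x ∼ D} [f x ≠ g x]`. -/
noncomputable def disagreement {n : ℕ} (D : PMF (Fin n → Bool)) (f g : (Fin n → Bool) → Bool) :
    ENNReal :=
  D.toOuterMeasure {x | f x ≠ g x}

/-! ### Randomized random access machines with oracle calls

The machine has registers and arrays that hold natural numbers, unit-cost addition, truncated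
subtraction, indirect addressing and uniform random choice, and structured control flow. -/

/-- The memory of the machine: registers `reg 0, reg 1, …` and arrays `arr 0, arr 1, …`, each
array with unboundedly many cells. -/
structure Store : Type where
  reg : ℕ → ℕ
  arr : ℕ → ℕ → ℕ

namespace Store

/-- Write the value `v` to the register `x`. -/
def setReg (σ : Store) (x v : ℕ) : Store :=
  { σ with reg := Function.update σ.reg x v }

/-- Replace the array `a` by `c`. -/
def setArr (σ : Store) (a : ℕ) (c : ℕ → ℕ) : Store :=
  { σ with arr := Function.update σ.arr a c }

end Store

/-- The elementary instructions:
`const x c` is `x := c`, `add x y z` is `x := y + z`, `sub x y z` is `x := y - z` (truncated),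
`load x a y` is `x := a[y]`, `store a y x` is `a[y] := x`, and `rand x y` draws `x` uniformly from
`{0, …, y - 1}` (and sets `x := 0` if `y = 0`). Here `x`, `y`, `z` are registers and `a` is an
array. -/
inductive Instr : Type
  | const (x c : ℕ) : Instr
  | add (x y z : ℕ) : Instr
  | sub (x y z : ℕ) : Instr
  | load (x a y : ℕ) : Instr
  | store (a y x : ℕ) : Instr
  | rand (x y : ℕ) : Instr

/-- The uniform distribution on `{0, …, m - 1}` (the point mass at `0` if `m = 0`). -/
noncomputable def uniformBelow : ℕ → PMF ℕ
  | 0 => PMF.pure 0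
  | m + 1 => (PMF.uniformOfFintype (Fin (m + 1))).map Fin.val

/-- The effect of an elementary instruction. -/
noncomputable def Instr.exec : Instr → Store → PMF Store
  | const x c, σ => PMF.pure (σ.setReg x c)
  | add x y z, σ => PMF.pure (σ.setReg x (σ.reg y + σ.reg z))
  | sub x y z, σ => PMF.pure (σ.setReg x (σ.reg y - σ.reg z))
  | load x a y, σ => PMF.pure (σ.setReg x (σ.arr a (σ.reg y)))
  | store a y x, σ => PMF.pure (σ.setArr a (Function.update (σ.arr a) (σ.reg y) (σ.reg x)))
  | rand x y, σ => (uniformBelow (σ.reg y)).map fun v => σ.setReg x v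

/-- Programs whose oracle calls are named by the elements of `ι`. Tests are of the form
"register `x` is nonzero". -/
inductive Prog (ι : Type) : Type
  | instr (o : Instr) : Prog ι
  | call (i : ι) : Prog ι
  | seq (p q : Prog ι) : Prog ι
  | branch (x : ℕ) (p q : Prog ι) : Prog ι
  | loop (x : ℕ) (p : Prog ι) : Prog ι

/-- A configuration: the stack of program pieces that are still to be executed, and the memory.
The machine has halted when the stack is empty. -/
abbrev Config (ι : Type) : Type := List (Prog ι) × Store

/-- One step of the machine; `h` is the effect of the oracle calls. A call costs one step. -/
noncomputable def step {ι : Type} (h : ι → Store → PMF Store) : Config ι → PMF (Config ι)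
  | ([], σ) => PMF.pure ([], σ)
  | (.instr o :: k, σ) => (o.exec σ).map fun σ' => (k, σ')
  | (.call i :: k, σ) => (h i σ).map fun σ' => (k, σ')
  | (.seq p q :: k, σ) => PMF.pure (p :: q :: k, σ)
  | (.branch x p q :: k, σ) => PMF.pure ((if σ.reg x ≠ 0 then p else q) :: k, σ)
  | (.loop x p :: k, σ) => PMF.pure (if σ.reg x ≠ 0 then p :: .loop x p :: k else k, σ)

/-- The distribution of the configuration after `T` steps. -/
noncomputable def runFor {ι : Type} (h : ι → Store → PMF Store) : ℕ → Config ι → PMF (Config ι)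
  | 0, c => PMF.pure c
  | T + 1, c => (step h c).bind (runFor h T)

/-- Started in the memory `σ`, the program `p` halts within `T` steps, whatever the random
choices and the random answers of the oracle are. -/
def HaltsWithin {ι : Type} (h : ι → Store → PMF Store) (p : Prog ι) (σ : Store) (T : ℕ) : Prop :=
  ∀ c ∈ (runFor h T ([p], σ)).support, c.1 = []

/-- The probability that the program `p`, started in the memory `σ`, has halted after `T` steps
with a memory that satisfies `E`. -/
noncomputable def outcomeProb {ι : Type} (h : ι → Store → PMF Store) (p : Prog ι) (σ : Store)
    (T : ℕ) (E : Store → Prop) : ENNReal :=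
  (runFor h T ([p], σ)).toOuterMeasure {c | c.1 = [] ∧ E c.2}

/-- Programs without oracle calls. -/
abbrev PlainProg : Type := Prog Empty

/-- The (void) effect of the oracle calls of a program without oracle calls. -/
noncomputable def noOracle : Empty → Store → PMF Store := fun i => i.elim

/-- The memory that holds the numbers `a` and `b` in the registers `0` and `1`, the array `c` as
array `0`, and zeros elsewhere. -/
def inputStore (a b : ℕ) (c : ℕ → ℕ) : Store where
  reg := fun x => if x = 0 then a else if x = 1 then b else 0
  arr := fun i => if i = 0 then c else fun _ => 0

/-- `g` is time-constructible with constant `c`: some program without oracle calls computes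
`g x` (into register `0`) from `x` (in register `0`) within `c * g x` steps. -/
def TimeConstructible (c : ℕ) (g : ℕ → ℕ) : Prop :=
  ∃ p : PlainProg, ∀ x : ℕ,
    HaltsWithin noOracle p (inputStore x 0 fun _ => 0) (c * g x) ∧
    outcomeProb noOracle p (inputStore x 0 fun _ => 0) (c * g x) (fun σ => σ.reg 0 = g x) = 1

/-! ### Learning decision trees with queries and random examples -/

/-- The two kinds of oracle calls of a learner. -/
inductive LearnCall : Type
  | query : LearnCall
  | sample : LearnCall

/-- The oracles of a learner for the target `f : {0,1}ⁿ → {0,1}` and the distribution `D`.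
A query returns in register `2` the value of `f` at the string in the first `n` cells of array `0`
(a nonzero cell is read as the bit `1`). A sample draws `x ∼ D`, writes it to the first `n` cells
of array `1` and writes `f x` to register `2`. -/
noncomputable def learnOracle {n : ℕ} (f : (Fin n → Bool) → Bool) (D : PMF (Fin n → Bool)) :
    LearnCall → Store → PMF Store
  | .query, σ => PMF.pure (σ.setReg 2 (f fun i => decide (σ.arr 0 i ≠ 0)).toNat)
  | .sample, σ => D.map fun x =>
      (σ.setReg 2 (f x).toNat).setArr 1
        fun j => if hj : j < n then (x ⟨j, hj⟩).toNat else σ.arr 1 j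

/-- The output of a learner is the tree `T`: array `2` starts with the serialization of `T`. -/
def OutputsTree {n : ℕ} (T : DTree n) (σ : Store) : Prop :=
  ∀ (j : ℕ) (hj : j < T.encode.length), σ.arr 2 j = T.encode[j]

/-- The learner `L` solves the task DT-Learn`(s, A * s, ε)` in `t s` steps for functions of `n`
variables: given `n` and `s` in the registers `0` and `1`, oracle access to a function `f` that is
computed by some decision tree of size at most `s`, and random examples from an arbitrary
distribution `D`, it always halts within `t s` steps, and with probability at least `2/3` it
outputs a decision tree of size at most `A * s` that is `ε`-close to `f` under `D`. -/
def SolvesDTLearn (L : Prog LearnCall) (A ε : ℝ) (t : ℕ → ℕ) (n s : ℕ) : Prop :=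
  ∀ (f : (Fin n → Bool) → Bool) (D : PMF (Fin n → Bool)),
    (∃ T : DTree n, T.size ≤ s ∧ ∀ x, T.eval x = f x) →
      HaltsWithin (learnOracle f D) L (inputStore n s fun _ => 0) (t s) ∧
      2 / 3 ≤ outcomeProb (learnOracle f D) L (inputStore n s fun _ => 0) (t s)
        (fun σ => ∃ T : DTree n, OutputsTree T σ ∧ (T.size : ℝ) ≤ A * s ∧
          disagreement D T.eval f ≤ ENNReal.ofReal ε)

/-! ### Approximating the vertex cover problem -/

/-- The adjacency matrix of a graph on `Fin n`, stored row by row: cell `u * n + v` is `1` if `u`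
and `v` are adjacent, and all other cells are `0`. -/
def adjArray {n : ℕ} (G : SimpleGraph (Fin n)) [DecidableRel G.Adj] : ℕ → ℕ :=
  fun j => if ∃ u v : Fin n, G.Adj u v ∧ (u : ℕ) * n + v = j then 1 else 0

/-- The randomized program `P` `a`-approximates Vertex Cover in time `T n` on graphs with
`n ≥ 1` vertices in which every vertex has degree at most `d`: given `n` and `k ≥ 1` in the
registers `0` and `1` and the adjacency matrix of `G` in array `0`, it always halts within `T n`
steps; with probability at least `2/3` it answers `1` (in register `0`) if `G` has a vertex cover
of size at most `k`, and with probability at least `2/3` it answers `0` if every vertex cover of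
`G` has size at least `a * k`. -/
def ApproximatesVertexCover (P : PlainProg) (a : ℝ) (d : ℕ) (T : ℕ → ℕ) : Prop :=
  ∀ (n : ℕ) (G : SimpleGraph (Fin n)) [DecidableRel G.Adj] (k : ℕ),
    1 ≤ n → 1 ≤ k → (∀ v, G.degree v ≤ d) →
      HaltsWithin noOracle P (inputStore n k (adjArray G)) (T n) ∧
      ((∃ S : Finset (Fin n), G.IsVertexCover S ∧ S.card ≤ k) →
        2 / 3 ≤ outcomeProb noOracle P (inputStore n k (adjArray G)) (T n)
          (fun σ => σ.reg 0 = 1)) ∧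
      ((∀ S : Finset (Fin n), G.IsVertexCover S → a * k ≤ (S.card : ℝ)) →
        2 / 3 ≤ outcomeProb noOracle P (inputStore n k (adjArray G)) (T n)
          (fun σ => σ.reg 0 = 0))

/-! ### Probability mass functions -/

/-! The graph is turned into a Boolean function whose small decision trees reveal small vertex
covers. Isolated vertices are dropped, and every other vertex gets ℓ + 1 variables, its copies 0, …,
ℓ. The function `blockFun` recognizes the strings in which exactly two vertices are on (in copy 0),
they form an edge, and all their copies are on. The examples are uniform over pairs (edge, index
below 4ℓ): for half of the indices the string is the indicator of the edge (value 1), and for the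
other half one copy of one endpoint is switched off (value 0).

A cover of size k gives a tree with about (k + m)ℓ leaves, where m is the number of edges: look for
a vertex of the cover that is on, check its copies, and look for its partner among the edges that
have not been ruled out (`size_searchFirst`). Conversely, let `W` be the greedy cover formed by the
vertices queried on a path, and let `cand W` be the size of the cover that results from adding one
endpoint of every uncovered edge. If `cand W` is at least κ at all leaves, then (ℓ - 1)(m + κ) is at
most the number of leaves plus the number of examples on which the tree errs. This is proved with a
potential that starts at (ℓ - 1)(m + κ). No query destroys any of it (`Pot.split`), and at a leaf it
is at most 1 or at most the number of consistent examples of each value (`Pot.leaf`).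

The target is the parity of r independent blocks. Upper bounds multiply by grafting (`exists_tree`).
Lower bounds multiply because a query concerns one block only and because changing the value of one
block changes the parity (`prod_pot_le`, `pow_le_size`). In this way the factor A and the error ε
for the parity correspond to A^(1/r) and ε^(1/r) for one block.

The algorithm fixes a rational ρ = u/q slightly below 1 + δ'. If m ≤ ρk it answers Yes. Otherwise it
simulates the learner on the parity, answering queries and drawing examples itself, and walks
through the output tree, testing at every inner node whether `cand W` ≤ ρk. A successful test always
exhibits a cover with fewer than (1 + δ')k vertices, whatever the learner has written, so No
instances are answered correctly with certainty. If there is a cover of size k and the learner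
succeeds, then its tree is too small to have only failing tests: by `size_lt`, A times the bound
from `exists_tree` plus ε(4mℓ)^r is less than ((ℓ - 1)(m + κ))^r whenever κ ≥ ρk. To leading order
in ℓ and per block this says (A^(1/r) - 1 + 4ε^(1/r))m + A^(1/r)k < ρk, which follows from m ≤ dk
and the assumption on δ'. One half of η pays for the difference between ρ and 1 + δ', the other half
for the lower order terms once ℓ/n is a large constant.

The learner's time bound is promised only for targets with small trees. Therefore the bound is
computed first, and the simulation runs with a step counter (`sim_law`); within t steps at most t
nonzero tokens can be written, which bounds the walk. Deterministic code is verified with `WP`,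
randomized code with `Law`, and `cost_le` adds up the running times. -/

theorem PMF.bind_congr_support {α β : Type*} (p : PMF α) {f g : α → PMF β}
    (h : ∀ a ∈ p.support, f a = g a) : p.bind f = p.bind g := by
  ext b
  simp only [PMF.bind_apply]
  refine tsum_congr fun a => ?_
  by_cases ha : p a = 0
  · simp [ha]
  · rw [h a ((PMF.mem_support_iff _ _).2 ha)]

theorem PMF.toOuterMeasure_mono_support {α : Type*} (p : PMF α) {s t : Set α}
    (h : ∀ a ∈ p.support, a ∈ s → a ∈ t) : p.toOuterMeasure s ≤ p.toOuterMeasure t :=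
  PMF.toOuterMeasure_mono p fun a ha => h a ha.2 ha.1

/-! ### Deterministic execution -/

/-- The effect of an instruction that makes no random choice. -/
def Instr.det : Instr → Store → Store
  | const x c, σ => σ.setReg x c
  | add x y z, σ => σ.setReg x (σ.reg y + σ.reg z)
  | sub x y z, σ => σ.setReg x (σ.reg y - σ.reg z)
  | load x a y, σ => σ.setReg x (σ.arr a (σ.reg y))
  | store a y x, σ => σ.setArr a (Function.update (σ.arr a) (σ.reg y) (σ.reg x))
  | rand _ _, σ => σ

/-- The instruction makes no random choice. -/
def Instr.isDet : Instr → Bool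
  | rand _ _ => false
  | _ => true

/-- The registers written by an instruction. -/
def Instr.regs : Instr → List ℕ
  | const x _ => [x]
  | add x _ _ => [x]
  | sub x _ _ => [x]
  | load x _ _ => [x]
  | store _ _ _ => []
  | rand x _ => [x]

/-- The arrays written by an instruction. -/
def Instr.arrs : Instr → List ℕ
  | store a _ _ => [a]
  | _ => []

namespace Prog

/-- The registers written by a program. -/
def regs {ι : Type} : Prog ι → List ℕ
  | instr o => o.regs
  | call _ => []
  | seq p q => p.regs ++ q.regs
  | branch _ p q => p.regs ++ q.regs
  | loop _ p => p.regs

/-- The arrays written by a program. -/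
def arrs {ι : Type} : Prog ι → List ℕ
  | instr o => o.arrs
  | call _ => []
  | seq p q => p.arrs ++ q.arrs
  | branch _ p q => p.arrs ++ q.arrs
  | loop _ p => p.arrs

/-- A program that only writes a dummy register. -/
def skip : PlainProg := instr (.const 99 0)

/-- A nonempty block of instructions. -/
def blk : Instr → List Instr → PlainProg
  | o, [] => instr o
  | o, o' :: os => seq (instr o) (blk o' os)

end Prog

/-- `σ` and `σ'` agree on the registers outside `R` and on the arrays outside `S`. -/
def Frame (R S : List ℕ) (σ σ' : Store) : Prop :=
  (∀ x, x ∉ R → σ'.reg x = σ.reg x) ∧ ∀ a, a ∉ S → σ'.arr a = σ.arr a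

theorem Frame.refl (R S : List ℕ) (σ : Store) : Frame R S σ σ := ⟨fun _ _ => rfl, fun _ _ => rfl⟩

theorem Frame.trans {R S : List ℕ} {σ σ' σ'' : Store} (h : Frame R S σ σ')
    (h' : Frame R S σ' σ'') : Frame R S σ σ'' :=
  ⟨fun x hx => (h'.1 x hx).trans (h.1 x hx), fun a ha => (h'.2 a ha).trans (h.2 a ha)⟩

theorem Frame.mono {R S R' S' : List ℕ} {σ σ' : Store} (h : Frame R S σ σ')
    (hR : ∀ x ∈ R, x ∈ R') (hS : ∀ a ∈ S, a ∈ S') : Frame R' S' σ σ' :=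
  ⟨fun x hx => h.1 x fun h' => hx (hR x h'), fun a ha => h.2 a fun h' => ha (hS a h')⟩

/-- Deterministic execution: `p` leads from `σ` to `σ'` in exactly `c` steps. -/
inductive Ex : PlainProg → Store → Store → ℕ → Prop
  | instr (o : Instr) (σ : Store) (h : o.isDet = true) : Ex (.instr o) σ (o.det σ) 1
  | seq {p q : PlainProg} {σ σ' σ'' : Store} {c c' : ℕ} (hp : Ex p σ σ' c) (hq : Ex q σ' σ'' c') :
      Ex (.seq p q) σ σ'' (c + c' + 1)
  | branch {x : ℕ} {p q : PlainProg} {σ σ' : Store} {c : ℕ}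
      (h : Ex (if σ.reg x ≠ 0 then p else q) σ σ' c) : Ex (.branch x p q) σ σ' (c + 1)
  | loop_zero {x : ℕ} {p : PlainProg} {σ : Store} (h : σ.reg x = 0) : Ex (.loop x p) σ σ 1
  | loop_succ {x : ℕ} {p : PlainProg} {σ σ' σ'' : Store} {c c' : ℕ} (h : σ.reg x ≠ 0)
      (hp : Ex p σ σ' c) (hq : Ex (.loop x p) σ' σ'' c') : Ex (.loop x p) σ σ'' (c + c' + 1)

theorem Instr.exec_det (o : Instr) (σ : Store) (h : o.isDet = true) :
    o.exec σ = PMF.pure (o.det σ) := by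
  cases o <;> first | rfl | simp [Instr.isDet] at h

theorem runFor_succ {ι : Type} (h : ι → Store → PMF Store) (T : ℕ) (c : Config ι) :
    runFor h (T + 1) c = (step h c).bind (runFor h T) := rfl

theorem runFor_nil {ι : Type} (h : ι → Store → PMF Store) (T : ℕ) (σ : Store) :
    runFor h T ([], σ) = PMF.pure ([], σ) := by
  induction T with
  | zero => rfl
  | succ T ih => rw [runFor_succ, step, PMF.pure_bind, ih]

/-- The continuation `k` and the remaining time `T` are arbitrary because the first half of a
sequence is executed with the second half on the stack. With exact step counts both sides agree as
distributions. -/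
theorem Ex.sound {p : PlainProg} {σ σ' : Store} {c : ℕ} (h : Ex p σ σ' c) :
    ∀ k T, runFor noOracle (T + c) (p :: k, σ) = runFor noOracle T (k, σ') := by
  induction h with
  | instr o σ h =>
    intro k T
    rw [runFor_succ, step, Instr.exec_det o σ h, PMF.pure_map, PMF.pure_bind]
  | seq hp hq ihp ihq =>
    rename_i c c'
    intro k T
    rw [show T + (c + c' + 1) = (T + c' + c) + 1 by omega, runFor_succ, step, PMF.pure_bind,
      ihp, ihq]
  | branch h ih =>
    intro k T
    rw [← add_assoc, runFor_succ, step, PMF.pure_bind, ih]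
  | loop_zero h =>
    intro k T
    rw [runFor_succ, step, PMF.pure_bind, if_neg (by simpa using h)]
  | loop_succ h hp hq ihp ihq =>
    rename_i c c'
    intro k T
    rw [show T + (c + c' + 1) = (T + c' + c) + 1 by omega, runFor_succ, step, PMF.pure_bind,
      if_pos h, ihp, ihq]

theorem Instr.det_frame (o : Instr) (σ : Store) : Frame o.regs o.arrs σ (o.det σ) := by
  cases o <;>
  · constructor <;> intro x hx <;>
    simp_all [Instr.regs, Instr.arrs, Instr.det, Store.setReg, Store.setArr, Function.update]

/-- The written registers and arrays are read off from the program text. Hence a specification only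
has to mention what a program computes, and all other contents are recovered from the frame. -/
theorem Ex.frame {p : PlainProg} {σ σ' : Store} {c : ℕ} (h : Ex p σ σ' c) :
    Frame p.regs p.arrs σ σ' := by
  induction h with
  | instr o σ h => exact o.det_frame σ
  | seq hp hq ihp ihq =>
    exact (ihp.mono (fun x hx => List.mem_append_left _ hx) fun x hx => List.mem_append_left _ hx).trans
      (ihq.mono (fun x hx => List.mem_append_right _ hx) fun x hx => List.mem_append_right _ hx)
  | branch h ih =>
    refine ih.mono (fun x hx => ?_) fun x hx => ?_
    · simp only [Prog.regs, List.mem_append]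
      split_ifs at hx <;> tauto
    · simp only [Prog.arrs, List.mem_append]
      split_ifs at hx <;> tauto
  | loop_zero h => exact Frame.refl _ _ _
  | loop_succ h hp hq ihp ihq => exact ihp.trans ihq

/-- From `σ` the program `p` deterministically reaches, within `B` steps, a memory that
satisfies `Q`. -/
def WP (p : PlainProg) (B : ℕ) (Q : Store → Prop) (σ : Store) : Prop :=
  ∃ σ' c, Ex p σ σ' c ∧ c ≤ B ∧ Q σ'

namespace WP

theorem mono {p : PlainProg} {B B' : ℕ} {Q Q' : Store → Prop} {σ : Store} (h : WP p B Q σ)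
    (hB : B ≤ B') (hQ : ∀ σ', Frame p.regs p.arrs σ σ' → Q σ' → Q' σ') : WP p B' Q' σ := by
  obtain ⟨σ', c, h1, h2, h3⟩ := h
  exact ⟨σ', c, h1, h2.trans hB, hQ σ' h1.frame h3⟩

theorem instr {o : Instr} {Q : Store → Prop} {σ : Store} (ho : o.isDet = true)
    (hQ : Q (o.det σ)) : WP (.instr o) 1 Q σ := ⟨_, _, Ex.instr o σ ho, le_rfl, hQ⟩

theorem skip {Q : Store → Prop} {σ : Store} (hQ : Q (σ.setReg 99 0)) : WP Prog.skip 1 Q σ :=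
  WP.instr rfl hQ

theorem seq {p q : PlainProg} {B B' : ℕ} {Q : Store → Prop} {σ : Store}
    (h : WP p B (WP q B' Q) σ) : WP (.seq p q) (B + B' + 1) Q σ := by
  obtain ⟨σ', c, h1, h2, σ'', c', h3, h4, h5⟩ := h
  exact ⟨σ'', _, h1.seq h3, by omega, h5⟩

theorem branch {x : ℕ} {p q : PlainProg} {B : ℕ} {Q : Store → Prop} {σ : Store}
    (h1 : σ.reg x ≠ 0 → WP p B Q σ) (h2 : σ.reg x = 0 → WP q B Q σ) :
    WP (.branch x p q) (B + 1) Q σ := by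
  by_cases hx : σ.reg x = 0
  · obtain ⟨σ', c, h3, h4, h5⟩ := h2 hx
    exact ⟨σ', _, Ex.branch (by rwa [if_neg (by simpa using hx)]), by omega, h5⟩
  · obtain ⟨σ', c, h3, h4, h5⟩ := h1 hx
    exact ⟨σ', _, Ex.branch (by rwa [if_pos hx]), by omega, h5⟩

theorem blk {o : Instr} {os : List Instr} {Q : Store → Prop} {σ : Store}
    (ho : (o :: os).all Instr.isDet = true) (hQ : Q (os.foldl (fun τ o => o.det τ) (o.det σ))) :
    WP (Prog.blk o os) (2 * os.length + 1) Q σ := by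
  induction os generalizing o σ with
  | nil => exact WP.instr (by simpa using ho) hQ
  | cons o' os ih =>
    simp only [List.all_cons, Bool.and_eq_true] at ho
    refine (WP.seq (WP.instr ho.1 (ih (by simpa using ho.2) hQ))).mono ?_ fun _ _ h => h
    simp only [List.length_cons]; omega

end WP

/-- `for i = 0, …, (reg n) - 1 do p`; register `t` is used by the loop test, and register `2`
has to hold the number `1`. -/
def Prog.forp (i t n : ℕ) (p : PlainProg) : PlainProg :=
  .seq (Prog.blk (.const i 0) [.sub t n i])
    (.loop t (.seq p (Prog.blk (.add i i 2) [.sub t n i])))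

/-- The rule for `for` loops. The invariant is required to hold after the counter has been
updated. -/
theorem WP.forp {i t n : ℕ} {p : PlainProg} {B : ℕ} {Q : Store → Prop} {σ : Store} (N : ℕ)
    (Inv : ℕ → Store → Prop) (hN : σ.reg n = N) (h1 : σ.reg 2 = 1)
    (hi : i ∉ p.regs) (hn : n ∉ i :: t :: p.regs) (h2 : 2 ∉ i :: t :: p.regs) (hit : i ≠ t)
    (h0 : Inv 0 ((σ.setReg i 0).setReg t N))
    (hstep : ∀ j < N, ∀ σ', Frame (i :: t :: p.regs) p.arrs σ σ' → σ'.reg i = j → Inv j σ' →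
      WP p B (fun σ'' => Inv (j + 1) ((σ''.setReg i (j + 1)).setReg t (N - (j + 1)))) σ')
    (hpost : ∀ σ', Frame (i :: t :: p.regs) p.arrs σ σ' → Inv N σ' → Q σ') :
    WP (Prog.forp i t n p) (N * (B + 5) + 5) Q σ := by
  have hni : n ≠ i := fun h => hn (by simp [h])
  have hnt : n ≠ t := fun h => hn (by simp [h])
  have h2i : 2 ≠ i := fun h => h2 (by simp [h])
  have h2t : 2 ≠ t := fun h => h2 (by simp [h])
  -- Induction on the number `d` of remaining iterations, which is the content of the test register.
  -- Besides the body, an iteration costs 5 steps: 3 for updating the counter, one for the sequence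
  -- and one for the loop test.
  have main : ∀ (d j : ℕ) (σ' : Store), j + d = N → Frame (i :: t :: p.regs) p.arrs σ σ' →
      σ'.reg i = j → σ'.reg t = d → Inv j σ' →
      WP (.loop t (.seq p (Prog.blk (.add i i 2) [.sub t n i]))) (d * (B + 5) + 1) Q σ' := by
    intro d
    induction d with
    | zero =>
      intro j σ' hj hf hi' ht hI
      refine ⟨σ', 1, Ex.loop_zero ht, by omega, hpost σ' hf ?_⟩
      rwa [← hj]
    | succ d ih =>
      intro j σ' hj hf hi' ht hI
      obtain ⟨σ'', c, hx, hc, hI'⟩ := hstep j (by omega) σ' hf hi' hI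
      have hf'' : Frame (i :: t :: p.regs) p.arrs σ σ'' :=
        hf.trans (hx.frame.mono (fun x hx => by simp [hx]) fun a ha => ha)
      have e1 : σ''.reg i = j := (hx.frame.1 i hi).trans hi'
      have e2 : σ''.reg 2 = 1 := (hf''.1 2 h2).trans h1
      have e3 : σ''.reg n = N := (hf''.1 n hn).trans hN
      have hb : Ex (Prog.blk (.add i i 2) [.sub t n i]) σ''
          ((σ''.setReg i (j + 1)).setReg t (N - (j + 1))) (1 + 1 + 1) := by
        have := Ex.seq (Ex.instr (.add i i 2) σ'' rfl)
          (Ex.instr (.sub t n i) _ rfl)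
        simpa [Prog.blk, Instr.det, Store.setReg, e1, e2, e3, hni] using this
      obtain ⟨τ, c', hx', hc', hQ⟩ := ih (j + 1) _ (by omega)
        (hf''.trans (hb.frame.mono (by simp [Prog.blk, Prog.regs, Instr.regs])
          (by simp [Prog.blk, Prog.arrs, Instr.arrs])))
        (by simp [Store.setReg, hit]) (by simp [Store.setReg]; omega) hI'
      refine ⟨τ, _, Ex.loop_succ (by omega) (Ex.seq hx hb) hx', ?_, hQ⟩
      rw [Nat.succ_mul]
      omega
  have hb : Ex (Prog.blk (.const i 0) [.sub t n i]) σ ((σ.setReg i 0).setReg t N) (1 + 1 + 1) := by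
    have := Ex.seq (Ex.instr (.const i 0) σ rfl) (Ex.instr (.sub t n i) _ rfl)
    simpa [Prog.blk, Instr.det, Store.setReg, hN, hni] using this
  obtain ⟨τ, c', hx', hc', hQ⟩ := main N 0 _ (by omega)
    (hb.frame.mono (by simp [Prog.blk, Prog.regs, Instr.regs])
      (by simp [Prog.blk, Prog.arrs, Instr.arrs]))
    (by simp [Store.setReg, hit]) (by simp [Store.setReg]) h0
  exact ⟨τ, _, Ex.seq hb hx', by omega, hQ⟩

/-! ### Execution with random choices -/

/-- From `σ` the programs `ks` are executed one after the other within `B` steps; `ν` is the joint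
law of the final memory and of the number of steps. -/
def Runs (ks : List PlainProg) (σ : Store) (B : ℕ) (ν : PMF (Store × ℕ)) : Prop :=
  (∀ y ∈ ν.support, y.2 ≤ B) ∧ ∀ k T, B ≤ T →
    runFor noOracle T (ks ++ k, σ) = ν.bind fun y => runFor noOracle (T - y.2) (k, y.1)

/-- From `σ` the programs `ks` are executed one after the other within `B` steps; the final memory
satisfies `I`, and `μ` is the law of its image under `obs`. -/
def Law {α : Type*} (ks : List PlainProg) (σ : Store) (B : ℕ) (I : Store → Prop) (obs : Store → α)
    (μ : PMF α) : Prop :=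
  ∃ ν, Runs ks σ B ν ∧ (∀ y ∈ ν.support, I y.1) ∧ ν.map (fun y => obs y.1) = μ

namespace Law

variable {α β : Type*} {ks : List PlainProg} {σ : Store} {B : ℕ} {I : Store → Prop}
  {obs : Store → α} {μ : PMF α}

theorem mono {B' : ℕ} {I' : Store → Prop} (h : Law ks σ B I obs μ) (hB : B ≤ B')
    (hI : ∀ σ', I σ' → I' σ') : Law ks σ B' I' obs μ := by
  obtain ⟨ν, ⟨h1, h2⟩, h3, h4⟩ := h
  exact ⟨ν, ⟨fun y hy => (h1 y hy).trans hB, fun k T hT => h2 k T (hB.trans hT)⟩,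
    fun y hy => hI _ (h3 y hy), h4⟩

theorem map (g : α → β) (h : Law ks σ B I obs μ) :
    Law ks σ B I (fun σ => g (obs σ)) (μ.map g) := by
  obtain ⟨ν, h1, h3, h4⟩ := h
  refine ⟨ν, h1, h3, ?_⟩
  rw [← h4, PMF.map_comp]; rfl

theorem nil (hI : I σ) : Law [] σ 0 I obs (PMF.pure (obs σ)) := by
  refine ⟨PMF.pure (σ, 0), ⟨?_, ?_⟩, ?_, ?_⟩
  · simp
  · intro k T _; simp [PMF.pure_bind]
  · simpa using hI
  · rw [PMF.pure_map]

theorem of_wp {p : PlainProg} {Q : Store → Prop} {a : α} (h : WP p B Q σ)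
    (hQ : ∀ σ', Frame p.regs p.arrs σ σ' → Q σ' → I σ' ∧ obs σ' = a) :
    Law [p] σ B I obs (PMF.pure a) := by
  obtain ⟨σ', c, h1, h2, h3⟩ := h
  obtain ⟨h4, h5⟩ := hQ σ' h1.frame h3
  refine ⟨PMF.pure (σ', c), ⟨?_, ?_⟩, ?_, ?_⟩
  · simpa using h2
  · intro k T hT
    rw [PMF.pure_bind]
    have := h1.sound k (T - c)
    rwa [Nat.sub_add_cancel (h2.trans hT)] at this
  · simpa using h4
  · rw [PMF.pure_map, h5]

/-- Kleisli composition. `I` carries what holds surely after the first part, and the law of the rest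
may depend on the memory only through the observation. Running times depend on the random choices,
so they are added inside the joint law. -/
theorem append {ks' : List PlainProg} {B' : ℕ} {I' : Store → Prop} {obs' : Store → β}
    {κ : α → PMF β} (h : Law ks σ B I obs μ)
    (h' : ∀ σ', I σ' → Law ks' σ' B' I' obs' (κ (obs σ'))) :
    Law (ks ++ ks') σ (B + B') I' obs' (μ.bind κ) := by
  classical
  obtain ⟨ν, ⟨h1, h2⟩, h3, h4⟩ := h
  choose! η hη using h'
  refine ⟨ν.bind fun y => (η y.1).map fun z => (z.1, y.2 + z.2), ⟨?_, ?_⟩, ?_, ?_⟩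
  · intro y hy
    simp only [PMF.mem_support_bind_iff, PMF.mem_support_map_iff] at hy
    obtain ⟨w, hw, z, hz, rfl⟩ := hy
    exact add_le_add (h1 w hw) ((hη _ (h3 w hw)).1.1 z hz)
  · intro k T hT
    rw [List.append_assoc, h2 _ T (by omega), PMF.bind_bind]
    refine PMF.bind_congr_support _ fun y hy => ?_
    have := h1 y hy
    rw [(hη _ (h3 y hy)).1.2 k _ (by omega), PMF.bind_map]
    congr 1
    funext z
    simp [Nat.sub_sub]
  · intro y hy
    simp only [PMF.mem_support_bind_iff, PMF.mem_support_map_iff] at hy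
    obtain ⟨w, hw, z, hz, rfl⟩ := hy
    exact (hη _ (h3 w hw)).2.1 z hz
  · rw [← h4, PMF.bind_map, PMF.map_bind]
    refine PMF.bind_congr_support _ fun y hy => ?_
    rw [PMF.map_comp, Function.comp_def, Function.comp_def]
    exact (hη _ (h3 y hy)).2.2

/-- A random step, followed by an execution. -/
theorem of_step {β : Type*} {p : PlainProg} {I' : Store → Prop} {obs' : Store → β}
    (ρ : PMF (List PlainProg × Store)) (κ : List PlainProg × Store → PMF β)
    (hstep : ∀ k, step noOracle (p :: (ks ++ k), σ) = ρ.map fun c => (c.1 ++ k, c.2))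
    (h : ∀ c ∈ ρ.support, Law c.1 c.2 B I' obs' (κ c)) :
    Law (p :: ks) σ (B + 1) I' obs' (ρ.bind κ) := by
  have : Nonempty (PMF (Store × ℕ)) := ⟨PMF.pure (σ, 0)⟩
  choose! η hη using h
  refine ⟨ρ.bind fun c => (η c).map fun z => (z.1, z.2 + 1), ⟨?_, ?_⟩, ?_, ?_⟩
  · intro y hy
    simp only [PMF.mem_support_bind_iff, PMF.mem_support_map_iff] at hy
    obtain ⟨w, hw, z, hz, rfl⟩ := hy
    exact Nat.succ_le_succ ((hη _ hw).1.1 z hz)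
  · intro k T hT
    obtain ⟨T, rfl⟩ : ∃ T', T = T' + 1 := ⟨T - 1, by omega⟩
    rw [List.cons_append, runFor_succ, hstep, PMF.bind_map, PMF.bind_bind]
    refine PMF.bind_congr_support _ fun c hc => ?_
    simp only [Function.comp_def]
    rw [(hη _ hc).1.2 k T (by omega), PMF.bind_map]
    congr 1
    funext z
    simp
  · intro y hy
    simp only [PMF.mem_support_bind_iff, PMF.mem_support_map_iff] at hy
    obtain ⟨w, hw, z, hz, rfl⟩ := hy
    exact (hη _ hw).2.1 z hz
  · rw [PMF.map_bind]
    refine PMF.bind_congr_support _ fun y hy => ?_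
    rw [PMF.map_comp, Function.comp_def]
    exact (hη _ hy).2.2

theorem of_pure_step {p : PlainProg} {ks' : List PlainProg}
    (hstep : ∀ k, step noOracle (p :: (ks ++ k), σ) = PMF.pure (ks' ++ k, σ))
    (h : Law ks' σ B I obs μ) : Law (p :: ks) σ (B + 1) I obs μ := by
  have := of_step (p := p) (ks := ks) (σ := σ) (B := B) (I' := I) (obs' := obs)
    (PMF.pure (ks', σ)) (fun _ => μ) (fun k => by rw [hstep, PMF.pure_map]) (by simpa using h)
  simpa using this

theorem seq {p q : PlainProg} (h : Law (p :: q :: ks) σ B I obs μ) :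
    Law (.seq p q :: ks) σ (B + 1) I obs μ :=
  of_pure_step (fun _ => rfl) h

theorem branch {x : ℕ} {p q : PlainProg}
    (h : Law ((if σ.reg x ≠ 0 then p else q) :: ks) σ B I obs μ) :
    Law (.branch x p q :: ks) σ (B + 1) I obs μ :=
  of_pure_step (fun _ => rfl) h

theorem loop_succ {x : ℕ} {p : PlainProg} (hx : σ.reg x ≠ 0)
    (h : Law (p :: .loop x p :: ks) σ B I obs μ) :
    Law (.loop x p :: ks) σ (B + 1) I obs μ :=
  of_pure_step (fun _ => by rw [step, if_pos hx]; rfl) h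

theorem loop_zero {x : ℕ} {p : PlainProg} (hx : σ.reg x = 0)
    (h : Law ks σ B I obs μ) :
    Law (.loop x p :: ks) σ (B + 1) I obs μ :=
  of_pure_step (fun _ => by rw [step, if_neg (by simpa using hx)]) h

theorem instr {o : Instr} (κ : Store → PMF α)
    (h : ∀ σ' ∈ (o.exec σ).support, Law ks σ' B I obs (κ σ')) :
    Law (.instr o :: ks) σ (B + 1) I obs ((o.exec σ).bind κ) := by
  have := of_step (p := .instr o) (ks := ks) (σ := σ) (B := B) (I' := I) (obs' := obs)
    ((o.exec σ).map fun σ' => (ks, σ')) (fun c => κ c.2)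
    (fun k => by rw [step, PMF.map_comp]; rfl) (by
      intro c hc
      simp only [PMF.mem_support_map_iff] at hc
      obtain ⟨σ', h', rfl⟩ := hc
      exact h σ' h')
  rwa [PMF.bind_map] at this

/-- Prepend a deterministic program. -/
theorem wp_cons {p : PlainProg} {B' : ℕ} {Q : Store → Prop} (h : WP p B Q σ)
    (h' : ∀ σ', Frame p.regs p.arrs σ σ' → Q σ' → Law ks σ' B' I obs μ) :
    Law (p :: ks) σ (B + B') I obs μ := by
  have h1 : Law [p] σ B (fun σ' => Law ks σ' B' I obs μ) (fun _ => ()) (PMF.pure ()) :=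
    of_wp h fun σ' hf hQ => ⟨h' σ' hf hQ, rfl⟩
  have := h1.append (κ := fun _ => μ) (fun σ' h => h)
  simpa using this

theorem halts {p : PlainProg} {T : ℕ} (h : Law [p] σ B I obs μ) (hT : B ≤ T) :
    HaltsWithin noOracle p σ T := by
  obtain ⟨ν, ⟨h1, h2⟩, h3, h4⟩ := h
  intro c hc
  have e := h2 [] T hT
  simp only [List.append_nil, runFor_nil] at e
  rw [e] at hc
  simp only [PMF.mem_support_bind_iff, PMF.support_pure, Set.mem_singleton_iff] at hc
  obtain ⟨y, _, rfl⟩ := hc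
  rfl

theorem le_outcomeProb {p : PlainProg} {T : ℕ} {E : Store → Prop} {s : Set α}
    (h : Law [p] σ B I obs μ) (hT : B ≤ T) (hs : ∀ σ', I σ' → obs σ' ∈ s → E σ') :
    μ.toOuterMeasure s ≤ outcomeProb noOracle p σ T E := by
  obtain ⟨ν, ⟨h1, h2⟩, h3, h4⟩ := h
  have e := h2 [] T hT
  simp only [List.append_nil, runFor_nil] at e
  rw [outcomeProb, e, ← h4]
  have e2 : (ν.bind fun y => PMF.pure (([], y.1) : Config Empty))
      = ν.map fun y => ([], y.1) := rfl
  rw [e2, PMF.toOuterMeasure_map_apply, PMF.toOuterMeasure_map_apply]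
  exact PMF.toOuterMeasure_mono_support _ fun y hy hs' => ⟨rfl, hs _ (h3 y hy) hs'⟩

end Law

/-! ### The hard function and its potential -/

/-- A list of `m` edges `{eu e, ev e}` on the vertices `0, …, n - 1`, together with the number `ℓ`
of extra copies of each vertex variable. -/
structure EdgeData : Type where
  (n m ℓ : ℕ)
  (eu ev : ℕ → ℕ)

namespace EdgeData

/-- The edges are edges of a simple graph and are listed without repetition. -/
structure Valid (I : EdgeData) : Prop where
  lt_u : ∀ e < I.m, I.eu e < I.n
  lt_v : ∀ e < I.m, I.ev e < I.n
  ne : ∀ e < I.m, I.eu e ≠ I.ev e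
  inj : ∀ e < I.m, ∀ e' < I.m, (I.eu e = I.eu e' ∧ I.ev e = I.ev e') ∨
    (I.eu e = I.ev e' ∧ I.ev e = I.eu e') → e = e'

variable (I : EdgeData)

/-- The value of the variable `(v, j)` at the point `(e, a)`: the point is the indicator function
of all copies of the endpoints of `e`, with the copy `a + 1` of `eu e` removed if `a < ℓ`, and the
copy `a + 1 - ℓ` of `ev e` removed if `ℓ ≤ a < 2 * ℓ`. -/
def pt (ω : ℕ × ℕ) (v j : ℕ) : Bool :=
  decide ((v = I.eu ω.1 ∧ j ≠ ω.2 + 1) ∨ (v = I.ev ω.1 ∧ ¬(1 ≤ j ∧ j + I.ℓ = ω.2 + 1)))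

/-- A history: the list of queried variables with their answers, the last query first. -/
abbrev Hist : Type := List (ℕ × ℕ × Bool)

/-- The point `ω` is consistent with the history. -/
def Cons (h : Hist) (ω : ℕ × ℕ) : Prop := ∀ q ∈ h, I.pt ω q.1 q.2.1 = q.2.2

instance (h : Hist) (ω : ℕ × ℕ) : Decidable (I.Cons h ω) := List.decidableBAll _ h

/-- The edges that are not covered by `W`. -/
def unc (W : Finset ℕ) : Finset ℕ :=
  (Finset.range I.m).filter fun e => I.eu e ∉ W ∧ I.ev e ∉ W

/-- The vertex `v` has an edge that is not covered by `W`. -/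
def Useful (W : Finset ℕ) (v : ℕ) : Prop :=
  ∃ e < I.m, (I.eu e = v ∨ I.ev e = v) ∧ I.eu e ∉ W ∧ I.ev e ∉ W

open Classical in
/-- Add `v` to the partial cover `W` if it covers a new edge. -/
noncomputable def greedy (W : Finset ℕ) (v : ℕ) : Finset ℕ :=
  if I.Useful W v then insert v W else W

/-- The partial cover collected from the queried vertices. -/
noncomputable def cover : Hist → Finset ℕ
  | [] => ∅
  | q :: h => I.greedy (cover h) q.1

/-- The number of vertices of the cover obtained from `W` by adding an endpoint of every
uncovered edge. -/
def cand (W : Finset ℕ) : ℕ := W.card + (I.unc W).card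

/-- The copies of `v` that have not been queried. -/
def free (h : Hist) (v : ℕ) : Finset ℕ :=
  (Finset.Icc 1 I.ℓ).filter fun j => ∀ b, (v, j, b) ∉ h

/-- The indicator function of all copies of the edge `e` is consistent with `h`. -/
def Full (h : Hist) (e : ℕ) : Prop := ∀ q ∈ h, q.2.2 = decide (q.1 = I.eu e ∨ q.1 = I.ev e)

/-- The potential: a lower bound for the number of leaves that are needed after the history
`h`. -/
inductive Pot (k : ℕ) (h : Hist) : ℕ → Prop
  | zero : Pot k h 0
  | one (e a : ℕ) (he : e < I.m) (ha : a < 4 * I.ℓ) (hc : I.Cons h (e, a)) : Pot k h 1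
  | two (e φ : ℕ) (he : e < I.m) (hf : I.Full h e)
      (hφ : φ ≤ (I.free h (I.eu e)).card + (I.free h (I.ev e)).card) : Pot k h φ
  | star (u φ : ℕ) (Y : Finset ℕ) (hY : Y.Nonempty) (hm : ∀ e ∈ Y, e < I.m)
      (hf : ∀ e ∈ Y, I.Full h e)
      (hu : ∀ e ∈ Y, (I.eu e = u ∧ ∀ q ∈ h, q.1 ≠ I.ev e) ∨ (I.ev e = u ∧ ∀ q ∈ h, q.1 ≠ I.eu e))
      (hφ : φ ≤ (I.ℓ - 1) * Y.card + (I.free h u).card) : Pot k h φ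
  | root (φ : ℕ) (hz : ∀ q ∈ h, q.2.2 = false)
      (hφ : φ ≤ (I.ℓ - 1) * ((I.unc (I.cover h)).card + (k - (I.cover h).card))) : Pot k h φ

variable {I}

theorem free_cons_ne {h : Hist} {v w j : ℕ} {b : Bool} (hw : w ≠ v) :
    I.free ((v, j, b) :: h) w = I.free h w := by
  unfold free
  refine Finset.filter_congr fun i _ => ?_
  simp [hw]

theorem free_cons_self {h : Hist} {v j : ℕ} {b : Bool} :
    I.free ((v, j, b) :: h) v = (I.free h v).erase j := by
  ext i
  simp only [free, List.mem_cons, Prod.mk.injEq, true_and, not_or, Finset.mem_filter,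
    Finset.mem_erase]
  constructor
  · rintro ⟨h1, h2⟩
    exact ⟨fun hij => (h2 b).1 ⟨hij, rfl⟩, h1, fun b => (h2 b).2⟩
  · rintro ⟨h1, h2, h3⟩
    exact ⟨h2, fun b => ⟨fun h => h1 h.1, h3 b⟩⟩

theorem free_card_le (h : Hist) (v : ℕ) : (I.free h v).card ≤ I.ℓ := by
  have := Finset.card_filter_le (Finset.Icc 1 I.ℓ) fun j => ∀ b, (v, j, b) ∉ h
  exact this.trans (by simp)

theorem free_of_untouched {h : Hist} {v : ℕ} (hv : ∀ q ∈ h, q.1 ≠ v) :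
    (I.free h v).card = I.ℓ := by
  have : I.free h v = Finset.Icc 1 I.ℓ :=
    Finset.filter_true_of_mem fun j _ b hb => hv _ hb rfl
  rw [this]; simp

theorem mem_unc {W : Finset ℕ} {e : ℕ} : e ∈ I.unc W ↔ e < I.m ∧ I.eu e ∉ W ∧ I.ev e ∉ W := by
  simp [unc]

theorem subset_greedy (W : Finset ℕ) (v : ℕ) : W ⊆ I.greedy W v := by
  unfold greedy
  split_ifs
  · exact Finset.subset_insert _ _
  · exact subset_rfl

/-- A queried vertex that was not added had no uncovered edge at that moment, and the greedy cover
only grows. Hence the ends of an uncovered edge have never been queried, in any of their copies. -/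
theorem covered_of_queried (h : Hist) :
    ∀ q ∈ h, ∀ e < I.m, (I.eu e = q.1 ∨ I.ev e = q.1) →
      I.eu e ∈ I.cover h ∨ I.ev e ∈ I.cover h := by
  induction h with
  | nil => simp
  | cons q h ih =>
    intro q' hq' e he hi
    rcases List.mem_cons.1 hq' with rfl | hq'
    · simp only [cover]
      by_cases hu : I.Useful (I.cover h) q'.1
      · rw [greedy, if_pos hu]
        rcases hi with hi | hi <;> simp [hi]
      · by_contra hcon
        rw [greedy, if_neg hu, not_or] at hcon
        exact hu ⟨e, he, hi, hcon.1, hcon.2⟩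
    · have hs := subset_greedy (I := I) (I.cover h) q.1
      exact (ih q' hq' e he hi).imp (fun h' => hs h') fun h' => hs h'

theorem untouched_of_unc {h : Hist} {e : ℕ} (he : e ∈ I.unc (I.cover h)) :
    ∀ q ∈ h, q.1 ≠ I.eu e ∧ q.1 ≠ I.ev e := by
  intro q hq
  rw [mem_unc] at he
  refine ⟨fun hh => ?_, fun hh => ?_⟩
  · have := covered_of_queried h q hq e he.1 (Or.inl hh.symm); tauto
  · have := covered_of_queried h q hq e he.1 (Or.inr hh.symm); tauto

theorem full_of_unc {h : Hist} (hz : ∀ q ∈ h, q.2.2 = false) {e : ℕ}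
    (he : e ∈ I.unc (I.cover h)) : I.Full h e := by
  intro q hq
  have := untouched_of_unc he q hq
  simp [hz q hq, this.1, this.2]

/-- An index from 2ℓ on would remove a copy with number larger than ℓ, so on the queried variables
it removes nothing. -/
theorem Full.cons_top {h : Hist} {e : ℕ} (hf : I.Full h e) (hj : ∀ q ∈ h, q.2.1 ≤ I.ℓ) {a : ℕ}
    (ha : 2 * I.ℓ ≤ a) : I.Cons h (e, a) := by
  intro q hq
  have := hj q hq
  rw [hf q hq, pt, decide_eq_decide]
  have h1 : q.2.1 ≠ a + 1 := by omega
  have h2 : ¬(1 ≤ q.2.1 ∧ q.2.1 + I.ℓ = a + 1) := by omega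
  simp [h1, h2]

/-- Free copies are numbered from 1, so the index `j - 1` removes precisely the copy `j`, which no
query in `h` has inspected. -/
theorem Full.cons_flip_u {h : Hist} {e : ℕ} (hf : I.Full h e)
    (hj : ∀ q ∈ h, q.2.1 ≤ I.ℓ) {j : ℕ} (ha : j ∈ I.free h (I.eu e)) : I.Cons h (e, j - 1) := by
  intro q hq
  have := hj q hq
  simp only [free, Finset.mem_filter, Finset.mem_Icc] at ha
  obtain ⟨⟨hj1, hj2⟩, hfree⟩ := ha
  rw [hf q hq, pt, decide_eq_decide]
  have h2 : ¬(1 ≤ q.2.1 ∧ q.2.1 + I.ℓ = j - 1 + 1) := by omega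
  simp only [h2, not_false_eq_true, and_true]
  by_cases hqu : q.1 = I.eu e
  · have : q.2.1 ≠ j - 1 + 1 := by
      intro hh
      apply hfree q.2.2
      rw [← hqu, show j = q.2.1 by omega]
      exact hq
    simp [hqu, this]
  · simp [hqu]

theorem Full.cons_flip_v {h : Hist} {e : ℕ} (hf : I.Full h e)
    (hj : ∀ q ∈ h, q.2.1 ≤ I.ℓ) {j : ℕ} (ha : j ∈ I.free h (I.ev e)) :
    I.Cons h (e, I.ℓ + j - 1) := by
  intro q hq
  have := hj q hq
  simp only [free, Finset.mem_filter, Finset.mem_Icc] at ha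
  obtain ⟨⟨hj1, hj2⟩, hfree⟩ := ha
  rw [hf q hq, pt, decide_eq_decide]
  have h1 : q.2.1 ≠ I.ℓ + j - 1 + 1 := by omega
  simp only [h1, ne_eq, not_false_eq_true, and_true]
  by_cases hqu : q.1 = I.ev e
  · have : ¬(1 ≤ q.2.1 ∧ q.2.1 + I.ℓ = I.ℓ + j - 1 + 1) := by
      intro hh
      apply hfree q.2.2
      rw [← hqu, show j = q.2.1 by omega]
      exact hq
    simp [hqu, this]
  · simp [hqu]

theorem Cons.cons {h : Hist} {ω : ℕ × ℕ} (hc : I.Cons h ω) {v j : ℕ} {b : Bool}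
    (hb : I.pt ω v j = b) : I.Cons ((v, j, b) :: h) ω := by
  intro q hq
  rcases List.mem_cons.1 hq with rfl | hq
  · exact hb
  · exact hc q hq

theorem Full.cons {h : Hist} {e : ℕ} (hf : I.Full h e) {v j : ℕ} {b : Bool}
    (hb : b = decide (v = I.eu e ∨ v = I.ev e)) : I.Full ((v, j, b) :: h) e := by
  intro q hq
  rcases List.mem_cons.1 hq with rfl | hq
  · exact hb
  · exact hf q hq

/-- If the unqueried copy `j` of the endpoint `v` of `e` is answered by `0`, then a point remains. -/
theorem Full.one_flip (hI : I.Valid) {k : ℕ} {h : Hist} {e v j : ℕ} (he : e < I.m)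
    (hf : I.Full h e) (hj : ∀ q ∈ h, q.2.1 ≤ I.ℓ) (hv : v = I.eu e ∨ v = I.ev e)
    (hfree : j ∈ I.free h v) : I.Pot k ((v, j, false) :: h) 1 := by
  have hne := hI.ne e he
  have hj' := hfree
  simp only [free, Finset.mem_filter, Finset.mem_Icc] at hj'
  obtain ⟨⟨hj1, hj2⟩, -⟩ := hj'
  rcases hv with rfl | rfl
  · refine .one e (j - 1) he (by omega) ((hf.cons_flip_u hj hfree).cons ?_)
    simp [pt, hne]; omega
  · refine .one e (I.ℓ + j - 1) he (by omega) ((hf.cons_flip_v hj hfree).cons ?_)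
    simp [pt, hne.symm]; omega

/-- This is the heart of the lower bound. The states mean: only zeros have been seen (`root`); the
answers allow edges `Y` at `u` whose other ends are untouched (`star`); one edge is singled out and
its unqueried copies remain to be checked (`two`); some point is left (`one`). A useful query at the
root transfers ℓ - 1 for each newly covered edge, and another ℓ - 1 for the vertex, to a star. A
query at the far end of a star edge transfers ℓ - 1 for that edge to `two`. A query of a free copy
of a vertex known to be on splits off a single point. The term ℓ - 1 instead of ℓ allows for the
copy that is used up by the query itself. -/
theorem Pot.split (hI : I.Valid) {k : ℕ} {h : Hist} {φ : ℕ} (hp : I.Pot k h φ)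
    (hj : ∀ q ∈ h, q.2.1 ≤ I.ℓ) (v j : ℕ) :
    ∃ φ₀ φ₁, I.Pot k ((v, j, false) :: h) φ₀ ∧ I.Pot k ((v, j, true) :: h) φ₁ ∧ φ ≤ φ₀ + φ₁ := by
  cases hp with
  | zero => exact ⟨0, 0, .zero, .zero, le_rfl⟩
  | one e a he ha hc =>
    cases hb : I.pt (e, a) v j
    · exact ⟨1, 0, .one e a he ha (hc.cons hb), .zero, le_rfl⟩
    · exact ⟨0, 1, .zero, .one e a he ha (hc.cons hb), le_rfl⟩
  | two e φ he hf hφ =>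
    have hne := hI.ne e he
    by_cases hv : v = I.eu e ∨ v = I.ev e
    · by_cases hfree : j ∈ I.free h v
      -- The answer 0 leaves the one point in which just this copy is missing; the answer 1 uses up
      -- one free copy.
      · refine ⟨1, φ - 1, hf.one_flip hI he hj hv hfree,
          .two e _ he (hf.cons (by simpa using hv)) ?_, by omega⟩
        have hcard := Finset.card_erase_of_mem hfree
        rcases hv with rfl | rfl
        · rw [free_cons_self, free_cons_ne hne.symm, hcard]; omega
        · rw [free_cons_self, free_cons_ne hne, hcard]; omega
      · refine ⟨0, φ, .zero, .two e _ he (hf.cons (by simpa using hv)) ?_, by omega⟩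
        have hcard := Finset.erase_eq_of_notMem hfree
        rcases hv with rfl | rfl
        · rw [free_cons_self, free_cons_ne hne.symm, hcard]; omega
        · rw [free_cons_self, free_cons_ne hne, hcard]; omega
    · refine ⟨φ, 0, .two e _ he (hf.cons (by simpa using hv)) ?_, .zero, by omega⟩
      rw [not_or] at hv
      rwa [free_cons_ne (Ne.symm hv.1), free_cons_ne (Ne.symm hv.2)]
  | star u φ Y hY hm hf hu hφ =>
    by_cases hvu : v = u
    · subst hvu
      have hinc : ∀ e ∈ Y, v = I.eu e ∨ v = I.ev e := fun e he =>
        (hu e he).imp (fun h => h.1.symm) fun h => h.1.symm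
      have hu' : ∀ e ∈ Y, (I.eu e = v ∧ ∀ q ∈ (v, j, true) :: h, q.1 ≠ I.ev e) ∨
          (I.ev e = v ∧ ∀ q ∈ (v, j, true) :: h, q.1 ≠ I.eu e) := by
        intro e he
        have hne := hI.ne e (hm e he)
        rcases hu e he with ⟨h1, h2⟩ | ⟨h1, h2⟩
        · refine Or.inl ⟨h1, fun q hq => ?_⟩
          rcases List.mem_cons.1 hq with rfl | hq
          · simpa [← h1] using hne
          · exact h2 q hq
        · refine Or.inr ⟨h1, fun q hq => ?_⟩
          rcases List.mem_cons.1 hq with rfl | hq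
          · simpa [← h1] using hne.symm
          · exact h2 q hq
      have hfull : ∀ e ∈ Y, I.Full ((v, j, true) :: h) e := fun e he =>
        (hf e he).cons (by simpa using hinc e he)
      by_cases hfree : j ∈ I.free h v
      · obtain ⟨e, he⟩ := hY
        refine ⟨1, φ - 1, (hf e he).one_flip hI (hm e he) hj (hinc e he) hfree,
          .star v _ Y ⟨e, he⟩ hm hfull hu' ?_, by omega⟩
        rw [free_cons_self, Finset.card_erase_of_mem hfree]
        have := Finset.card_pos.2 ⟨j, hfree⟩
        omega
      · refine ⟨0, φ, .zero, .star v _ Y hY hm hfull hu' ?_, by omega⟩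
        rwa [free_cons_self, Finset.erase_eq_of_notMem hfree]
    · by_cases hex : ∃ e ∈ Y, v = I.eu e ∨ v = I.ev e
      · obtain ⟨e, he, hve⟩ := hex
        have hem := hm e he
        have hne := hI.ne e hem
        have huntouched : ∀ q ∈ h, q.1 ≠ v := by
          rcases hu e he with ⟨h1, h2⟩ | ⟨h1, h2⟩
          · rcases hve with hve | hve
            · exact absurd (hve.trans h1) hvu
            · rwa [hve]
          · rcases hve with hve | hve
            · rwa [hve]
            · exact absurd (hve.trans h1) hvu
        -- The far end `v` was untouched, so all its ℓ copies except possibly the queried one are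
        -- free.
        have h1 : I.Pot k ((v, j, true) :: h) (I.ℓ - 1 + (I.free h u).card) := by
          refine .two e _ hem ((hf e he).cons (by simpa using hve)) ?_
          have hv1 : I.ℓ - 1 ≤ (I.free ((v, j, true) :: h) v).card := by
            rw [free_cons_self, ← free_of_untouched (I := I) huntouched]
            exact Finset.pred_card_le_card_erase
          have hv2 : (I.free ((v, j, true) :: h) u).card = (I.free h u).card := by
            rw [free_cons_ne (Ne.symm hvu)]
          rcases hu e he with ⟨h1, h2⟩ | ⟨h1, h2⟩
          · rcases hve with hve | hve
            · exact absurd (hve.trans h1) hvu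
            · rw [h1, ← hve, hv2]; omega
          · rcases hve with hve | hve
            · rw [h1, ← hve, hv2]; omega
            · exact absurd (hve.trans h1) hvu
        have hcard := Finset.card_erase_of_mem he
        have hpos := Finset.card_pos.2 ⟨e, he⟩
        have hmul : (I.ℓ - 1) * Y.card = (I.ℓ - 1) * (Y.erase e).card + (I.ℓ - 1) := by
          rw [hcard]
          obtain ⟨c, hc⟩ : ∃ c, Y.card = c + 1 := ⟨Y.card - 1, by omega⟩
          rw [hc, Nat.add_sub_cancel, Nat.mul_succ]
        by_cases hY' : (Y.erase e).Nonempty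
        · refine ⟨(I.ℓ - 1) * (Y.erase e).card + (I.free h u).card, _,
            .star u _ (Y.erase e) hY' (fun e' he' => hm e' (Finset.mem_of_mem_erase he')) ?_ ?_ ?_,
            h1, by omega⟩
          · intro e' he'
            obtain ⟨hee', he'⟩ := Finset.mem_erase.1 he'
            refine (hf e' he').cons ?_
            symm
            rw [decide_eq_false_iff_not]
            intro hve'
            refine hee' (hI.inj e' (hm e' he') e hem ?_)
            rcases hu e he with ⟨h1, -⟩ | ⟨h1, -⟩ <;> rcases hu e' he' with ⟨h2, -⟩ | ⟨h2, -⟩ <;>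
              rcases hve with hve | hve <;> rcases hve' with hve' | hve' <;>
              first
                | exact absurd (hve.trans h1) hvu
                | exact absurd (hve'.trans h2) hvu
                | (left; constructor <;> omega)
                | (right; constructor <;> omega)
          · intro e' he'
            obtain ⟨hee', he'⟩ := Finset.mem_erase.1 he'
            have hve' : ¬(v = I.eu e' ∨ v = I.ev e') := by
              intro hve'
              refine hee' (hI.inj e' (hm e' he') e hem ?_)
              rcases hu e he with ⟨h1, -⟩ | ⟨h1, -⟩ <;>
                rcases hu e' he' with ⟨h2, -⟩ | ⟨h2, -⟩ <;>
                rcases hve with hve | hve <;> rcases hve' with hve' | hve' <;>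
                first
                  | exact absurd (hve.trans h1) hvu
                  | exact absurd (hve'.trans h2) hvu
                  | (left; constructor <;> omega)
                  | (right; constructor <;> omega)
            rw [not_or] at hve'
            rcases hu e' he' with ⟨h1, h2⟩ | ⟨h1, h2⟩
            · exact Or.inl ⟨h1, by simpa [hve'.2] using h2⟩
            · exact Or.inr ⟨h1, by simpa [hve'.1] using h2⟩
          · rw [free_cons_ne (Ne.symm hvu)]
        -- If `e` was the last edge of the star, nothing remains for the answer 0, and the single
        -- edge in the other branch accounts for the whole potential.
        · rw [Finset.not_nonempty_iff_eq_empty] at hY'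
          rw [hY'] at hmul
          simp only [Finset.card_empty, mul_zero, zero_add] at hmul
          exact ⟨0, _, .zero, h1, by omega⟩
      · push Not at hex
        refine ⟨φ, 0, .star u _ Y hY hm (fun e he => (hf e he).cons ?_) (fun e he => ?_) ?_, .zero,
          by omega⟩
        · have := hex e he
          simp [this.1, this.2]
        · have := hex e he
          refine (hu e he).imp (fun h' => ⟨h'.1, ?_⟩) fun h' => ⟨h'.1, ?_⟩
          · simpa [this.2] using h'.2
          · simpa [this.1] using h'.2
        · rwa [free_cons_ne (Ne.symm hvu)]
  | root φ hz hφ =>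
    have hz' : ∀ q ∈ (v, j, false) :: h, q.2.2 = false := by simpa using hz
    by_cases hus : I.Useful (I.cover h) v
    · have hcov : I.cover ((v, j, false) :: h) = insert v (I.cover h) := by
        rw [cover, greedy, if_pos hus]
      set W := I.cover h with hW
      set Y := (I.unc W).filter fun e => I.eu e = v ∨ I.ev e = v with hYdef
      have hYne : Y.Nonempty := by
        obtain ⟨e, he, hi, h1, h2⟩ := hus
        exact ⟨e, by simp [hYdef, mem_unc, he, h1, h2, hi]⟩
      obtain ⟨e₀, he₀⟩ := hYne
      have hYm : ∀ e ∈ Y, e ∈ I.unc (I.cover h) := fun e he => (Finset.mem_filter.1 he).1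
      have hYv : ∀ e ∈ Y, I.eu e = v ∨ I.ev e = v := fun e he => (Finset.mem_filter.1 he).2
      have huntouched : ∀ q ∈ h, q.1 ≠ v := by
        intro q hq
        have := untouched_of_unc (hYm e₀ he₀) q hq
        rcases hYv e₀ he₀ with h' | h'
        · rw [← h']; exact this.1
        · rw [← h']; exact this.2
      have hvW : v ∉ W := by
        have := mem_unc.1 (hYm e₀ he₀)
        rcases hYv e₀ he₀ with h' | h'
        · rw [← h']; exact this.2.1
        · rw [← h']; exact this.2.2
      have hunc : (I.unc (insert v W)).card + Y.card = (I.unc W).card := by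
        have : I.unc (insert v W) = (I.unc W).filter fun e => ¬(I.eu e = v ∨ I.ev e = v) := by
          ext e
          simp only [mem_unc, Finset.mem_insert, Finset.mem_filter, not_or]
          tauto
        rw [this, hYdef, add_comm, Finset.card_filter_add_card_filter_not]
      -- The edges newly covered by `v` leave the root and form the star of the branch with answer
      -- 1. The additional ℓ - 1 there, from the free copies of `v`, compensates for the cover
      -- having grown by one vertex.
      refine ⟨(I.ℓ - 1) * ((I.unc (insert v W)).card + (k - (insert v W).card)),
        (I.ℓ - 1) * Y.card + (I.ℓ - 1), .root _ hz' ?_,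
        .star v _ Y ⟨e₀, he₀⟩ (fun e he => (mem_unc.1 (hYm e he)).1) (fun e he => ?_)
          (fun e he => ?_) ?_, ?_⟩
      · rw [hcov]
      · exact (full_of_unc hz (hYm e he)).cons (by
          have := hYv e he
          symm
          rw [decide_eq_true_iff]
          exact this.imp Eq.symm Eq.symm)
      · have hne := hI.ne e (mem_unc.1 (hYm e he)).1
        have := untouched_of_unc (hYm e he)
        refine (hYv e he).imp (fun h' => ⟨h', ?_⟩) fun h' => ⟨h', ?_⟩
        · intro q hq
          rcases List.mem_cons.1 hq with rfl | hq
          · simpa [← h'] using hne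
          · exact (this q hq).2
        · intro q hq
          rcases List.mem_cons.1 hq with rfl | hq
          · simpa [← h'] using hne.symm
          · exact (this q hq).1
      · rw [free_cons_self]
        have h1 := free_of_untouched (I := I) huntouched
        have h2 : (I.free h v).card - 1 ≤ ((I.free h v).erase j).card :=
          Finset.pred_card_le_card_erase
        omega
      · rw [Finset.card_insert_of_notMem hvW]
        refine hφ.trans ?_
        rw [← hunc, ← Nat.mul_succ, ← Nat.mul_add]
        refine Nat.mul_le_mul_left _ ?_
        omega
    -- A vertex without uncovered edges does not change the cover, so the answer 0 keeps the whole
    -- potential.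
    · have hcov : I.cover ((v, j, false) :: h) = I.cover h := by
        rw [cover, greedy, if_neg hus]
      exact ⟨φ, 0, .root _ hz' (by rwa [hcov]), .zero, by omega⟩

end EdgeData

/-! ### Consistent points at a leaf -/

namespace EdgeData

variable {I : EdgeData}

/-- The consistent points with value `0`. -/
def zeros (I : EdgeData) (h : Hist) : Finset (ℕ × ℕ) :=
  (Finset.range I.m ×ˢ Finset.range (4 * I.ℓ)).filter fun ω => I.Cons h ω ∧ ω.2 < 2 * I.ℓ

/-- The consistent points with value `1`. -/
def ones (I : EdgeData) (h : Hist) : Finset (ℕ × ℕ) :=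
  (Finset.range I.m ×ˢ Finset.range (4 * I.ℓ)).filter fun ω => I.Cons h ω ∧ 2 * I.ℓ ≤ ω.2

/-- Free copies of the first endpoint correspond to indices below ℓ and those of the second endpoint
to indices from ℓ to 2ℓ - 1, so different free copies give different points. -/
theorem Full.card_flips {h : Hist} {e : ℕ} (hf : I.Full h e)
    (hj : ∀ q ∈ h, q.2.1 ≤ I.ℓ) :
    (I.free h (I.eu e)).card + (I.free h (I.ev e)).card ≤
      ((Finset.range (4 * I.ℓ)).filter fun a => I.Cons h (e, a) ∧ a < 2 * I.ℓ).card := by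
  have hle : ∀ v, ∀ j ∈ I.free h v, 1 ≤ j ∧ j ≤ I.ℓ := fun v j hj => by
    simpa using (Finset.mem_filter.1 hj).1
  have h1 : ((I.free h (I.eu e)).image fun j => j - 1).card = (I.free h (I.eu e)).card := by
    refine Finset.card_image_of_injOn fun a ha b hb hab => ?_
    have := hle _ a ha
    have := hle _ b hb
    omega
  have h2 : ((I.free h (I.ev e)).image fun j => I.ℓ + j - 1).card = (I.free h (I.ev e)).card := by
    refine Finset.card_image_of_injOn fun a ha b hb hab => ?_
    have := hle _ a ha
    have := hle _ b hb
    omega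
  rw [← h1, ← h2, ← Finset.card_union_of_disjoint]
  · refine Finset.card_le_card fun a ha => ?_
    simp only [Finset.mem_union, Finset.mem_image] at ha
    rcases ha with ⟨j, hj', rfl⟩ | ⟨j, hj', rfl⟩
    · have := hle _ j hj'
      simp only [Finset.mem_filter, Finset.mem_range]
      exact ⟨by omega, hf.cons_flip_u hj hj', by omega⟩
    · have := hle _ j hj'
      simp only [Finset.mem_filter, Finset.mem_range]
      exact ⟨by omega, hf.cons_flip_v hj hj', by omega⟩
  · rw [Finset.disjoint_left]
    intro a ha hb
    simp only [Finset.mem_image] at ha hb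
    obtain ⟨j, hj1, rfl⟩ := ha
    obtain ⟨j', hj2, hj3⟩ := hb
    have := hle _ j hj1
    have := hle _ j' hj2
    omega

theorem card_zeros_ge {h : Hist} (hj : ∀ q ∈ h, q.2.1 ≤ I.ℓ) {Y : Finset ℕ}
    (hY : ∀ e ∈ Y, e < I.m ∧ I.Full h e) :
    ∑ e ∈ Y, ((I.free h (I.eu e)).card + (I.free h (I.ev e)).card) ≤ (I.zeros h).card := by
  rw [zeros, Finset.card_filter, Finset.sum_product]
  refine (Finset.sum_le_sum fun e he => (hY e he).2.card_flips hj).trans ?_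
  simp only [Finset.card_filter]
  exact Finset.sum_le_sum_of_subset fun e he => by simpa using (hY e he).1

/-- All indices from 2ℓ to 4ℓ - 1 stand for the same string, the indicator of the edge. This
multiplicity balances the points of value 1 against the 2ℓ ways to remove a copy. -/
theorem card_ones_ge {h : Hist} (hj : ∀ q ∈ h, q.2.1 ≤ I.ℓ) {Y : Finset ℕ}
    (hY : ∀ e ∈ Y, e < I.m ∧ I.Full h e) : Y.card * (2 * I.ℓ) ≤ (I.ones h).card := by
  have hc : (Y ×ˢ Finset.Ico (2 * I.ℓ) (4 * I.ℓ)).card = Y.card * (2 * I.ℓ) := by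
    rw [Finset.card_product, Nat.card_Ico]
    congr 1; omega
  rw [← hc]
  refine Finset.card_le_card fun ω hω => ?_
  simp only [Finset.mem_product, Finset.mem_Ico] at hω
  simp only [ones, Finset.mem_filter, Finset.mem_product, Finset.mem_range]
  exact ⟨⟨(hY _ hω.1).1, hω.2.2⟩, (hY _ hω.1).2.cons_top hj hω.2.1, hω.2.1⟩

/-- At a leaf with a large cover, the potential is small. -/
theorem Pot.leaf {k : ℕ} {h : Hist} {φ : ℕ} (hp : I.Pot k h φ)
    (hj : ∀ q ∈ h, q.2.1 ≤ I.ℓ) (hk : k ≤ I.cand (I.cover h)) :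
    (φ ≤ 1 ∧ φ ≤ (I.zeros h ∪ I.ones h).card) ∨ (φ ≤ (I.zeros h).card ∧ φ ≤ (I.ones h).card) := by
  cases hp with
  | zero => simp
  | one e a he ha hc =>
    left
    refine ⟨le_rfl, Finset.card_pos.2 ⟨(e, a), ?_⟩⟩
    simp only [zeros, ones, Finset.mem_union, Finset.mem_filter, Finset.mem_product,
      Finset.mem_range]
    have := le_or_gt (2 * I.ℓ) a
    tauto
  | two e φ he hf hφ =>
    right
    have hY : ∀ e' ∈ ({e} : Finset ℕ), e' < I.m ∧ I.Full h e' := by simp [he, hf]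
    have h0 := card_zeros_ge hj hY
    have h1 := card_ones_ge hj hY
    rw [Finset.sum_singleton] at h0
    rw [Finset.card_singleton] at h1
    have := free_card_le (I := I) h (I.eu e)
    have := free_card_le (I := I) h (I.ev e)
    omega
  | star u φ Y hY hm hf hu hφ =>
    right
    have hY' : ∀ e' ∈ Y, e' < I.m ∧ I.Full h e' := fun e he => ⟨hm e he, hf e he⟩
    have h0 := card_zeros_ge hj hY'
    have h1 := card_ones_ge hj hY'
    have h2 : Y.card * (I.ℓ + (I.free h u).card) ≤
        ∑ e ∈ Y, ((I.free h (I.eu e)).card + (I.free h (I.ev e)).card) := by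
      rw [← smul_eq_mul, ← Finset.sum_const]
      refine Finset.sum_le_sum fun e he => ?_
      rcases hu e he with ⟨h1, h2⟩ | ⟨h1, h2⟩
      · rw [h1, free_of_untouched h2]; omega
      · rw [h1, free_of_untouched h2]
    have hq := free_card_le (I := I) h u
    have hpos := Finset.card_pos.2 hY
    -- Each star edge has ℓ free copies at its untouched end, and the free copies of `u` count once
    -- per edge here but only once in the potential.
    have h3 : φ ≤ Y.card * (I.ℓ + (I.free h u).card) := by
      refine hφ.trans ?_
      rw [Nat.mul_add, mul_comm]
      exact add_le_add (Nat.mul_le_mul_left _ (Nat.sub_le _ _)) (Nat.le_mul_of_pos_left _ hpos)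
    have h4 : Y.card * (I.ℓ + (I.free h u).card) ≤ Y.card * (2 * I.ℓ) :=
      Nat.mul_le_mul_left _ (by omega)
    omega
  | root φ hz hφ =>
    right
    have hY : ∀ e ∈ I.unc (I.cover h), e < I.m ∧ I.Full h e := fun e he =>
      ⟨(mem_unc.1 he).1, full_of_unc hz he⟩
    have h0 := card_zeros_ge hj hY
    have h1 := card_ones_ge hj hY
    have h2 : (I.unc (I.cover h)).card * (2 * I.ℓ) ≤
        ∑ e ∈ I.unc (I.cover h), ((I.free h (I.eu e)).card + (I.free h (I.ev e)).card) := by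
      rw [← smul_eq_mul, ← Finset.sum_const]
      refine Finset.sum_le_sum fun e he => ?_
      rw [free_of_untouched fun q hq => (untouched_of_unc he q hq).1,
        free_of_untouched fun q hq => (untouched_of_unc he q hq).2]
      omega
    -- The only use of the large cover: `hk` bounds the second summand `k - (I.cover h).card` by the
    -- number of uncovered edges, each of which has 2ℓ consistent points of either value.
    have h3 : φ ≤ (I.unc (I.cover h)).card * (2 * I.ℓ) := by
      refine hφ.trans ?_
      rw [cand] at hk
      calc _ ≤ I.ℓ * ((I.unc (I.cover h)).card + (I.unc (I.cover h)).card) :=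
            Nat.mul_le_mul (Nat.sub_le _ _) (by omega)
        _ = _ := by ring
    omega

/-! ### The XOR lemma -/

section Xor

variable {r N : ℕ} (dec : Fin N → Fin r × ℕ × ℕ) (par : (Fin r → Bool) → Bool)

/-- The input given by `r` points. -/
def point (I : EdgeData) (dec : Fin N → Fin r × ℕ × ℕ) (ω : Fin r → ℕ × ℕ) : Fin N → Bool :=
  fun x => I.pt (ω (dec x).1) (dec x).2.1 (dec x).2.2

/-- The value at the input given by `r` points. -/
def value (I : EdgeData) (par : (Fin r → Bool) → Bool) (ω : Fin r → ℕ × ℕ) : Bool :=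
  par fun i => decide (2 * I.ℓ ≤ (ω i).2)

/-- The choices of `r` points that are consistent with the histories `H` and on which `T` errs. -/
def errors (I : EdgeData) (dec : Fin N → Fin r × ℕ × ℕ) (par : (Fin r → Bool) → Bool)
    (T : DTree N) (H : Fin r → Hist) : Finset (Fin r → ℕ × ℕ) :=
  (Fintype.piFinset fun _ : Fin r => Finset.range I.m ×ˢ Finset.range (4 * I.ℓ)).filter fun ω =>
    (∀ i, I.Cons (H i) (ω i)) ∧ T.eval (I.point dec ω) ≠ I.value par ω

/-- At every leaf of `T`, all blocks have large covers. -/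
def LargeLeaves (I : EdgeData) (dec : Fin N → Fin r × ℕ × ℕ) (k : ℕ) :
    DTree N → (Fin r → Hist) → Prop
  | .leaf _, H => ∀ i, k ≤ I.cand (I.cover (H i))
  | .node x T T', H =>
    LargeLeaves I dec k T (Function.update H (dec x).1
      (((dec x).2.1, (dec x).2.2, false) :: H (dec x).1)) ∧
    LargeLeaves I dec k T' (Function.update H (dec x).1
      (((dec x).2.1, (dec x).2.2, true) :: H (dec x).1))

variable {dec par}

theorem mem_errors {T : DTree N} {H : Fin r → Hist} {ω : Fin r → ℕ × ℕ} :
    ω ∈ I.errors dec par T H ↔ (∀ i, (ω i).1 < I.m ∧ (ω i).2 < 4 * I.ℓ) ∧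
      (∀ i, I.Cons (H i) (ω i)) ∧ T.eval (I.point dec ω) ≠ I.value par ω := by
  simp [errors]

/-- A leaf outputs one fixed bit. Match φ points of value 0 in the block `i₀` with φ points of value
1; for every choice of the other blocks, exchanging matched points changes the parity, so one point
of each pair is an error. -/
theorem prod_le_errors (hpar : ∀ g i, par (Function.update g i (!g i)) = !par g) {b : Bool}
    {H : Fin r → Hist} {φ : Fin r → ℕ} {i₀ : Fin r} (h0 : φ i₀ ≤ (I.zeros (H i₀)).card)
    (h1 : φ i₀ ≤ (I.ones (H i₀)).card)
    (hφ : ∀ i, φ i ≤ (I.zeros (H i) ∪ I.ones (H i)).card) :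
    ∏ i, φ i ≤ (I.errors dec par (.leaf b) H).card := by
  obtain ⟨Z, hZ, hZc⟩ := Finset.exists_subset_card_eq h0
  obtain ⟨O, hO, hOc⟩ := Finset.exists_subset_card_eq h1
  obtain ⟨g, hg⟩ : ∃ g : ℕ × ℕ → ℕ × ℕ, Set.BijOn g Z O := by
    have e : Z ≃ O := Finset.equivOfCardEq (hZc.trans hOc.symm)
    refine ⟨fun ω => if h : ω ∈ Z then e ⟨ω, h⟩ else ω, ?_, ?_, ?_⟩
    · intro ω hω
      have hω' : ω ∈ Z := hω
      simp [hω']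
    · intro ω hω ω' hω' h
      have h1 : ω ∈ Z := hω
      have h2 : ω' ∈ Z := hω'
      simp only [h1, h2, dif_pos] at h
      have := e.injective (Subtype.ext h)
      simpa using this
    · intro ω hω
      refine ⟨e.symm ⟨ω, hω⟩, (e.symm ⟨ω, hω⟩).2, ?_⟩
      simp
  set C : Fin r → Finset (ℕ × ℕ) := fun i => if i = i₀ then Z else I.zeros (H i) ∪ I.ones (H i)
    with hC
  have hcard : ∏ i, φ i ≤ (Fintype.piFinset C).card := by
    rw [Fintype.card_piFinset]
    refine Finset.prod_le_prod (fun _ _ => Nat.zero_le _) fun i _ => ?_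
    by_cases hi : i = i₀
    · subst hi; simp [hC, hZc]
    · simpa [hC, hi] using hφ i
  refine hcard.trans ?_
  classical
  set F : (Fin r → ℕ × ℕ) → Fin r → ℕ × ℕ := fun ω =>
    if b ≠ I.value par ω then ω else Function.update ω i₀ (g (ω i₀)) with hF
  have hval : ∀ ω : Fin r → ℕ × ℕ, ω i₀ ∈ Z →
      I.value par (Function.update ω i₀ (g (ω i₀))) = !I.value par ω := by
    intro ω hω
    have e0 : (ω i₀).2 < 2 * I.ℓ := (Finset.mem_filter.1 (hZ hω)).2.2
    have e1 : 2 * I.ℓ ≤ (g (ω i₀)).2 := (Finset.mem_filter.1 (hO (hg.mapsTo hω))).2.2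
    rw [value, value, ← hpar _ i₀]
    congr 1
    funext i
    by_cases hi : i = i₀
    · subst hi; simp [e1, e0]
    · simp [hi]
  have hZm : ∀ ω ∈ Fintype.piFinset C, ω i₀ ∈ Z := fun ω hω => by
    have := Fintype.mem_piFinset.1 hω i₀
    simpa [hC] using this
  have hmem : ∀ ω ∈ Fintype.piFinset C, ∀ i, ω i ∈ I.zeros (H i) ∪ I.ones (H i) := fun ω hω i => by
    have := Fintype.mem_piFinset.1 hω i
    by_cases hi : i = i₀
    · subst hi; exact Finset.mem_union_left _ (hZ (hZm ω hω))
    · simpa [hC, hi] using this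
  have hbase : ∀ h : Hist, ∀ ω ∈ I.zeros h ∪ I.ones h,
      (ω.1 < I.m ∧ ω.2 < 4 * I.ℓ) ∧ I.Cons h ω := by
    intro h ω hω
    simp only [zeros, ones, Finset.mem_union, Finset.mem_filter, Finset.mem_product,
      Finset.mem_range] at hω
    tauto
  refine Finset.card_le_card_of_injOn F ?_ ?_
  · intro ω hω
    have hω : ω ∈ Fintype.piFinset C := hω
    rw [Finset.mem_coe, mem_errors, hF]
    simp only
    split_ifs with hb
    · exact ⟨fun i => (hbase _ _ (hmem ω hω i)).1, fun i => (hbase _ _ (hmem ω hω i)).2, hb⟩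
    · have hmem' : ∀ i, Function.update ω i₀ (g (ω i₀)) i ∈ I.zeros (H i) ∪ I.ones (H i) := by
        intro i
        by_cases hi : i = i₀
        · subst hi
          rw [Function.update_self]
          exact Finset.mem_union_right _ (hO (hg.mapsTo (hZm ω hω)))
        · rw [Function.update_of_ne hi]; exact hmem ω hω i
      refine ⟨fun i => (hbase _ _ (hmem' i)).1, fun i => (hbase _ _ (hmem' i)).2, ?_⟩
      rw [hval ω (hZm ω hω)]
      simp only [ne_eq, not_not] at hb
      simp [DTree.eval, hb]
  · intro ω hω ω' hω' heq
    have hω : ω ∈ Fintype.piFinset C := hω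
    have hω' : ω' ∈ Fintype.piFinset C := hω'
    have hne : ∀ i, i ≠ i₀ → ω i = ω' i := by
      intro i hi
      have := congrFun heq i
      simp only [hF] at this
      split_ifs at this <;> simpa [hi] using this
    have e0 : ∀ ω ∈ Fintype.piFinset C, (ω i₀).2 < 2 * I.ℓ := fun ω hω =>
      (Finset.mem_filter.1 (hZ (hZm ω hω))).2.2
    -- The entries at `i₀` come from `Z` and all have value 0, so whether `F` exchanges a point
    -- depends only on the other coordinates, which `F` preserves. Hence `F` is injective.
    have hv : I.value par ω = I.value par ω' := by
      unfold value
      congr 1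
      funext i
      by_cases hi : i = i₀
      · subst hi
        have := e0 ω hω
        have := e0 ω' hω'
        rw [decide_eq_decide]; omega
      · rw [hne i hi]
    have h0 := congrFun heq i₀
    simp only [hF, hv] at h0
    have : ω i₀ = ω' i₀ := by
      split_ifs at h0
      · exact h0
      · simp only [Function.update_self] at h0
        exact hg.injOn (hZm ω hω) (hZm ω' hω') h0
    funext i
    by_cases hi : i = i₀
    · subst hi; exact this
    · exact hne i hi

/-- Consistency with the extended history fixes the value of the queried variable. So the two sets
are disjoint, and their points follow the respective subtree. -/
theorem errors_node {x : Fin N} {T T' : DTree N} {H : Fin r → Hist} :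
    (I.errors dec par T (Function.update H (dec x).1
      (((dec x).2.1, (dec x).2.2, false) :: H (dec x).1))).card +
    (I.errors dec par T' (Function.update H (dec x).1
      (((dec x).2.1, (dec x).2.2, true) :: H (dec x).1))).card ≤
    (I.errors dec par (.node x T T') H).card := by
  have key : ∀ (b : Bool) (ω : Fin r → ℕ × ℕ),
      (∀ i, I.Cons (Function.update H (dec x).1 (((dec x).2.1, (dec x).2.2, b) :: H (dec x).1) i)
        (ω i)) → I.point dec ω x = b ∧ ∀ i, I.Cons (H i) (ω i) := by
    intro b ω h
    have hx := h (dec x).1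
    rw [Function.update_self] at hx
    refine ⟨hx _ List.mem_cons_self, fun i => ?_⟩
    by_cases hi : i = (dec x).1
    · rw [hi]; exact fun q hq => hx q (List.mem_cons_of_mem _ hq)
    · have := h i
      rwa [Function.update_of_ne hi] at this
  rw [← Finset.card_union_of_disjoint]
  · refine Finset.card_le_card fun ω hω => ?_
    rw [Finset.mem_union, mem_errors, mem_errors] at hω
    rw [mem_errors]
    rcases hω with ⟨h1, h2, h3⟩ | ⟨h1, h2, h3⟩
    · obtain ⟨h4, h5⟩ := key _ _ h2
      exact ⟨h1, h5, by simpa [DTree.eval, h4] using h3⟩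
    · obtain ⟨h4, h5⟩ := key _ _ h2
      exact ⟨h1, h5, by simpa [DTree.eval, h4] using h3⟩
  · rw [Finset.disjoint_left]
    intro ω h1 h2
    have h1 := (key _ _ (mem_errors.1 h1).2.1).1
    have h2 := (key _ _ (mem_errors.1 h2).2.1).1
    rw [h1] at h2
    exact Bool.noConfusion h2

/-- A query extends the history of one block, so the product splits as that factor does, with the
other factors constant. At a leaf, either all factors are at most 1 and the leaf itself pays, or one
block has enough consistent points of both values and errors pay. -/
theorem prod_pot_le (hI : I.Valid) (hdec : ∀ x, (dec x).2.2 ≤ I.ℓ)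
    (hpar : ∀ g i, par (Function.update g i (!g i)) = !par g) {k : ℕ} (T : DTree N)
    (H : Fin r → Hist) (hj : ∀ i, ∀ q ∈ H i, q.2.1 ≤ I.ℓ) (φ : Fin r → ℕ)
    (hφ : ∀ i, I.Pot k (H i) (φ i)) (hT : I.LargeLeaves dec k T H) :
    ∏ i, φ i ≤ T.size + (I.errors dec par T H).card := by
  induction T generalizing H φ with
  | leaf b =>
    have hl := fun i => (hφ i).leaf (hj i) (hT i)
    by_cases hex : ∃ i, φ i ≤ (I.zeros (H i)).card ∧ φ i ≤ (I.ones (H i)).card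
    · obtain ⟨i₀, h0, h1⟩ := hex
      refine (prod_le_errors hpar h0 h1 fun i => ?_).trans (Nat.le_add_left _ _)
      rcases hl i with h | h
      · exact h.2
      · exact h.1.trans (Finset.card_le_card Finset.subset_union_left)
    · push Not at hex
      have : ∏ i, φ i ≤ 1 := Finset.prod_le_one' fun i _ => by
        rcases hl i with h | h
        · exact h.1
        · exact absurd h.2 (by have := hex i h.1; omega)
      exact this.trans (Nat.le_add_right _ _)
  | node x T T' ih ih' =>
    obtain ⟨φ₀, φ₁, h0, h1, hle⟩ := (hφ (dec x).1).split hI (hj _) (dec x).2.1 (dec x).2.2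
    have hj' : ∀ b, ∀ i, ∀ q ∈ Function.update H (dec x).1
        (((dec x).2.1, (dec x).2.2, b) :: H (dec x).1) i, q.2.1 ≤ I.ℓ := by
      intro b i q hq
      by_cases hi : i = (dec x).1
      · subst hi
        rw [Function.update_self] at hq
        rcases List.mem_cons.1 hq with rfl | hq
        · exact hdec x
        · exact hj _ q hq
      · rw [Function.update_of_ne hi] at hq
        exact hj _ q hq
    have hφ' : ∀ b ψ, I.Pot k (((dec x).2.1, (dec x).2.2, b) :: H (dec x).1) ψ → ∀ i,
        I.Pot k (Function.update H (dec x).1 (((dec x).2.1, (dec x).2.2, b) :: H (dec x).1) i)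
          (Function.update φ (dec x).1 ψ i) := by
      intro b ψ hψ i
      by_cases hi : i = (dec x).1
      · subst hi; simpa using hψ
      · simpa [hi] using hφ i
    have e0 := ih _ (hj' false) _ (hφ' false φ₀ h0) hT.1
    have e1 := ih' _ (hj' true) _ (hφ' true φ₁ h1) hT.2
    have e2 := errors_node (I := I) (dec := dec) (par := par) (x := x) (T := T) (T' := T') (H := H)
    have hprod : ∀ ψ, ∏ i, Function.update φ (dec x).1 ψ i =
        ψ * ∏ i ∈ Finset.univ \ {(dec x).1}, φ i := fun ψ =>
      Finset.prod_update_of_mem (Finset.mem_univ _) _ _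
    have hprod' : ∏ i, φ i = φ (dec x).1 * ∏ i ∈ Finset.univ \ {(dec x).1}, φ i := by
      conv_lhs => rw [← Function.update_eq_self (dec x).1 φ]
      exact hprod _
    rw [hprod] at e0 e1
    rw [hprod', DTree.size]
    have := Nat.mul_le_mul_right (∏ i ∈ Finset.univ \ {(dec x).1}, φ i) hle
    rw [Nat.add_mul] at this
    omega

/-- The lower bound for the size of a tree all of whose leaves have large covers. -/
theorem pow_le_size (hI : I.Valid) (hdec : ∀ x, (dec x).2.2 ≤ I.ℓ)
    (hpar : ∀ g i, par (Function.update g i (!g i)) = !par g) {k : ℕ} (T : DTree N)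
    (hT : I.LargeLeaves dec k T fun _ => []) :
    ((I.ℓ - 1) * (I.m + k)) ^ r ≤ T.size + (I.errors dec par T fun _ => []).card := by
  have := prod_pot_le (par := par) hI hdec hpar T (fun _ => []) (by simp)
    (fun _ => (I.ℓ - 1) * (I.m + k))
    (fun _ => .root _ (by simp) (by simp [cover, unc])) hT
  simpa using this

end Xor

end EdgeData

namespace EdgeData

variable {I : EdgeData}

/-! ### The target function -/

open Classical in
/-- The target on one block: exactly two vertices are switched on, they form an edge, and all
their copies are switched on. The copy `j` of the vertex `v` is the variable `j * n + v`. -/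
noncomputable def blockFun (I : EdgeData) (x : ℕ → Bool) : Bool :=
  decide (((Finset.range I.n).filter fun v => x v = true).card = 2 ∧
    (∃ e < I.m, x (I.eu e) = true ∧ x (I.ev e) = true) ∧
    ∀ v < I.n, x v = true → ∀ j, 1 ≤ j → j ≤ I.ℓ → x (j * I.n + v) = true)

/-- The number of variables of a block. -/
def width (I : EdgeData) : ℕ := I.n * (I.ℓ + 1)

/-- The target: the parity of the values of the first `r` blocks. -/
noncomputable def target (I : EdgeData) : ℕ → (ℕ → Bool) → Bool
  | 0, _ => false
  | r + 1, x => xor (target I r x) (I.blockFun fun z => x (r * I.width + z))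

/-- The extension by `false` of a string to an infinite sequence. -/
def extend {N : ℕ} (x : Fin N → Bool) : ℕ → Bool := fun j => if h : j < N then x ⟨j, h⟩ else false

theorem blockFun_eq_true {x : ℕ → Bool} : I.blockFun x = true ↔
    ((Finset.range I.n).filter fun v => x v = true).card = 2 ∧
    (∃ e < I.m, x (I.eu e) = true ∧ x (I.ev e) = true) ∧
    ∀ v < I.n, x v = true → ∀ j, 1 ≤ j → j ≤ I.ℓ → x (j * I.n + v) = true := by
  simp [blockFun]

theorem lt_width {v j : ℕ} (hv : v < I.n) (hj : j ≤ I.ℓ) : j * I.n + v < I.width := by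
  unfold width
  calc j * I.n + v < j * I.n + I.n := by omega
    _ = I.n * (j + 1) := by ring
    _ ≤ _ := Nat.mul_le_mul_left _ (by omega)

theorem blockFun_congr (hI : I.Valid) {x y : ℕ → Bool} (h : ∀ z < I.width, x z = y z) :
    I.blockFun x = I.blockFun y := by
  have h0 : ∀ v < I.n, x v = y v := fun v hv => h v (by
    have := lt_width (I := I) hv (Nat.zero_le _); simpa using this)
  have key : ∀ {x y : ℕ → Bool}, (∀ z < I.width, x z = y z) → (∀ v < I.n, x v = y v) →
      I.blockFun x = true → I.blockFun y = true := by
    intro x y h h0 hx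
    rw [blockFun_eq_true] at hx ⊢
    obtain ⟨h1, ⟨e, he, h2, h3⟩, h4⟩ := hx
    refine ⟨?_, ⟨e, he, ?_, ?_⟩, ?_⟩
    · rw [← h1]
      congr 1
      refine Finset.filter_congr fun v hv => ?_
      rw [h0 v (by simpa using hv)]
    · rwa [← h0 _ (hI.lt_u e he)]
    · rwa [← h0 _ (hI.lt_v e he)]
    · intro v hv hyv j hj hj'
      rw [← h _ (lt_width hv hj')]
      exact h4 v hv (by rwa [h0 v hv]) j hj hj'
  exact Bool.eq_iff_iff.2 ⟨key h h0, key (fun z hz => (h z hz).symm) fun v hv => (h0 v hv).symm⟩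

theorem target_congr (hI : I.Valid) {r : ℕ} {x y : ℕ → Bool}
    (h : ∀ z < r * I.width, x z = y z) : I.target r x = I.target r y := by
  induction r with
  | zero => rfl
  | succ r ih =>
    rw [Nat.succ_mul] at h
    rw [target, target, ih fun z hz => h z (by omega),
      blockFun_congr hI fun z hz => h (r * I.width + z) (by omega)]

/-- No point has a copy 0 of its endpoints removed, so exactly the two endpoints are on. The index
only decides whether one of the copies 1, …, ℓ is missing. -/
theorem blockFun_point (hI : I.Valid) {ω : ℕ × ℕ} (h1 : ω.1 < I.m) (h2 : ω.2 < 4 * I.ℓ)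
    {x : ℕ → Bool} (hx : ∀ v < I.n, ∀ j ≤ I.ℓ, x (j * I.n + v) = I.pt ω v j) :
    I.blockFun x = decide (2 * I.ℓ ≤ ω.2) := by
  have hu := hI.lt_u _ h1
  have hv := hI.lt_v _ h1
  have hne := hI.ne _ h1
  have h0 : ∀ v < I.n, x v = decide (v = I.eu ω.1 ∨ v = I.ev ω.1) := by
    intro v hv
    have := hx v hv 0 (Nat.zero_le _)
    simpa [pt] using this
  rw [Bool.eq_iff_iff, blockFun_eq_true, decide_eq_true_iff]
  constructor
  · rintro ⟨-, -, h4⟩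
    by_contra hlt
    by_cases ha : ω.2 < I.ℓ
    · have := h4 _ hu (by simp [h0 _ hu]) (ω.2 + 1) (by omega) (by omega)
      rw [hx _ hu _ (by omega)] at this
      simp [pt, hne] at this
    · have := h4 _ hv (by simp [h0 _ hv]) (ω.2 + 1 - I.ℓ) (by omega) (by omega)
      rw [hx _ hv _ (by omega)] at this
      simp [pt, hne.symm] at this
      omega
  · intro ha
    refine ⟨?_, ⟨_, h1, by simp [h0 _ hu], by simp [h0 _ hv]⟩, ?_⟩
    · have : ((Finset.range I.n).filter fun v => x v = true) = {I.eu ω.1, I.ev ω.1} := by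
        ext v
        simp only [Finset.mem_filter, Finset.mem_range, Finset.mem_insert, Finset.mem_singleton]
        constructor
        · rintro ⟨h, h'⟩
          simpa [h0 v h] using h'
        · intro h
          have hvn : v < I.n := by rcases h with rfl | rfl <;> assumption
          exact ⟨hvn, by simpa [h0 v hvn] using h⟩
      rw [this, Finset.card_pair hne]
    · intro v hvn hxv j hj hj'
      rw [h0 v hvn, decide_eq_true_iff] at hxv
      rw [hx v hvn j hj', pt, decide_eq_true_iff]
      rcases hxv with hxv | hxv
      · exact Or.inl ⟨hxv, by omega⟩
      · exact Or.inr ⟨hxv, by omega⟩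

/-! ### A small tree for the target -/

section Tree

variable {N : ℕ} (w : ℕ → Fin N)

/-- Check that the variables in the list are `1`, and continue with `t`. -/
def checkOnes : List ℕ → DTree N → DTree N
  | [], t => t
  | z :: zs, t => .node (w z) (.leaf false) (checkOnes zs t)

/-- Check that the variables in the list are `0`, and continue with `t`. -/
def checkZeros : List ℕ → DTree N → DTree N
  | [], t => t
  | z :: zs, t => .node (w z) (checkZeros zs t) (.leaf false)

theorem size_checkOnes (l : List ℕ) (t : DTree N) :
    (checkOnes w l t).size = l.length + t.size := by
  induction l with
  | nil => simp [checkOnes]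
  | cons z zs ih => simp only [checkOnes, DTree.size, ih, List.length_cons]; omega

theorem size_checkZeros (l : List ℕ) (t : DTree N) :
    (checkZeros w l t).size = l.length + t.size := by
  induction l with
  | nil => simp [checkZeros]
  | cons z zs ih => simp only [checkZeros, DTree.size, ih, List.length_cons]; omega

theorem eval_checkOnes (l : List ℕ) (t : DTree N) (x : Fin N → Bool) :
    (checkOnes w l t).eval x = (decide (∀ z ∈ l, x (w z) = true) && t.eval x) := by
  induction l with
  | nil => simp [checkOnes]
  | cons z zs ih => cases h : x (w z) <;> simp [checkOnes, DTree.eval, ih, h]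

theorem eval_checkZeros (l : List ℕ) (t : DTree N) (x : Fin N → Bool) :
    (checkZeros w l t).eval x = (decide (∀ z ∈ l, x (w z) = false) && t.eval x) := by
  induction l with
  | nil => simp [checkZeros]
  | cons z zs ih => cases h : x (w z) <;> simp [checkZeros, DTree.eval, ih, h]

/-- The variables of the copies `1, …, ℓ` of `v`. -/
def copies (I : EdgeData) (v : ℕ) : List ℕ := (List.range I.ℓ).map fun j => (j + 1) * I.n + v

theorem forall_copies {v : ℕ} {p : ℕ → Prop} :
    (∀ z ∈ I.copies v, p z) ↔ ∀ j, 1 ≤ j → j ≤ I.ℓ → p (j * I.n + v) := by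
  simp only [copies, List.mem_map, List.mem_range, forall_exists_index, and_imp,
    forall_apply_eq_imp_iff₂]
  constructor
  · intro h j hj hj'
    have := h (j - 1) (by omega)
    rwa [Nat.sub_add_cancel hj] at this
  · intro h j hj
    exact h (j + 1) (by omega) (by omega)

/-- With `u` switched on, search for a second vertex in the list. -/
def searchSecond (I : EdgeData) (u : ℕ) : List ℕ → DTree N
  | [] => .leaf false
  | v :: vs => .node (w v) (searchSecond I u vs)
      (checkOnes w (I.copies v)
        (checkZeros w ((List.range I.n).filter fun z => z ≠ u ∧ z ≠ v) (.leaf true)))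

/-- The endpoint of `e` other than `u`. -/
def other (I : EdgeData) (u e : ℕ) : ℕ := if I.eu e = u then I.ev e else I.eu e

/-- Search for a vertex in the list; the edges outside `E` are known not to be switched on. -/
noncomputable def searchFirst (I : EdgeData) : List ℕ → Finset ℕ → DTree N
  | [], _ => .leaf false
  | u :: us, E => .node (w u)
      (searchFirst I us (E.filter fun e => ¬(I.eu e = u ∨ I.ev e = u)))
      (checkOnes w (I.copies u) (searchSecond w I u
        ((E.filter fun e => I.eu e = u ∨ I.ev e = u).toList.map (I.other u))))

theorem size_searchSecond (u : ℕ) (vs : List ℕ) :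
    (searchSecond w I u vs).size ≤ 1 + vs.length * (I.ℓ + I.n + 1) := by
  induction vs with
  | nil => simp [searchSecond, DTree.size]
  | cons v vs ih =>
    simp only [searchSecond, DTree.size, size_checkOnes, size_checkZeros, List.length_cons]
    have h1 : (I.copies v).length = I.ℓ := by simp [copies]
    have h2 := List.length_filter_le (fun z => decide (z ≠ u ∧ z ≠ v)) (List.range I.n)
    rw [List.length_range] at h2
    rw [Nat.succ_mul]
    omega

/-- Once `u` has been seen to be off, the edges at `u` leave `E`. So on the whole each edge is
charged only at the first vertex of the list that is incident to it, and the vertices pay just for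
their copies. -/
theorem size_searchFirst (us : List ℕ) (E : Finset ℕ) :
    (searchFirst w I us E).size ≤ 1 + us.length * (I.ℓ + 1) + E.card * (I.ℓ + I.n + 1) := by
  induction us generalizing E with
  | nil => simp [searchFirst, DTree.size]
  | cons u us ih =>
    simp only [searchFirst, DTree.size, size_checkOnes, List.length_cons]
    have h1 : (I.copies u).length = I.ℓ := by simp [copies]
    have h2 := ih (E.filter fun e => ¬(I.eu e = u ∨ I.ev e = u))
    have h3 := size_searchSecond (I := I) w u
      ((E.filter fun e => I.eu e = u ∨ I.ev e = u).toList.map (I.other u))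
    rw [List.length_map, Finset.length_toList] at h3
    have h4 := Finset.card_filter_add_card_filter_not (s := E) fun e => I.eu e = u ∨ I.ev e = u
    rw [← h4, Nat.succ_mul, Nat.add_mul]
    omega

/-- As soon as some `v` is found to be on, it forms an edge with `u`, and it remains to check the
copies of `v` and that no third vertex is on. The hypothesis `hex` says that a partner outside the
list cannot make the value 1. -/
theorem eval_searchSecond {x : Fin N → Bool} {u : ℕ} (hun : u < I.n)
    (hu : x (w u) = true) (huc : ∀ j, 1 ≤ j → j ≤ I.ℓ → x (w (j * I.n + u)) = true)
    (vs : List ℕ) (hvs : ∀ v ∈ vs, v < I.n ∧ v ≠ u ∧ ∃ e < I.m, (I.eu e = u ∧ I.ev e = v) ∨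
      (I.ev e = u ∧ I.eu e = v))
    (hex : I.blockFun (fun z => x (w z)) = true → ∃ v ∈ vs, x (w v) = true) :
    (searchSecond w I u vs).eval x = I.blockFun fun z => x (w z) := by
  induction vs with
  | nil =>
    cases h : I.blockFun fun z => x (w z)
    · rfl
    · simpa using hex h
  | cons v vs ih =>
    cases hv : x (w v)
    · simp only [searchSecond, DTree.eval, hv]
      refine ih (fun v' hv' => hvs v' (List.mem_cons_of_mem _ hv')) fun h => ?_
      obtain ⟨v', hv', h'⟩ := hex h
      rcases List.mem_cons.1 hv' with rfl | hv'
      · rw [hv] at h'; exact absurd h' (by simp)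
      · exact ⟨v', hv', h'⟩
    · simp only [searchSecond, DTree.eval, hv, if_true, eval_checkOnes, eval_checkZeros,
        Bool.and_true]
      obtain ⟨hvn, hvu, e, he, hev⟩ := hvs v List.mem_cons_self
      have hsub : ({u, v} : Finset ℕ) ⊆ (Finset.range I.n).filter fun z => x (w z) = true := by
        intro z hz
        simp only [Finset.mem_insert, Finset.mem_singleton] at hz
        rcases hz with rfl | rfl <;> simp [hun, hvn, hu, hv]
      rw [Bool.eq_iff_iff, Bool.and_eq_true, decide_eq_true_iff, decide_eq_true_iff,
        blockFun_eq_true, forall_copies (p := fun z => x (w z) = true)]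
      constructor
      · rintro ⟨h1, h2⟩
        have hzero : ∀ z < I.n, x (w z) = true → z = u ∨ z = v := by
          intro z hz hxz
          by_contra hcon
          rw [not_or] at hcon
          have := h2 z (by simp [hz, hcon.1, hcon.2])
          rw [hxz] at this
          exact absurd this (by simp)
        refine ⟨?_, ⟨e, he, ?_⟩, ?_⟩
        · rw [← Finset.card_pair (Ne.symm hvu)]
          congr 1
          refine Finset.Subset.antisymm (fun z hz => ?_) hsub
          rw [Finset.mem_filter, Finset.mem_range] at hz
          simpa using hzero z hz.1 hz.2
        · rcases hev with ⟨h3, h4⟩ | ⟨h3, h4⟩ <;> simp [h3, h4, hu, hv]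
        · intro z hz hxz
          rcases hzero z hz hxz with rfl | rfl
          · exact huc
          · exact h1
      · rintro ⟨h1, -, h3⟩
        refine ⟨h3 v hvn hv, fun z hz => ?_⟩
        have heq := Finset.eq_of_subset_of_card_le hsub (by rw [h1, Finset.card_pair (Ne.symm hvu)])
        rw [List.mem_filter, List.mem_range, decide_eq_true_iff] at hz
        by_contra hcon
        have : z ∈ ({u, v} : Finset ℕ) := by
          rw [heq]
          simpa [hz.1] using hcon
        simp [hz.2.1, hz.2.2] at this

/-- The invariant is that no edge outside `E` is switched on and that the remaining list covers `E`.
When the list is exhausted, `E` is empty and no edge is switched on. -/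
theorem eval_searchFirst (hI : I.Valid) {x : Fin N → Bool} (us : List ℕ) (E : Finset ℕ)
    (hus : ∀ u ∈ us, u < I.n)
    (hE : ∀ e < I.m, e ∉ E → ¬(x (w (I.eu e)) = true ∧ x (w (I.ev e)) = true))
    (hcov : ∀ e ∈ E, e < I.m ∧ (I.eu e ∈ us ∨ I.ev e ∈ us)) :
    (searchFirst w I us E).eval x = I.blockFun fun z => x (w z) := by
  induction us generalizing E with
  | nil =>
    cases h : I.blockFun fun z => x (w z)
    · rfl
    · obtain ⟨-, ⟨e, he, h1⟩, -⟩ := blockFun_eq_true.1 h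
      refine absurd h1 (hE e he fun heE => ?_)
      simpa using hcov e heE
  | cons u us ih =>
    have hun := hus u List.mem_cons_self
    cases hu : x (w u)
    · simp only [searchFirst, DTree.eval, hu]
      refine ih _ (fun v hv => hus v (List.mem_cons_of_mem _ hv)) (fun e he heE => ?_)
        fun e he => ?_
      · rw [Finset.mem_filter, not_and_or, not_not] at heE
        rcases heE with heE | heE | heE
        · exact hE e he heE
        · simp [heE, hu]
        · simp [heE, hu]
      · rw [Finset.mem_filter, not_or] at he
        obtain ⟨h1, h2⟩ := hcov e he.1
        refine ⟨h1, ?_⟩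
        simp only [List.mem_cons, he.2.1, he.2.2, false_or] at h2
        exact h2
    · simp only [searchFirst, DTree.eval, hu, if_true, eval_checkOnes]
      by_cases huc : ∀ z ∈ I.copies u, x (w z) = true
      · rw [decide_eq_true huc, Bool.true_and]
        refine eval_searchSecond w hun hu ((forall_copies (p := fun z => x (w z) = true)).1 huc) _
          (fun v hv => ?_) fun h => ?_
        · simp only [List.mem_map, Finset.mem_toList, Finset.mem_filter] at hv
          obtain ⟨e, ⟨heE, hinc⟩, rfl⟩ := hv
          have he := (hcov e heE).1
          have hne := hI.ne e he
          have h1 := hI.lt_u e he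
          have h2 := hI.lt_v e he
          unfold other
          by_cases h : I.eu e = u
          · rw [if_pos h]
            exact ⟨h2, by rw [← h]; exact hne.symm, e, he, Or.inl ⟨h, rfl⟩⟩
          · rw [if_neg h]
            exact ⟨h1, h, e, he, Or.inr ⟨by tauto, rfl⟩⟩
        · obtain ⟨h1, ⟨e, he, h2, h3⟩, -⟩ := blockFun_eq_true.1 h
          have heE : e ∈ E := by
            by_contra heE
            exact hE e he heE ⟨h2, h3⟩
          have hne := hI.ne e he
          have heq := Finset.eq_of_subset_of_card_le
            (s := {I.eu e, I.ev e}) (t := (Finset.range I.n).filter fun z => x (w z) = true) (by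
              intro z hz
              simp only [Finset.mem_insert, Finset.mem_singleton] at hz
              rcases hz with rfl | rfl
              · simp [hI.lt_u e he, h2]
              · simp [hI.lt_v e he, h3]) (by rw [h1, Finset.card_pair hne])
          have hmem : u ∈ ({I.eu e, I.ev e} : Finset ℕ) := by
            rw [heq]; simp [hun, hu]
          simp only [Finset.mem_insert, Finset.mem_singleton] at hmem
          refine ⟨I.other u e, List.mem_map.2 ⟨e, ?_, rfl⟩, ?_⟩
          · rw [Finset.mem_toList, Finset.mem_filter]
            exact ⟨heE, hmem.imp Eq.symm Eq.symm⟩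
          · unfold other
            split_ifs
            · exact h3
            · exact h2
      · rw [decide_eq_false huc, Bool.false_and]
        symm
        rw [Bool.eq_false_iff, ne_eq, blockFun_eq_true]
        rintro ⟨-, -, h⟩
        exact huc ((forall_copies (p := fun z => x (w z) = true)).2 (h u hun hu))

end Tree

end EdgeData

/-! ### Grafting and the length of the code -/

namespace DTree

/-- Replace every leaf with label `b` by the tree `g b`. -/
def graft {N : ℕ} : DTree N → (Bool → DTree N) → DTree N
  | leaf b, g => g b
  | node i l r, g => node i (l.graft g) (r.graft g)

theorem size_graft {N : ℕ} (T : DTree N) {g : Bool → DTree N} {B : ℕ} (h : ∀ b, (g b).size ≤ B) :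
    (T.graft g).size ≤ T.size * B := by
  induction T with
  | leaf b => simpa [graft, size] using h b
  | node i l r ihl ihr =>
    simp only [graft, size, Nat.add_mul]
    omega

theorem eval_graft {N : ℕ} (T : DTree N) (g : Bool → DTree N) (x : Fin N → Bool) :
    (T.graft g).eval x = (g (T.eval x)).eval x := by
  induction T with
  | leaf b => rfl
  | node i l r ihl ihr =>
    simp only [graft, eval]
    split_ifs <;> assumption

theorem length_encode {N : ℕ} (T : DTree N) : T.encode.length + 1 = 2 * T.size := by
  induction T with
  | leaf b => simp [encode, size]
  | node i l r ihl ihr => simp only [encode, size, List.length_cons, List.length_append]; omega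

end DTree

/-! ### A small tree for the parity, and the indexing of its variables -/

namespace EdgeData

variable {I : EdgeData}

/-- A vertex cover of size `k` yields a small tree for the target. -/
theorem exists_tree (hI : I.Valid) {us : List ℕ} {k : ℕ} (hk : us.length ≤ k)
    (hus : ∀ u ∈ us, u < I.n) (hcov : ∀ e < I.m, I.eu e ∈ us ∨ I.ev e ∈ us) {N : ℕ} (r : ℕ)
    (hr : r * I.width ≤ N) :
    ∃ T : DTree N, T.size ≤ (1 + k * (I.ℓ + 1) + I.m * (I.ℓ + I.n + 1)) ^ r ∧
      ∀ x, T.eval x = I.target r (extend x) := by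
  induction r with
  | zero => exact ⟨.leaf false, by simp [DTree.size], fun x => rfl⟩
  | succ r ih =>
    rw [Nat.succ_mul] at hr
    obtain ⟨T, hT, hTe⟩ := ih (by omega)
    obtain ⟨B, hB, hBe⟩ : ∃ B : DTree N, B.size ≤ 1 + k * (I.ℓ + 1) + I.m * (I.ℓ + I.n + 1) ∧
        ∀ x, B.eval x = I.blockFun fun z => extend x (r * I.width + z) := by
      -- Without variables in the block, `Fin N` may be empty and no query could be named.
      rcases Nat.eq_zero_or_pos I.width with hw | hw
      · refine ⟨.leaf false, by simp [DTree.size]; omega, fun x => ?_⟩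
        have hn : I.n = 0 := by simpa [width] using hw
        have hm : I.m = 0 := by
          by_contra hm
          have := hI.lt_u 0 (by omega)
          omega
        symm
        simp [DTree.eval, blockFun, hm]
      -- Reducing modulo `N` only serves to make the map of variables total; the positions in this
      -- block are below `N`.
      · refine ⟨searchFirst (fun z => ⟨(r * I.width + z) % N, Nat.mod_lt _ (by omega)⟩) I us
          (Finset.range I.m), ?_, fun x => ?_⟩
        · have h := size_searchFirst (I := I) (N := N)
            (fun z => ⟨(r * I.width + z) % N, Nat.mod_lt _ (by omega)⟩) us (Finset.range I.m)
          rw [Finset.card_range] at h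
          have := Nat.mul_le_mul_right (I.ℓ + 1) hk
          omega
        · rw [eval_searchFirst _ hI us _ hus (fun e he heE => absurd (Finset.mem_range.2 he) heE)
            fun e he => ⟨by simpa using he, hcov e (by simpa using he)⟩]
          refine blockFun_congr hI fun z hz => ?_
          have h1 : r * I.width + z < N := by omega
          simp [extend, h1, Nat.mod_eq_of_lt]
    -- The tree for the new block is put below each leaf of the tree for the previous ones, with
    -- negated leaves below `true`; this realizes the exclusive or and multiplies the sizes.
    refine ⟨T.graft fun b => if b then B.graft fun b => .leaf !b else B, ?_, fun x => ?_⟩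
    · rw [pow_succ]
      refine (T.size_graft fun b => ?_).trans (Nat.mul_le_mul_right _ hT)
      cases b
      · simpa using hB
      · have := B.size_graft (g := fun b => .leaf !b) (B := 1) (by simp [DTree.size])
        simp only [if_true]
        omega
    · rw [DTree.eval_graft, target, ← hTe, ← hBe]
      cases T.eval x <;> simp [DTree.eval_graft, DTree.eval]

/-- The index of a variable of `r` blocks: its block, its vertex, and its copy. -/
def decode (I : EdgeData) (r : ℕ) (x : Fin (r * I.width)) : Fin r × ℕ × ℕ :=
  (⟨x / I.width, Nat.div_lt_of_lt_mul (x.2.trans_eq (mul_comm _ _))⟩,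
    x % I.width % I.n, x % I.width / I.n)

theorem decode_le (r : ℕ) (x : Fin (r * I.width)) : (I.decode r x).2.2 ≤ I.ℓ := by
  have h0 : 0 < I.width := by
    rcases Nat.eq_zero_or_pos I.width with h | h
    · have := x.2
      simp [h] at this
    · exact h
  have h := Nat.mod_lt (x : ℕ) h0
  rw [decode]
  exact Nat.lt_succ_iff.1 (Nat.div_lt_of_lt_mul h)

theorem decode_eq {r i v j : ℕ} (hi : i < r) (hv : v < I.n) (hj : j ≤ I.ℓ)
    (hx : i * I.width + (j * I.n + v) < r * I.width) :
    I.decode r ⟨i * I.width + (j * I.n + v), hx⟩ = (⟨i, hi⟩, v, j) := by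
  have hlt := lt_width hv hj
  have h1 : (i * I.width + (j * I.n + v)) / I.width = i := by
    rw [mul_comm i, Nat.mul_add_div (by omega), Nat.div_eq_of_lt hlt, add_zero]
  have h2 : (i * I.width + (j * I.n + v)) % I.width = j * I.n + v := by
    rw [mul_comm i, Nat.mul_add_mod, Nat.mod_eq_of_lt hlt]
  have h3 : (j * I.n + v) % I.n = v := by
    rw [mul_comm j, Nat.mul_add_mod, Nat.mod_eq_of_lt hv]
  have h4 : (j * I.n + v) / I.n = j := by
    rw [mul_comm j, Nat.mul_add_div (by omega), Nat.div_eq_of_lt hv, add_zero]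
  simp only [decode, h1, h2, h3, h4]

theorem pos_lt {i r v j : ℕ} (hi : i < r) (hv : v < I.n) (hj : j ≤ I.ℓ) :
    i * I.width + (j * I.n + v) < r * I.width := by
  have := lt_width hv hj
  calc _ < i * I.width + I.width := by omega
    _ = (i + 1) * I.width := by ring
    _ ≤ _ := Nat.mul_le_mul_right _ hi

/-- The parity of a string. -/
def parity : ∀ {r : ℕ}, (Fin r → Bool) → Bool
  | 0, _ => false
  | _ + 1, g => xor (parity fun i => g i.castSucc) (g (Fin.last _))

theorem parity_update {r : ℕ} (g : Fin r → Bool) (i : Fin r) :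
    parity (Function.update g i (!g i)) = !parity g := by
  induction r with
  | zero => exact i.elim0
  | succ r ih =>
    simp only [parity]
    refine Fin.lastCases ?_ (fun i => ?_) i
    · rw [Function.update_self]
      have : (fun i : Fin r => Function.update g (Fin.last r) (!g (Fin.last r)) i.castSucc) =
          fun i => g i.castSucc := by
        funext i
        rw [Function.update_of_ne (Fin.castSucc_lt_last i).ne]
      rw [this]; simp
    · rw [Function.update_of_ne (Fin.castSucc_lt_last i).ne']
      have : (fun j : Fin r => Function.update g i.castSucc (!g i.castSucc) j.castSucc) =
          Function.update (fun j => g j.castSucc) i (!g i.castSucc) := by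
        funext j
        by_cases hj : j = i
        · subst hj; simp
        · rw [Function.update_of_ne hj, Function.update_of_ne (by simpa using hj)]
      rw [this, ih]; simp

theorem target_points (hI : I.Valid) {r : ℕ} {ω : Fin r → ℕ × ℕ} {x : ℕ → Bool}
    (hω : ∀ i, (ω i).1 < I.m ∧ (ω i).2 < 4 * I.ℓ)
    (hx : ∀ i : Fin r, ∀ v < I.n, ∀ j ≤ I.ℓ, x (i * I.width + (j * I.n + v)) = I.pt (ω i) v j) :
    I.target r x = I.value parity ω := by
  induction r with
  | zero => rfl
  | succ r ih =>
    rw [target, value, parity, ih (ω := fun i => ω i.castSucc) (fun i => hω _)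
      (fun i v hv j hj => by simpa using hx i.castSucc v hv j hj)]
    rw [blockFun_point hI (hω (Fin.last r)).1 (hω (Fin.last r)).2
      (fun v hv j hj => by simpa using hx (Fin.last r) v hv j hj)]
    rfl

theorem extend_point {r : ℕ} (ω : Fin r → ℕ × ℕ) (i : Fin r) {v j : ℕ} (hv : v < I.n)
    (hj : j ≤ I.ℓ) :
    extend (I.point (I.decode r) ω) (i * I.width + (j * I.n + v)) = I.pt (ω i) v j := by
  rw [extend, dif_pos (pos_lt i.2 hv hj), point, decode_eq i.2 hv hj]

theorem target_point (hI : I.Valid) {r : ℕ} {ω : Fin r → ℕ × ℕ}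
    (hω : ∀ i, (ω i).1 < I.m ∧ (ω i).2 < 4 * I.ℓ) :
    I.target r (extend (I.point (I.decode r) ω)) = I.value parity ω :=
  target_points hI hω fun i _ hv _ hj => extend_point ω i hv hj

end EdgeData

/-! ### Renaming registers and arrays -/

/-- Rename the registers by `ρ` and the arrays by `κ`. -/
def Instr.ren (ρ κ : ℕ → ℕ) : Instr → Instr
  | const x c => const (ρ x) c
  | add x y z => add (ρ x) (ρ y) (ρ z)
  | sub x y z => sub (ρ x) (ρ y) (ρ z)
  | load x a y => load (ρ x) (κ a) (ρ y)
  | store a y x => store (κ a) (ρ y) (ρ x)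
  | rand x y => rand (ρ x) (ρ y)

/-- Rename the registers by `ρ` and the arrays by `κ`. -/
def Prog.ren (ρ κ : ℕ → ℕ) : PlainProg → PlainProg
  | instr o => instr (o.ren ρ κ)
  | call i => i.elim
  | seq p q => seq (ren ρ κ p) (ren ρ κ q)
  | branch x p q => branch (ρ x) (ren ρ κ p) (ren ρ κ q)
  | loop x p => loop (ρ x) (ren ρ κ p)

/-- The part of the memory that consists of the registers `ρ x` and of the arrays `κ a`. -/
def Store.view (ρ κ : ℕ → ℕ) (σ : Store) : Store where
  reg := fun x => σ.reg (ρ x)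
  arr := fun a => σ.arr (κ a)

/-- `σ` and `σ'` agree outside of the view. -/
def OutFrame (ρ κ : ℕ → ℕ) (σ σ' : Store) : Prop :=
  (∀ x, x ∉ Set.range ρ → σ'.reg x = σ.reg x) ∧ ∀ a, a ∉ Set.range κ → σ'.arr a = σ.arr a

theorem OutFrame.refl (ρ κ : ℕ → ℕ) (σ : Store) : OutFrame ρ κ σ σ :=
  ⟨fun _ _ => rfl, fun _ _ => rfl⟩

theorem OutFrame.trans {ρ κ : ℕ → ℕ} {σ σ' σ'' : Store} (h : OutFrame ρ κ σ σ')
    (h' : OutFrame ρ κ σ' σ'') : OutFrame ρ κ σ σ'' :=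
  ⟨fun x hx => (h'.1 x hx).trans (h.1 x hx), fun a ha => (h'.2 a ha).trans (h.2 a ha)⟩

theorem Store.view_setReg {ρ κ : ℕ → ℕ} (hρ : Function.Injective ρ) (σ : Store) (x v : ℕ) :
    (σ.setReg (ρ x) v).view ρ κ = (σ.view ρ κ).setReg x v := by
  unfold view setReg
  congr 1
  funext y
  by_cases h : y = x
  · subst h; simp
  · simp [h, hρ.ne h]

theorem Store.view_setArr {ρ κ : ℕ → ℕ} (hκ : Function.Injective κ) (σ : Store) (a : ℕ)
    (c : ℕ → ℕ) : (σ.setArr (κ a) c).view ρ κ = (σ.view ρ κ).setArr a c := by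
  unfold view setArr
  congr 1
  funext y
  by_cases h : y = a
  · subst h; simp
  · simp [h, hκ.ne h]

theorem Instr.map_exec_ren {ρ κ : ℕ → ℕ} (hρ : Function.Injective ρ) (hκ : Function.Injective κ)
    (o : Instr) (σ : Store) :
    ((o.ren ρ κ).exec σ).map (Store.view ρ κ) = o.exec (σ.view ρ κ) := by
  cases o <;>
    simp only [ren, exec, PMF.pure_map, PMF.map_comp, Function.comp_def, Store.view_setReg hρ,
      Store.view_setArr hκ] <;> rfl

theorem Instr.exec_ren_out {ρ κ : ℕ → ℕ} (o : Instr) (σ : Store) :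
    ∀ σ' ∈ ((o.ren ρ κ).exec σ).support, OutFrame ρ κ σ σ' := by
  have h1 : ∀ x v, OutFrame ρ κ σ (σ.setReg (ρ x) v) := fun x v =>
    ⟨fun y hy => Function.update_of_ne (fun h => hy ⟨x, h.symm⟩) _ _, fun _ _ => rfl⟩
  have h2 : ∀ a c, OutFrame ρ κ σ (σ.setArr (κ a) c) := fun a c =>
    ⟨fun _ _ => rfl, fun y hy => Function.update_of_ne (fun h => hy ⟨a, h.symm⟩) _ _⟩
  intro σ' hσ'
  cases o <;> simp only [ren, exec, PMF.support_pure, Set.mem_singleton_iff,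
    PMF.mem_support_map_iff] at hσ'
  · subst hσ'; exact h1 _ _
  · subst hσ'; exact h1 _ _
  · subst hσ'; exact h1 _ _
  · subst hσ'; exact h1 _ _
  · subst hσ'; exact h2 _ _
  · obtain ⟨v, _, rfl⟩ := hσ'; exact h1 _ _

/-- A renamed program has the effect of the original program on its part of the memory, and leaves
the rest unchanged. -/
theorem ren_law {ρ κ : ℕ → ℕ} (hρ : Function.Injective ρ) (hκ : Function.Injective κ) (T : ℕ)
    (K : List PlainProg) (σ : Store)
    (h : ∀ c ∈ (runFor noOracle T (K, σ.view ρ κ)).support, c.1 = []) :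
    Law (K.map (Prog.ren ρ κ)) σ T (OutFrame ρ κ σ) (Store.view ρ κ)
      ((runFor noOracle T (K, σ.view ρ κ)).map fun c => c.2) := by
  induction T generalizing K σ with
  | zero =>
    have : K = [] := by simpa [runFor] using h
    subst this
    simpa [runFor, PMF.pure_map] using Law.nil (obs := Store.view ρ κ) (OutFrame.refl ρ κ σ)
  | succ T ih =>
    cases K with
    | nil =>
      rw [runFor_nil, PMF.pure_map]
      exact (Law.nil (obs := Store.view ρ κ) (OutFrame.refl ρ κ σ)).mono (Nat.zero_le _)
        fun _ h => h
    | cons p K =>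
      rw [runFor_succ] at h ⊢
      cases p with
      | instr o =>
        rw [step, PMF.bind_map] at h ⊢
        have e : ((o.exec (σ.view ρ κ)).bind (runFor noOracle T ∘ fun σ' => (K, σ'))).map
            (fun c => c.2) = ((o.ren ρ κ).exec σ).bind fun σ' =>
              (runFor noOracle T (K, σ'.view ρ κ)).map fun c => c.2 := by
          rw [← Instr.map_exec_ren hρ hκ, PMF.bind_map, PMF.map_bind]; rfl
        rw [e]
        refine Law.instr (ks := K.map (Prog.ren ρ κ)) _ fun σ' hσ' => ?_
        refine (ih K σ' fun c hc => h c ?_).mono le_rfl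
          fun σ'' h'' => (o.exec_ren_out σ σ' hσ').trans h''
        rw [← Instr.map_exec_ren hρ hκ, PMF.bind_map, PMF.mem_support_bind_iff]
        exact ⟨σ', hσ', hc⟩
      | call i => exact i.elim
      | seq p q =>
        rw [step, PMF.pure_bind] at h ⊢
        exact Law.seq (ih (p :: q :: K) σ h)
      | branch x p q =>
        rw [step, PMF.pure_bind] at h ⊢
        refine Law.branch ?_
        have := ih _ σ h
        rw [List.map_cons, apply_ite (Prog.ren ρ κ)] at this
        exact this
      | loop x p =>
        rw [step, PMF.pure_bind] at h ⊢
        by_cases hx : (σ.view ρ κ).reg x ≠ 0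
        · rw [if_pos hx] at h ⊢
          exact Law.loop_succ hx (ih (p :: .loop x p :: K) σ h)
        · rw [if_neg hx] at h ⊢
          exact Law.loop_zero (not_not.1 hx) (ih K σ h)

/-! ### Simulating a learner with a step counter -/

/-- The location of the registers of the learner. -/
def lreg (x : ℕ) : ℕ := 2 * x + 100

/-- The location of the arrays of the learner. -/
def larr (a : ℕ) : ℕ := 2 * a + 20

/-- The learner occupies even positions only, registers from 100 and arrays from 20 on. The odd
positions above these thresholds are left for the program that computes the time bound, and
everything below is workspace. -/
theorem lreg_injective : Function.Injective lreg := fun x y h => by unfold lreg at h; omega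

theorem larr_injective : Function.Injective larr := fun x y h => by unfold larr at h; omega

/-- The memory of the simulated learner. -/
abbrev Store.learner (σ : Store) : Store := σ.view lreg larr

/-- Decrease the step counter in register `17`; the flag in register `18` tells whether it was
positive. -/
def tick : PlainProg :=
  .branch 17 (Prog.blk (.sub 17 17 2) [.const 18 1]) (Prog.blk (.const 18 0) [])

/-- Decrease the step counter; if it was positive, then the flag is the register `x`. -/
def tickLoad (x : ℕ) : PlainProg :=
  .branch 17 (Prog.blk (.sub 17 17 2) [.const 18 0, .add 18 18 x]) (Prog.blk (.const 18 0) [])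

/-- The simulation of a learner, where `S` contains the subroutines for the oracle calls. -/
def Prog.sim (S : LearnCall → PlainProg) : Prog LearnCall → PlainProg
  | instr o => seq tick (branch 18 (instr (o.ren lreg larr)) skip)
  | call i => seq tick (branch 18 (S i) skip)
  | seq p q => seq tick (branch 18 (seq (p.sim S) (q.sim S)) skip)
  | branch x p q => seq tick (branch 18 (branch (lreg x) (p.sim S) (q.sim S)) skip)
  | loop x p => seq (tickLoad (lreg x)) (loop 18 (seq (p.sim S) (tickLoad (lreg x))))

/-- The two parts of a simulating program. -/
def Prog.simParts (S : LearnCall → PlainProg) : Prog LearnCall → List PlainProg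
  | instr o => [tick, branch 18 (instr (o.ren lreg larr)) skip]
  | call i => [tick, branch 18 (S i) skip]
  | seq p q => [tick, branch 18 (seq (p.sim S) (q.sim S)) skip]
  | branch x p q => [tick, branch 18 (branch (lreg x) (p.sim S) (q.sim S)) skip]
  | loop x p => [tickLoad (lreg x), loop 18 (seq (p.sim S) (tickLoad (lreg x)))]

/-- The stack of the simulation; the programs that are marked by `true` have been unfolded. -/
def simStack (S : LearnCall → PlainProg) : List (Bool × Prog LearnCall) → List PlainProg
  | [] => []
  | (false, p) :: K => p.sim S :: simStack S K
  | (true, p) :: K => p.simParts S ++ simStack S K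

/-- The memory outside of the learner and of the registers used by the simulation is unchanged. -/
def SameAux (σ σ' : Store) : Prop :=
  (∀ x < 100, x ≠ 17 → x ≠ 18 → x ≠ 99 → σ'.reg x = σ.reg x) ∧ ∀ a < 20, σ'.arr a = σ.arr a

theorem Frame.sameAux {R : List ℕ} {σ σ' : Store} (h : Frame R [] σ σ')
    (hR : ∀ x ∈ R, x = 17 ∨ x = 18 ∨ x = 99) : SameAux σ σ' :=
  ⟨fun x _ h1 h2 h3 => h.1 x fun hx => by have := hR x hx; omega, fun a _ => h.2 a (by simp)⟩

theorem Frame.learner_eq {R S : List ℕ} {σ σ' : Store} (h : Frame R S σ σ')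
    (hR : ∀ x ∈ R, x < 100) (hS : ∀ a ∈ S, a < 20) : σ'.learner = σ.learner := by
  unfold Store.learner Store.view
  congr 1
  · funext x
    exact h.1 _ fun hx => by have := hR _ hx; unfold lreg at this; omega
  · funext a
    exact h.2 _ fun hx => by have := hS _ hx; unfold larr at this; omega

theorem OutFrame.sameAux {σ σ' : Store} (h : OutFrame lreg larr σ σ') : SameAux σ σ' :=
  ⟨fun x hx _ _ _ => h.1 x (by rintro ⟨y, rfl⟩; unfold lreg at hx; omega),
    fun a ha => h.2 a (by rintro ⟨y, rfl⟩; unfold larr at ha; omega)⟩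

theorem tick_pos {σ : Store} {c : ℕ} (hc : σ.reg 17 = c + 1) (h2 : σ.reg 2 = 1) :
    WP tick 4 (fun σ' => σ'.reg 17 = c ∧ σ'.reg 18 = 1) σ :=
  WP.branch (fun _ => WP.blk rfl (by simp [Instr.det, Store.setReg, hc, h2]))
    fun h => by omega

theorem tick_zero {σ : Store} (hc : σ.reg 17 = 0) : WP tick 2 (fun σ' => σ'.reg 17 = 0 ∧
    σ'.reg 18 = 0) σ :=
  WP.branch (fun h => absurd hc h)
    fun _ => WP.blk rfl (by simp [Instr.det, Store.setReg, hc])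

theorem tickLoad_pos {σ : Store} {x c : ℕ} (hx : x ≠ 17 ∧ x ≠ 18) (hc : σ.reg 17 = c + 1)
    (h2 : σ.reg 2 = 1) :
    WP (tickLoad x) 6 (fun σ' => σ'.reg 17 = c ∧ σ'.reg 18 = σ.reg x) σ :=
  WP.branch (fun _ => WP.blk rfl (by simp [Instr.det, Store.setReg, hc, h2, hx.1, hx.2]))
    fun h => by omega

theorem tickLoad_zero {σ : Store} {x : ℕ} (hc : σ.reg 17 = 0) :
    WP (tickLoad x) 2 (fun σ' => σ'.reg 17 = 0 ∧ σ'.reg 18 = 0) σ :=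
  WP.branch (fun h => absurd hc h)
    fun _ => WP.blk rfl (by simp [Instr.det, Store.setReg, hc])

section Sim

variable {S : LearnCall → PlainProg} {h : LearnCall → Store → PMF Store} {J : Store → Prop}
  {B₀ : ℕ}

/-- Unfolding a simulating program costs one step. -/
theorem sim_unfold {α : Type*} {p : Prog LearnCall} {b : Bool} {K : List (Bool × Prog LearnCall)}
    {σ : Store} {B : ℕ} {I : Store → Prop} {obs : Store → α} {μ : PMF α}
    (hl : Law (p.simParts S ++ simStack S K) σ B I obs μ) :
    Law (simStack S ((b, p) :: K)) σ (B + 1) I obs μ := by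
  cases b with
  | true => exact hl.mono (Nat.le_succ _) fun _ h => h
  | false => cases p <;> exact Law.seq hl

/-- With an exhausted counter every flag is 0, so each piece of the stack falls through in at most 5
steps without touching the learner's memory. Thus the simulation always terminates, even if the
learner does not. -/
theorem sim_idle (hJ : ∀ σ σ', J σ → SameAux σ σ' → J σ') (K : List (Bool × Prog LearnCall))
    (σ : Store) (hσ : J σ) (hc : σ.reg 17 = 0) :
    Law (simStack S K) σ (5 * K.length) J Store.learner (PMF.pure σ.learner) := by
  induction K generalizing σ with
  | nil => exact Law.nil hσ
  | cons bp K ih =>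
    obtain ⟨b, p⟩ := bp
    -- The two shapes of a simulating program, a guarded step and a loop, are treated together.
    have main : ∀ (t q q' : PlainProg), t.regs = [17, 18, 18] ∨ t.regs = [17, 18, 18, 18] →
        t.arrs = [] → WP t 2 (fun σ' => σ'.reg 17 = 0 ∧ σ'.reg 18 = 0) σ →
        (q' = .branch 18 q Prog.skip ∨ q' = .loop 18 q) →
        Law (t :: q' :: simStack S K) σ (5 * K.length + 4) J Store.learner
          (PMF.pure σ.learner) := by
      intro t q q' htr hta ht hq'
      refine (Law.wp_cons (B := 2) (B' := 5 * K.length + 2) ht fun σ' hf hQ => ?_).mono (by omega)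
        fun _ h => h
      rw [hta] at hf
      have hJ' : J σ' := hJ σ σ' hσ (hf.sameAux fun x hx => by
        rcases htr with htr | htr <;> rw [htr] at hx <;> simp at hx <;> omega)
      have hv : σ'.learner = σ.learner := hf.learner_eq (fun x hx => by
        rcases htr with htr | htr <;> rw [htr] at hx <;> simp at hx <;> omega) (by simp)
      rcases hq' with rfl | rfl
      · refine Law.branch (B := 5 * K.length + 1) ?_
        rw [if_neg (by simpa using hQ.2)]
        refine (Law.wp_cons (B := 1) (B' := 5 * K.length) (WP.skip (Q := fun σ'' =>
          σ''.reg 17 = 0) (by simp [Store.setReg, hQ.1])) fun σ'' hf' hQ' => ?_).mono (by omega)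
            fun _ h => h
        have hJ'' : J σ'' := hJ σ' σ'' hJ' (Frame.sameAux (R := [99]) hf' (by simp))
        rw [← hv, ← Frame.learner_eq (R := [99]) (S := []) hf' (by simp) (by simp)]
        exact ih σ'' hJ'' hQ'
      · refine (Law.loop_zero hQ.2 (B := 5 * K.length) ?_).mono (by omega) fun _ h => h
        rw [← hv]
        exact ih σ' hJ' hQ.1
    refine (sim_unfold (B := 5 * K.length + 4) ?_).mono (by simp; omega) fun _ h => h
    cases p with
    | loop x p =>
      exact main _ _ _ (Or.inr rfl) rfl (tickLoad_zero hc) (Or.inr rfl)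
    | instr o => exact main _ _ _ (Or.inl rfl) rfl (tick_zero hc) (Or.inl rfl)
    | call i => exact main _ _ _ (Or.inl rfl) rfl (tick_zero hc) (Or.inl rfl)
    | seq p q => exact main _ _ _ (Or.inl rfl) rfl (tick_zero hc) (Or.inl rfl)
    | branch x p q => exact main _ _ _ (Or.inl rfl) rfl (tick_zero hc) (Or.inl rfl)

/-- The simulation of `c` steps of a learner. -/
theorem sim_law (hJ : ∀ σ σ', J σ → SameAux σ σ' → J σ') (hJ2 : ∀ σ, J σ → σ.reg 2 = 1)
    (hS : ∀ i σ, J σ → Law [S i] σ B₀ (fun σ' => J σ' ∧ σ'.reg 17 = σ.reg 17) Store.learner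
      (h i σ.learner)) (c : ℕ) (K : List (Bool × Prog LearnCall)) (σ : Store) (hσ : J σ)
    (hc : σ.reg 17 = c) :
    Law (simStack S K) σ (c * (B₀ + 20) + 5 * K.length) J Store.learner
      ((runFor h c (K.map Prod.snd, σ.learner)).map fun c => c.2) := by
  induction c generalizing K σ with
  | zero =>
    rw [runFor, PMF.pure_map]
    exact (sim_idle hJ K σ hσ hc).mono (by omega) fun _ h => h
  | succ c ih =>
    cases K with
    | nil =>
      rw [List.map_nil, runFor_nil, PMF.pure_map]
      exact (Law.nil hσ).mono (Nat.zero_le _) fun _ h => h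
    | cons bp K =>
      obtain ⟨b, p⟩ := bp
      have hB : (c + 1) * (B₀ + 20) + 5 * (K.length + 1) =
          c * (B₀ + 20) + 5 * K.length + B₀ + 25 := by ring
      rw [List.length_cons, hB]
      refine (sim_unfold (B := c * (B₀ + 20) + 5 * K.length + B₀ + 24) ?_).mono (by omega)
        fun _ h => h
      rw [List.map_cons, runFor_succ]
      -- All cases except the loop share this prefix: the counter is decreased, and the guarded
      -- piece is entered because the counter was positive.
      have main : ∀ (q : PlainProg) (μ : PMF Store),
          (∀ σ', J σ' → σ'.reg 17 = c → σ'.learner = σ.learner →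
            Law (q :: simStack S K) σ' (c * (B₀ + 20) + 5 * K.length + B₀ + 15) J
              Store.learner μ) →
          Law (tick :: .branch 18 q Prog.skip :: simStack S K) σ
            (c * (B₀ + 20) + 5 * K.length + B₀ + 24) J Store.learner μ := by
        intro q μ hq
        refine (Law.wp_cons (B := 4) (B' := c * (B₀ + 20) + 5 * K.length + B₀ + 16)
          (tick_pos hc (hJ2 σ hσ)) fun σ' hf hQ => Law.branch ?_).mono (by omega) fun _ h => h
        have hR : ∀ x ∈ tick.regs, x = 17 ∨ x = 18 ∨ x = 99 := by
          simp [tick, Prog.regs, Prog.blk, Instr.regs]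
        rw [if_pos (by omega)]
        exact hq σ' (hJ _ _ hσ (Frame.sameAux hf hR)) hQ.1
          (hf.learner_eq (fun x hx => by have := hR x hx; omega)
            (by simp [tick, Prog.arrs, Prog.blk, Instr.arrs]))
      cases p with
      | instr o =>
        refine main _ _ fun σ' hJ' hc' hv => ?_
        have e : ((step h (.instr o :: K.map Prod.snd, σ.learner)).bind (runFor h c)).map
            (fun c => c.2) = ((o.ren lreg larr).exec σ').bind fun σ'' =>
              (runFor h c (K.map Prod.snd, σ''.learner)).map fun c => c.2 := by
          rw [step, PMF.bind_map, ← hv, ← Instr.map_exec_ren lreg_injective larr_injective,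
            PMF.bind_map, PMF.map_bind]
          rfl
        rw [e]
        refine (Law.instr (B := c * (B₀ + 20) + 5 * K.length) _ fun σ'' hσ'' => ?_).mono (by omega)
          fun _ h => h
        have ho := o.exec_ren_out σ' σ'' hσ''
        refine ih K σ'' (hJ _ _ hJ' ho.sameAux) ?_
        rw [← hc']
        exact ho.1 17 (by rintro ⟨y, hy⟩; unfold lreg at hy; omega)
      | call i =>
        refine main _ _ fun σ' hJ' hc' hv => ?_
        rw [step, PMF.bind_map, PMF.map_bind, ← hv]
        have := (hS i σ' hJ').append (ks' := simStack S K) (B' := c * (B₀ + 20) + 5 * K.length)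
          (I' := J) (obs' := Store.learner)
          (κ := fun τ => (runFor h c (K.map Prod.snd, τ)).map fun c => c.2)
          (fun σ'' h'' => ih K σ'' h''.1 (h''.2.trans hc'))
        exact this.mono (by omega) fun _ h => h
      | seq p q =>
        refine main _ _ fun σ' hJ' hc' hv => ?_
        rw [step, PMF.pure_bind, ← hv]
        refine (Law.seq (B := c * (B₀ + 20) + 5 * (K.length + 2)) ?_).mono (by omega) fun _ h => h
        exact ih ((false, p) :: (false, q) :: K) σ' hJ' hc'
      | branch x p q =>
        refine main _ _ fun σ' hJ' hc' hv => ?_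
        rw [step, PMF.pure_bind, ← hv]
        refine (Law.branch (B := c * (B₀ + 20) + 5 * (K.length + 1)) ?_).mono (by omega)
          fun _ h => h
        have := ih ((false, if σ'.learner.reg x ≠ 0 then p else q) :: K) σ' hJ' hc'
        rw [simStack, apply_ite (Prog.sim S)] at this
        exact this
      | loop x p =>
        rw [step, PMF.pure_bind]
        refine (Law.wp_cons (B := 6) (B' := c * (B₀ + 20) + 5 * K.length + B₀ + 12)
          (tickLoad_pos (x := lreg x) (by unfold lreg; omega) hc (hJ2 σ hσ))
          fun σ' hf hQ => ?_).mono (by omega) fun _ h => h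
        have hR : ∀ y ∈ (tickLoad (lreg x)).regs, y = 17 ∨ y = 18 ∨ y = 99 := by
          simp [tickLoad, Prog.regs, Prog.blk, Instr.regs]
        have hJ' := hJ _ _ hσ (Frame.sameAux hf hR)
        have hv : σ'.learner = σ.learner := hf.learner_eq
          (fun x hx => by have := hR x hx; omega)
          (by simp [tickLoad, Prog.arrs, Prog.blk, Instr.arrs])
        by_cases hx : σ.learner.reg x ≠ 0
        · rw [if_pos hx, ← hv]
          refine (Law.loop_succ (B := c * (B₀ + 20) + 5 * (K.length + 2) + 1) (by rw [hQ.2]; exact hx)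
            (Law.seq ?_)).mono (by omega) fun _ h => h
          -- After the body the stack shows the renewed test and the loop as two separate pieces.
          -- They are the parts of the simulated loop without the enclosing sequence, which is what
          -- the mark `true` stands for.
          exact ih ((false, p) :: (true, .loop x p) :: K) σ' hJ' hQ.1
        · rw [if_neg hx, ← hv]
          refine (Law.loop_zero (B := c * (B₀ + 20) + 5 * K.length)
            (by rw [hQ.2]; exact not_not.1 hx) ?_).mono (by omega) fun _ h => h
          exact ih K σ' hJ' hQ.1

end Sim

/-! ### The length of the output -/

/-- In `T` steps a learner writes at most `T` nonzero cells of the array `2`. -/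
theorem card_written_le {n : ℕ} (f : (Fin n → Bool) → Bool) (D : PMF (Fin n → Bool)) (T : ℕ)
    (K : List (Prog LearnCall)) (σ : Store) (s : Finset ℕ) (hs : ∀ j, σ.arr 2 j ≠ 0 → j ∈ s) :
    ∀ c ∈ (runFor (learnOracle f D) T (K, σ)).support,
      ∃ s' : Finset ℕ, (∀ j, c.2.arr 2 j ≠ 0 → j ∈ s') ∧ s'.card ≤ s.card + T := by
  induction T generalizing K σ s with
  | zero =>
    intro c hc
    simp only [runFor, PMF.support_pure, Set.mem_singleton_iff] at hc
    subst hc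
    exact ⟨s, hs, le_rfl⟩
  | succ T ih =>
    intro c hc
    rw [runFor_succ, PMF.mem_support_bind_iff] at hc
    obtain ⟨⟨K', σ'⟩, hc', hc⟩ := hc
    have hstep : ∃ s' : Finset ℕ, (∀ j, σ'.arr 2 j ≠ 0 → j ∈ s') ∧ s'.card ≤ s.card + 1 := by
      have same : σ'.arr 2 = σ.arr 2 → ∃ s' : Finset ℕ, (∀ j, σ'.arr 2 j ≠ 0 → j ∈ s') ∧
          s'.card ≤ s.card + 1 := fun h => ⟨s, by rwa [h], Nat.le_succ _⟩
      cases K with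
      | nil =>
        simp only [step, PMF.support_pure, Set.mem_singleton_iff, Prod.mk.injEq] at hc'
        exact same (by rw [hc'.2])
      | cons p K =>
        cases p with
        | instr o =>
          simp only [step, PMF.mem_support_map_iff, Prod.mk.injEq] at hc'
          obtain ⟨σ'', ho, -, rfl⟩ := hc'
          cases o <;> simp only [Instr.exec, PMF.support_pure, Set.mem_singleton_iff,
            PMF.mem_support_map_iff] at ho
          · exact same (by rw [ho]; rfl)
          · exact same (by rw [ho]; rfl)
          · exact same (by rw [ho]; rfl)
          · exact same (by rw [ho]; rfl)
          -- `store` is the only instruction that can write to array 2; a sample changes only array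
          -- 1 and a register.
          · rename_i a y x
            by_cases ha : a = 2
            · subst ha
              refine ⟨insert (σ.reg y) s, fun j hj => ?_, Finset.card_insert_le _ _⟩
              by_cases hjy : j = σ.reg y
              · simp [hjy]
              · rw [ho] at hj
                simp only [Store.setArr, Function.update_self, Function.update_of_ne hjy] at hj
                exact Finset.mem_insert_of_mem (hs j hj)
            · exact same (by rw [ho]; simp [Store.setArr, Ne.symm ha])
          · obtain ⟨v, -, rfl⟩ := ho
            exact same rfl
        | call i =>
          simp only [step, PMF.mem_support_map_iff, Prod.mk.injEq] at hc'
          obtain ⟨σ'', ho, -, rfl⟩ := hc'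
          cases i <;> simp only [learnOracle, PMF.support_pure, Set.mem_singleton_iff,
            PMF.mem_support_map_iff] at ho
          · exact same (by rw [ho]; rfl)
          · obtain ⟨v, -, rfl⟩ := ho
            exact same (by simp [Store.setArr, Store.setReg])
        | seq p q =>
          simp only [step, PMF.support_pure, Set.mem_singleton_iff, Prod.mk.injEq] at hc'
          exact same (by rw [hc'.2])
        | branch x p q =>
          simp only [step, PMF.support_pure, Set.mem_singleton_iff, Prod.mk.injEq] at hc'
          exact same (by rw [hc'.2])
        | loop x p =>
          simp only [step, PMF.support_pure, Set.mem_singleton_iff, Prod.mk.injEq] at hc'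
          exact same (by rw [hc'.2])
    obtain ⟨s', h1, h2⟩ := hstep
    obtain ⟨s'', h3, h4⟩ := ih K' σ' s' h1 c hc
    exact ⟨s'', h3, by omega⟩

/-- Tokens of inner nodes are at least 2, hence nonzero, and a tree has one inner node fewer than
leaves. Leaves labelled 0 cannot be counted, since an unwritten cell already reads as such a leaf.
-/
theorem DTree.size_le_of_written {N : ℕ} (T : DTree N) (a : ℕ → ℕ)
    (ha : ∀ (j : ℕ) (hj : j < T.encode.length), a j = T.encode[j]) :
    T.size ≤ ((Finset.range T.encode.length).filter fun j => a j ≠ 0).card + 1 := by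
  have hcount : ∀ T : DTree N, T.size ≤ (T.encode.filter fun c => decide (2 ≤ c)).length + 1 := by
    intro T
    induction T with
    | leaf b => simp [size]
    | node i l r ihl ihr =>
      simp only [size, encode, List.filter_cons, List.filter_append]
      simp only [Nat.le_add_left, decide_true, if_true, List.length_cons, List.length_append]
      omega
  have hle : ∀ (l : List ℕ) (a : ℕ → ℕ), (∀ (j : ℕ) (hj : j < l.length), a j = l[j]) →
      (l.filter fun c => decide (2 ≤ c)).length ≤
        ((Finset.range l.length).filter fun j => a j ≠ 0).card := by
    intro l
    induction l with
    | nil => simp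
    | cons c l ih =>
      intro a ha
      have h0 : a 0 = c := ha 0 (by simp)
      have h1 := ih (fun j => a (j + 1)) fun j hj =>
        ha (j + 1) (Nat.succ_lt_succ hj)
      rw [List.length_cons, Finset.range_add_one', Finset.filter_insert, Finset.filter_map,
        List.filter_cons]
      have h2 : (Finset.filter ((fun j => a j ≠ 0) ∘ (⟨fun i => i + 1, fun i j => Nat.succ.inj⟩ : ℕ ↪ ℕ))
          (Finset.range l.length)).card =
            ((Finset.range l.length).filter fun j => a (j + 1) ≠ 0).card := rfl
      by_cases hc : 2 ≤ c
      · rw [if_pos (show a 0 ≠ 0 by omega), if_pos (decide_eq_true hc),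
          Finset.card_insert_of_notMem (by simp), Finset.card_map, List.length_cons, h2]
        omega
      · rw [if_neg (by simpa using hc)]
        split_ifs
        · rw [Finset.card_insert_of_notMem (by simp), Finset.card_map, h2]; omega
        · rw [Finset.card_map, h2]; exact h1
  exact (hcount T).trans (Nat.succ_le_succ (hle _ a ha))

/-! ### Subroutines -/

@[simp] theorem Store.setReg_reg (σ : Store) (x v y : ℕ) :
    (σ.setReg x v).reg y = if y = x then v else σ.reg y := by
  simp [Store.setReg, Function.update_apply]

@[simp] theorem Store.setReg_arr (σ : Store) (x v : ℕ) : (σ.setReg x v).arr = σ.arr := rfl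

@[simp] theorem Store.setArr_reg (σ : Store) (a : ℕ) (c : ℕ → ℕ) : (σ.setArr a c).reg = σ.reg := rfl

@[simp] theorem Store.setArr_arr (σ : Store) (a : ℕ) (c : ℕ → ℕ) (b : ℕ) :
    (σ.setArr a c).arr b = if b = a then c else σ.arr b := by
  simp [Store.setArr, Function.update_apply]

attribute [simp] Instr.det Prog.regs Prog.arrs Instr.regs Instr.arrs

@[simp] theorem Prog.regs_blk (o : Instr) (os : List Instr) :
    (Prog.blk o os).regs = (o :: os).flatMap Instr.regs := by
  induction os generalizing o with
  | nil => simp [Prog.blk]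
  | cons o' os ih => simp [Prog.blk, ih]

@[simp] theorem Prog.arrs_blk (o : Instr) (os : List Instr) :
    (Prog.blk o os).arrs = (o :: os).flatMap Instr.arrs := by
  induction os generalizing o with
  | nil => simp [Prog.blk]
  | cons o' os ih => simp [Prog.blk, ih]

@[simp] theorem Prog.regs_skip : Prog.skip.regs = [99] := rfl

@[simp] theorem Prog.arrs_skip : Prog.skip.arrs = [] := rfl

@[simp] theorem Prog.regs_forp (i t n : ℕ) (p : PlainProg) :
    (Prog.forp i t n p).regs = i :: t :: (p.regs ++ [i, t]) := by
  simp [Prog.forp]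

@[simp] theorem Prog.arrs_forp (i t n : ℕ) (p : PlainProg) :
    (Prog.forp i t n p).arrs = p.arrs := by
  simp [Prog.forp]

/-- The rule for sequences, with the frame of the first program. -/
theorem WP.seq' {p q : PlainProg} {B B' : ℕ} {P Q : Store → Prop} {σ : Store} (h : WP p B P σ)
    (h' : ∀ σ', Frame p.regs p.arrs σ σ' → P σ' → WP q B' Q σ') :
    WP (.seq p q) (B + B' + 1) Q σ :=
  WP.seq (h.mono le_rfl h')

theorem WP.weaken {p : PlainProg} {B B' : ℕ} {Q Q' : Store → Prop} {σ : Store} (h : WP p B Q σ)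
    (hB : B ≤ B') (hQ : ∀ σ', Q σ' → Q' σ') : WP p B' Q' σ :=
  h.mono hB fun σ' _ => hQ σ'

/-- The memory holds the edge list and the derived constants; the registers `11` and `12` hold the
parameters of the test of the candidate covers. -/
structure Holds (I : EdgeData) (r P q : ℕ) (σ : Store) : Prop where
  one : σ.reg 2 = 1
  n : σ.reg 3 = I.n
  m : σ.reg 4 = I.m
  copies : σ.reg 5 = I.ℓ
  width : σ.reg 6 = I.width
  N : σ.reg 7 = r * I.width
  rows : σ.reg 8 = r * I.n
  r : σ.reg 9 = r
  range : σ.reg 10 = 4 * I.ℓ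
  P : σ.reg 11 = P
  q : σ.reg 12 = q
  succ : σ.reg 14 = I.ℓ + 1
  eu : ∀ e < I.m, σ.arr 2 e = I.eu e
  ev : ∀ e < I.m, σ.arr 3 e = I.ev e

/-- Registers below 15 and arrays below 4 are reserved for the instance, so this applies to every
subroutine that works elsewhere. -/
theorem Holds.frame {I : EdgeData} {r P q : ℕ} {σ σ' : Store} (h : Holds I r P q σ)
    {R S : List ℕ} (hf : Frame R S σ σ') (hR : ∀ x ∈ R, 15 ≤ x := by decide)
    (hS : ∀ a ∈ S, 4 ≤ a := by decide) : Holds I r P q σ' := by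
  have h1 : ∀ x < 15, σ'.reg x = σ.reg x := fun x hx => hf.1 x fun h => by
    have := hR x h; omega
  have h2 : ∀ a < 4, σ'.arr a = σ.arr a := fun a ha => hf.2 a fun h => by
    have := hS a h; omega
  constructor <;> (first | rw [h1 _ (by norm_num)] | rw [h2 _ (by norm_num)])
  exacts [h.one, h.n, h.m, h.copies, h.width, h.N, h.rows, h.r, h.range, h.P, h.q, h.succ, h.eu,
    h.ev]

/-- A `skip` in a context with a larger time bound. -/
theorem WP.skip_le {B : ℕ} {Q : Store → Prop} {σ : Store} (hB : 1 ≤ B) (hQ : Q (σ.setReg 99 0)) :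
    WP Prog.skip B Q σ := (WP.skip hQ).weaken hB fun _ h => h

theorem WP.instr_le {o : Instr} {B : ℕ} {Q : Store → Prop} {σ : Store} (ho : o.isDet = true)
    (hB : 1 ≤ B) (hQ : Q (o.det σ)) : WP (.instr o) B Q σ := (WP.instr ho hQ).weaken hB fun _ h => h

theorem WP.blk_le {o : Instr} {os : List Instr} {B : ℕ} {Q : Store → Prop} {σ : Store}
    (ho : (o :: os).all Instr.isDet = true) (hB : 2 * os.length + 1 ≤ B)
    (hQ : Q (os.foldl (fun τ o => o.det τ) (o.det σ))) : WP (Prog.blk o os) B Q σ :=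
  (WP.blk ho hQ).weaken hB fun _ h => h

/-- Count the vertices that are switched on in the block at the offset in register `30`. -/
def countProg (a : ℕ) : PlainProg :=
  .seq (.instr (.const 34 0)) (Prog.forp 37 38 3
    (.seq (Prog.blk (.add 40 30 37) [.load 41 a 40])
      (.branch 41 (.instr (.add 34 34 2)) Prog.skip)))

theorem countProg_spec {I : EdgeData} {r P q a : ℕ} {σ : Store} (h : Holds I r P q σ) :
    WP (countProg a) (I.n * 11 + 10) (fun σ' => σ'.reg 34 =
      ((Finset.range I.n).filter fun v => σ.arr a (σ.reg 30 + v) ≠ 0).card) σ := by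
  refine (WP.seq (WP.instr rfl (WP.forp I.n (fun j σ' => σ'.reg 34 =
      ((Finset.range j).filter fun v => σ.arr a (σ.reg 30 + v) ≠ 0).card)
      (B := 6) (by simp [h.n]) (by simp [h.one]) (by simp) (by simp) (by simp) (by simp)
      (by simp) ?_ ?_))).weaken (by omega) fun _ h => h
  · intro j hj σ' hf hi hI
    have e30 : σ'.reg 30 = σ.reg 30 := by rw [hf.1 30 (by simp)]; simp
    have ea : σ'.arr a = σ.arr a := by rw [hf.2 a (by simp)]; simp
    have e2 : σ'.reg 2 = 1 := by rw [hf.1 2 (by simp)]; simp [h.one]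
    refine WP.seq (B := 3) (B' := 2) (WP.blk rfl (WP.branch (fun hx => WP.instr rfl ?_) fun hx => WP.skip ?_))
    · simp [e30, ea, hi] at hx
      simp [Finset.range_add_one, Finset.filter_insert, hx, hI, e2]
    · simp [e30, ea, hi] at hx
      simp [Finset.range_add_one, Finset.filter_insert, hx, hI]
  · intro σ' hf hI
    exact hI

/-- Search for an edge that is switched on in the block at the offset in register `30`. -/
def edgeProg (a : ℕ) : PlainProg :=
  .seq (.instr (.const 35 0)) (Prog.forp 37 38 4
    (.seq (Prog.blk (.load 40 2 37) [.add 40 30 40, .load 40 a 40, .load 41 3 37, .add 41 30 41,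
      .load 41 a 41])
      (.branch 40 (.branch 41 (.instr (.const 35 1)) Prog.skip) Prog.skip)))

theorem exists_lt_succ_iff {p : ℕ → Prop} {j : ℕ} : (∃ e < j + 1, p e) ↔ (∃ e < j, p e) ∨ p j := by
  simp only [Nat.lt_succ_iff_lt_or_eq]
  constructor
  · rintro ⟨e, he | rfl, hp⟩
    · exact Or.inl ⟨e, he, hp⟩
    · exact Or.inr hp
  · rintro (⟨e, he, hp⟩ | hp)
    · exact ⟨e, Or.inl he, hp⟩
    · exact ⟨j, Or.inr rfl, hp⟩

theorem edgeProg_spec {I : EdgeData} {r P q a : ℕ} {σ : Store} (h : Holds I r P q σ) :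
    WP (edgeProg a) (I.m * 20 + 10) (fun σ' => σ'.reg 35 ≠ 0 ↔ ∃ e < I.m,
      σ.arr a (σ.reg 30 + I.eu e) ≠ 0 ∧ σ.arr a (σ.reg 30 + I.ev e) ≠ 0) σ := by
  refine (WP.seq (WP.instr rfl (WP.forp I.m (fun j σ' => σ'.reg 35 ≠ 0 ↔ ∃ e < j,
      σ.arr a (σ.reg 30 + I.eu e) ≠ 0 ∧ σ.arr a (σ.reg 30 + I.ev e) ≠ 0)
      (B := 15) (by simp [h.m]) (by simp [h.one]) (by simp) (by simp) (by simp) (by simp)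
      (by simp) ?_ ?_))).weaken (by omega) fun _ h => h
  · intro j hj σ' hf hi hI
    have e30 : σ'.reg 30 = σ.reg 30 := by simpa using hf.1 30 (by simp)
    have ea : σ'.arr a = σ.arr a := by simpa using hf.2 a (by simp)
    have eu : σ'.arr 2 j = I.eu j := by rw [hf.2 2 (by simp)]; exact h.eu j hj
    have ev : σ'.arr 3 j = I.ev j := by rw [hf.2 3 (by simp)]; exact h.ev j hj
    refine WP.seq (B := 11) (B' := 3) (WP.blk rfl (WP.branch (fun hx => WP.branch
      (fun hy => WP.instr rfl ?_) fun hy => WP.skip ?_) fun hx => WP.skip_le (by norm_num) ?_))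
    · simp [e30, ea, hi, eu, ev] at hx hy
      rw [exists_lt_succ_iff]
      simp [hx, hy]
    · simp [e30, ea, hi, eu, ev] at hx hy
      rw [exists_lt_succ_iff, ← hI]
      simp [hy]
    · simp [e30, ea, hi, eu] at hx
      rw [exists_lt_succ_iff, ← hI]
      simp [hx]
  · intro σ' hf hI
    exact hI

/-- Search for a missing copy of a vertex that is switched on in the block at the offset in
register `30`. -/
def copyProg (a : ℕ) : PlainProg :=
  .seq (.instr (.const 36 0)) (Prog.forp 37 38 3
    (.seq (Prog.blk (.add 40 30 37) [.load 41 a 40])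
      (.branch 41
        (Prog.forp 43 44 5 (.seq (Prog.blk (.add 40 40 3) [.load 45 a 40])
          (.branch 45 Prog.skip (.instr (.const 36 1)))))
        Prog.skip)))

theorem copyProg_spec {I : EdgeData} {r P q a : ℕ} {σ : Store} (h : Holds I r P q σ) :
    WP (copyProg a) (I.n * (I.ℓ * 11 + 15) + 10) (fun σ' => σ'.reg 36 ≠ 0 ↔ ∃ v < I.n,
      σ.arr a (σ.reg 30 + v) ≠ 0 ∧ ∃ c < I.ℓ, σ.arr a (σ.reg 30 + ((c + 1) * I.n + v)) = 0) σ := by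
  refine (WP.seq (WP.instr rfl (WP.forp I.n (fun j σ' => σ'.reg 36 ≠ 0 ↔ ∃ v < j,
      σ.arr a (σ.reg 30 + v) ≠ 0 ∧ ∃ c < I.ℓ, σ.arr a (σ.reg 30 + ((c + 1) * I.n + v)) = 0)
      (B := I.ℓ * 11 + 10) (by simp [h.n]) (by simp [h.one]) (by simp) (by simp) (by simp) (by simp)
      (by simp) ?_ ?_))).weaken (by ring_nf; omega) fun _ h => h
  · intro j hj σ' hf hi hI
    have e30 : σ'.reg 30 = σ.reg 30 := by simpa using hf.1 30 (by simp)
    have ea : σ'.arr a = σ.arr a := by simpa using hf.2 a (by simp)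
    have e2 : σ'.reg 2 = 1 := by simpa [h.one] using hf.1 2 (by simp)
    have e3 : σ'.reg 3 = I.n := by simpa [h.n] using hf.1 3 (by simp)
    have e5 : σ'.reg 5 = I.ℓ := by simpa [h.copies] using hf.1 5 (by simp)
    -- Register 40 walks through the copies of the current vertex by adding the number of vertices,
    -- so no multiplication is needed.
    refine (WP.seq (B := 3) (B' := I.ℓ * 11 + 6) (WP.blk rfl (WP.branch (fun hx =>
      (WP.forp I.ℓ (B := 6) (fun k σ'' => σ''.reg 40 = σ.reg 30 + (k * I.n + j) ∧
        (σ''.reg 36 ≠ 0 ↔ σ'.reg 36 ≠ 0 ∨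
          ∃ c < k, σ.arr a (σ.reg 30 + ((c + 1) * I.n + j)) = 0))
        (by simp [e5]) (by simp [e2]) (by simp) (by simp) (by simp) (by simp) (by simp [hi, e30])
        ?_ ?_)) fun hx => WP.skip_le (by omega) ?_))).weaken (by omega) fun _ h => h
    · intro k hk σ'' hf' hi' hI'
      have ea' : σ''.arr a = σ.arr a := by rw [hf'.2 a (by simp)]; simpa using ea
      have e3' : σ''.reg 3 = I.n := by simpa [e3] using hf'.1 3 (by simp)
      have e40 : σ.reg 30 + (k * I.n + j) + I.n = σ.reg 30 + ((k + 1) * I.n + j) := by ring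
      refine WP.seq (B := 3) (B' := 2) (WP.blk rfl (WP.branch (fun hy => WP.skip ?_)
        fun hy => WP.instr rfl ?_))
      · simp [ea', hI'.1, e3', e40] at hy
        refine ⟨by simp [hI'.1, e3', e40], ?_⟩
        rw [exists_lt_succ_iff]
        have := hI'.2
        simp [hy] at this ⊢
        exact this
      · simp [ea', hI'.1, e3', e40] at hy
        refine ⟨by simp [hI'.1, e3', e40], ?_⟩
        rw [exists_lt_succ_iff]
        simp [hy]
    · intro σ'' hf' hI'
      simp [ea, hi, e30] at hx
      rw [exists_lt_succ_iff, ← hI]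
      simpa [hx] using hI'.2
    · simp [ea, hi, e30] at hx
      rw [exists_lt_succ_iff, ← hI]
      simp [hx]
  · intro σ' hf hI
    exact hI

/-- Evaluate the target on the string in the array `a`; the result is written to register `2` of
the learner. -/
def evalProg (a : ℕ) : PlainProg :=
  .seq (Prog.blk (.const 30 0) [.const 31 0]) (.seq (Prog.forp 32 33 9
    (.seq (countProg a) (.seq (edgeProg a) (.seq (copyProg a)
      (.seq (Prog.blk (.const 45 2) [.sub 46 34 45, .sub 47 45 34, .add 46 46 47, .add 46 46 36,
        .add 30 30 6])
        (.branch 46 Prog.skip (.branch 35 (.instr (.sub 31 2 31)) Prog.skip)))))))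
    (Prog.blk (.const 104 0) [.add 104 104 31]))

/-- The string in an array. -/
def bits (c : ℕ → ℕ) (z : ℕ) : Bool := decide (c z ≠ 0)

theorem evalProg_spec {I : EdgeData} {r P q a : ℕ} {σ : Store} (h : Holds I r P q σ) :
    WP (evalProg a) (r * (I.n * (I.ℓ * 11 + 26) + I.m * 20 + 60) + 20)
      (fun σ' => σ'.learner = σ.learner.setReg 2 (I.target r (bits (σ.arr a))).toNat) σ := by
  refine (WP.seq (WP.blk rfl (WP.seq' (WP.forp r (B := I.n * (I.ℓ * 11 + 26) + I.m * 20 + 55)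
    (fun i σ' => σ'.reg 30 = i * I.width ∧ σ'.reg 31 = (I.target i (bits (σ.arr a))).toNat)
    (by simp [h.r]) (by simp [h.one]) (by simp [countProg, edgeProg, copyProg])
    (by simp [countProg, edgeProg, copyProg]) (by simp [countProg, edgeProg, copyProg]) (by simp)
    (by simp [EdgeData.target]) ?_ (fun σ' hf hI => hI)) fun σ' hf hI => WP.blk rfl ?_))).weaken
      (by simp only [List.length]; ring_nf; omega) fun _ h => h
  · intro i hi σ₀ hf hii hI
    have hH0 : Holds I r P q σ₀ := (h.frame (R := [30, 31]) (S := []) (σ' := (σ.setReg 30 0).setReg 31 0)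
      ⟨fun x hx => by simp at hx; simp [hx], fun a _ => rfl⟩).frame hf
      (by simp [countProg, edgeProg, copyProg]) (by simp [countProg, edgeProg, copyProg])
    have ea : σ₀.arr a = σ.arr a := by
      simpa using hf.2 a (by simp [countProg, edgeProg, copyProg])
    refine (WP.seq' (countProg_spec (a := a) hH0) fun σ₁ hf₁ h₁ => WP.seq' (edgeProg_spec (a := a)
      (hH0.frame hf₁ (by simp [countProg]) (by simp [countProg]))) fun σ₂ hf₂ h₂ => WP.seq'
      (copyProg_spec (a := a) ((hH0.frame hf₁ (by simp [countProg]) (by simp [countProg])).frame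
        hf₂ (by simp [edgeProg]) (by simp [edgeProg]))) fun σ₃ hf₃ h₃ =>
      WP.seq (B := 11) (B' := 3) (WP.blk rfl (WP.branch (fun hx => WP.skip_le (by norm_num) ?_)
        fun hx => WP.branch (fun hy => WP.instr rfl ?_) fun hy => WP.skip ?_))).weaken
        (by ring_nf; omega) fun _ h => h
    all_goals
      have a1 : σ₁.arr a = σ₀.arr a := hf₁.2 a (by simp [countProg])
      have a2 : σ₂.arr a = σ₁.arr a := hf₂.2 a (by simp [edgeProg])
      have r1 : σ₁.reg 30 = σ₀.reg 30 := hf₁.1 30 (by simp [countProg])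
      have r2 : σ₂.reg 30 = σ₁.reg 30 := hf₂.1 30 (by simp [edgeProg])
      have r3 : σ₃.reg 30 = i * I.width := by
        rw [hf₃.1 30 (by simp [copyProg]), r2, r1, hI.1]
      have p3 : σ₃.reg 31 = (I.target i (bits (σ.arr a))).toNat := by
        rw [hf₃.1 31 (by simp [copyProg]), hf₂.1 31 (by simp [edgeProg]),
          hf₁.1 31 (by simp [countProg]), hI.2]
      have c6 : σ₃.reg 6 = I.width := by
        rw [hf₃.1 6 (by simp [copyProg]), hf₂.1 6 (by simp [edgeProg]),
          hf₁.1 6 (by simp [countProg]), hH0.width]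
      have c2 : σ₃.reg 2 = 1 := by
        rw [hf₃.1 2 (by simp [copyProg]), hf₂.1 2 (by simp [edgeProg]),
          hf₁.1 2 (by simp [countProg]), hH0.one]
      have c34 : σ₃.reg 34 = ((Finset.range I.n).filter fun v =>
          bits (σ.arr a) (i * I.width + v) = true).card := by
        rw [hf₃.1 34 (by simp [copyProg]), hf₂.1 34 (by simp [edgeProg]), h₁, ea, hI.1]
        simp [bits]
      have c35 : σ₃.reg 35 ≠ 0 ↔ ∃ e < I.m, bits (σ.arr a) (i * I.width + I.eu e) = true ∧
          bits (σ.arr a) (i * I.width + I.ev e) = true := by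
        rw [hf₃.1 35 (by simp [copyProg]), h₂, a1, ea, r1, hI.1]
        simp [bits]
      have c36 : σ₃.reg 36 = 0 ↔ ∀ v < I.n, bits (σ.arr a) (i * I.width + v) = true → ∀ j,
          1 ≤ j → j ≤ I.ℓ → bits (σ.arr a) (i * I.width + (j * I.n + v)) = true := by
        rw [← not_iff_not, ← ne_eq, h₃, a2, a1, ea, r2, r1, hI.1]
        simp only [bits, decide_eq_true_iff]
        push Not
        refine exists_congr fun v => and_congr_right fun _ => and_congr_right fun _ => ?_
        constructor
        · rintro ⟨c, hc, h0⟩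
          exact ⟨c + 1, by omega, by omega, h0⟩
        · rintro ⟨j, hj, hj', h0⟩
          exact ⟨j - 1, by omega, by rwa [Nat.sub_add_cancel hj]⟩
      -- The program adds the two truncated differences of register 34 and 2 to register 36. The sum
      -- vanishes iff exactly two vertices are on and no copy is missing, which leaves register 35
      -- to be tested for the edge.
      have cval : I.blockFun (fun z => bits (σ.arr a) (i * I.width + z)) = true ↔
          σ₃.reg 34 = 2 ∧ σ₃.reg 35 ≠ 0 ∧ σ₃.reg 36 = 0 := by
        rw [EdgeData.blockFun_eq_true, c34, c35, c36]
      have cpos : i * I.width + I.width = (i + 1) * I.width := by ring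
    · have : I.blockFun (fun z => bits (σ.arr a) (i * I.width + z)) = false := by
        rw [Bool.eq_false_iff, ne_eq, cval]
        simp at hx
        omega
      simp [EdgeData.target, r3, c6, cpos, this, p3]
    · simp at hx hy
      have : I.blockFun (fun z => bits (σ.arr a) (i * I.width + z)) = true := by
        rw [cval]
        omega
      simp [EdgeData.target, r3, c6, cpos, this, p3, c2]
      cases I.target i (bits (σ.arr a)) <;> rfl
    · have : I.blockFun (fun z => bits (σ.arr a) (i * I.width + z)) = false := by
        rw [Bool.eq_false_iff, ne_eq, cval]
        simp at hy
        omega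
      simp [EdgeData.target, r3, c6, cpos, this, p3]
  · have hl : σ'.learner = σ.learner := by
      rw [hf.learner_eq (by simp [countProg, edgeProg, copyProg])
        (by simp [countProg, edgeProg, copyProg])]
      exact Frame.learner_eq (R := [30, 31]) (S := [])
        ⟨fun x hx => by simp at hx; simp [hx], fun a _ => rfl⟩ (by simp) (by simp)
    simp only [List.foldl, Instr.det]
    rw [show (104 : ℕ) = lreg 2 from rfl, Store.learner, Store.view_setReg lreg_injective,
      Store.view_setReg lreg_injective]
    have hl' : Store.view lreg larr σ' = Store.view lreg larr σ := hl
    rw [hl']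
    unfold Store.setReg
    congr 1
    have : (lreg 2 : ℕ) = 104 := rfl
    simp [this, hI.2]

/-! ### Uniform distributions -/

theorem PMF.uniformOfFintype_prod (α β : Type*) [Fintype α] [Nonempty α] [Fintype β] [Nonempty β] :
    PMF.uniformOfFintype (α × β) =
      (PMF.uniformOfFintype α).bind fun a => (PMF.uniformOfFintype β).map fun b => (a, b) := by
  classical
  ext ⟨a, b⟩
  simp only [PMF.bind_apply, PMF.map_apply, PMF.uniformOfFintype_apply, tsum_fintype,
    Fintype.card_prod, Prod.mk.injEq]
  rw [Finset.sum_eq_single a]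
  · rw [Finset.sum_eq_single b]
    · simp only [and_self, if_true]
      rw [Nat.cast_mul, ENNReal.mul_inv] <;> simp
    · intro b' _ hb'; simp [Ne.symm hb']
    · simp
  · intro a' _ ha'
    simp [Ne.symm ha']
  · simp

theorem PMF.map_uniformOfFintype_equiv {α β : Type*} [Fintype α] [Nonempty α] [Fintype β]
    [Nonempty β] (e : α ≃ β) : (PMF.uniformOfFintype α).map e = PMF.uniformOfFintype β := by
  classical
  ext b
  simp only [PMF.map_apply, PMF.uniformOfFintype_apply, tsum_fintype]
  rw [Finset.sum_eq_single (e.symm b)]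
  · simp [Fintype.card_congr e]
  · intro a _ ha
    rw [if_neg]
    rintro rfl
    simp at ha
  · simp

theorem PMF.uniformOfFintype_fin_cons (α : Type*) [Fintype α] [Nonempty α] (d : ℕ) :
    PMF.uniformOfFintype (Fin (d + 1) → α) =
      (PMF.uniformOfFintype α).bind fun a =>
        (PMF.uniformOfFintype (Fin d → α)).map fun ω => Fin.cons a ω := by
  rw [← PMF.map_uniformOfFintype_equiv (Fin.consEquiv fun _ : Fin (d + 1) => α),
    PMF.uniformOfFintype_prod, PMF.map_bind]
  simp only [PMF.map_comp]
  rfl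

theorem uniformBelow_eq {m : ℕ} [Nonempty (Fin m)] :
    uniformBelow m = (PMF.uniformOfFintype (Fin m)).map Fin.val := by
  cases m with
  | zero => exact (Classical.arbitrary (Fin 0)).elim0
  | succ m => rfl

/-! ### Drawing an example -/

/-- The numbers behind a choice of `r` points. -/
def vals {r m k : ℕ} (ω : Fin r → Fin m × Fin k) : Fin r → ℕ × ℕ :=
  fun i => ((ω i).1, (ω i).2)

/-- Draw `r` points into the arrays `4` and `5`. -/
def drawProg : PlainProg :=
  Prog.forp 32 33 9 (.seq (.instr (.rand 40 4)) (.seq (.instr (.rand 41 10))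
    (Prog.blk (.store 4 32 40) [.store 5 32 41])))

/-- The points in the arrays `4` and `5`. -/
def drawn (r : ℕ) (σ : Store) : Fin r → ℕ × ℕ := fun i => (σ.arr 4 i, σ.arr 5 i)

/-- The points after `d` draws, starting with the draw number `j`. -/
def overlay {r m k : ℕ} (j d : ℕ) (w : Fin r → ℕ × ℕ) (ω : Fin d → Fin m × Fin k) :
    Fin r → ℕ × ℕ :=
  fun i => if h : j ≤ i ∧ i - j < d then vals ω ⟨i - j, h.2⟩ else w i

/-- Filling place `j` and then the next `d` places is the same as filling `d + 1` places from `j`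
on; the old content shows only outside this window. -/
theorem overlay_succ {r m k : ℕ} {j d : ℕ} (w : Fin r → ℕ × ℕ) (o : Fin m × Fin k)
    (ω : Fin d → Fin m × Fin k) :
    overlay j (d + 1) w (Fin.cons o ω) =
      overlay (j + 1) d (fun i => if (i : ℕ) = j then (o.1, o.2) else w i) ω := by
  funext i
  unfold overlay
  dsimp only
  rcases lt_trichotomy (i : ℕ) j with h | h | h
  · rw [dif_neg (by omega), dif_neg (by omega), if_neg (by omega)]
  · rw [dif_pos (by omega), dif_neg (by omega), if_pos h]
    have : (⟨(i : ℕ) - j, by omega⟩ : Fin (d + 1)) = 0 := by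
      ext; simp; omega
    simp only [vals]
    rw [this, Fin.cons_zero]
  · by_cases h' : (i : ℕ) - j < d + 1
    · rw [dif_pos ⟨h.le, h'⟩, dif_pos (by omega)]
      have : (⟨(i : ℕ) - j, h'⟩ : Fin (d + 1)) = Fin.succ ⟨i - (j + 1), by omega⟩ := by
        ext; simp; omega
      simp only [vals]
      rw [this, Fin.cons_succ]
    · rw [dif_neg (by omega), dif_neg (by omega), if_neg (by omega)]

theorem drawProg_law {I : EdgeData} {r P q : ℕ} {σ : Store} (h : Holds I r P q σ)
    [Nonempty (Fin I.m)] [Nonempty (Fin (4 * I.ℓ))] :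
    Law [drawProg] σ (r * 15 + 15)
      (fun σ' => Frame [32, 33, 40, 41] [4, 5] σ σ' ∧
        ∀ i, (drawn r σ' i).1 < I.m ∧ (drawn r σ' i).2 < 4 * I.ℓ)
      (drawn r)
      ((PMF.uniformOfFintype (Fin r → Fin I.m × Fin (4 * I.ℓ))).map vals) := by
  set body : PlainProg := .seq (.instr (.rand 40 4)) (.seq (.instr (.rand 41 10))
    (Prog.blk (.store 4 32 40) [.store 5 32 41])) with hbody
  set inc : PlainProg := Prog.blk (.add 32 32 2) [.sub 33 9 32] with hinc
  have main : ∀ (d j : ℕ) (σ' : Store), j + d = r → Frame [32, 33, 40, 41] [4, 5] σ σ' →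
      σ'.reg 32 = j → σ'.reg 33 = d →
      (∀ i : Fin r, (i : ℕ) < j → (drawn r σ' i).1 < I.m ∧ (drawn r σ' i).2 < 4 * I.ℓ) →
      Law [.loop 33 (.seq body inc)] σ' (d * 15 + 1)
        (fun σ' => Frame [32, 33, 40, 41] [4, 5] σ σ' ∧
          ∀ i, (drawn r σ' i).1 < I.m ∧ (drawn r σ' i).2 < 4 * I.ℓ)
        (drawn r)
        ((PMF.uniformOfFintype (Fin d → Fin I.m × Fin (4 * I.ℓ))).map
          (overlay j d (drawn r σ'))) := by
    intro d
    induction d with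
    | zero =>
      intro j σ' hj hf hi ht hr
      have e : overlay (m := I.m) (k := 4 * I.ℓ) j 0 (drawn r σ') = fun _ => drawn r σ' := by
        funext ω i
        simp [overlay]
      rw [e, show (PMF.uniformOfFintype (Fin 0 → Fin I.m × Fin (4 * I.ℓ))).map
        (fun _ => drawn r σ') = PMF.pure (drawn r σ') from PMF.map_const _ _]
      exact (Law.loop_zero ht (Law.nil ⟨hf, fun i => hr i (by omega)⟩)).mono (by omega)
        fun _ h => h
    | succ d ih =>
      intro j σ' hj hf hi ht hr
      have c4 : σ'.reg 4 = I.m := by rw [hf.1 4 (by simp), h.m]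
      have c10 : σ'.reg 10 = 4 * I.ℓ := by rw [hf.1 10 (by simp), h.range]
      have c2 : σ'.reg 2 = 1 := by rw [hf.1 2 (by simp), h.one]
      have c9 : σ'.reg 9 = r := by rw [hf.1 9 (by simp), h.r]
      -- A uniform vector is split into its first entry, made of two independent draws, and a
      -- uniform vector of the remaining entries; this matches one iteration of the loop.
      have e : (PMF.uniformOfFintype (Fin (d + 1) → Fin I.m × Fin (4 * I.ℓ))).map
          (overlay j (d + 1) (drawn r σ')) = ((Instr.rand 40 4).exec σ').bind fun σ₁ =>
            ((Instr.rand 41 10).exec σ₁).bind fun σ₂ =>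
              (PMF.uniformOfFintype (Fin d → Fin I.m × Fin (4 * I.ℓ))).map
                (overlay (j + 1) d fun i => if (i : ℕ) = j then (σ₂.reg 40, σ₂.reg 41)
                  else drawn r σ' i) := by
        rw [PMF.uniformOfFintype_fin_cons, PMF.uniformOfFintype_prod, PMF.bind_bind, PMF.map_bind]
        simp only [Instr.exec, c4, uniformBelow_eq, PMF.map_comp, PMF.bind_map, Function.comp_def,
          overlay_succ, Store.setReg_reg, c10, PMF.map_bind]
        simp [Function.comp_def, uniformBelow_eq, PMF.bind_map]
      rw [e]
      refine (Law.loop_succ (by omega) (Law.seq (Law.seq (Law.instr (B := d * 15 + 11) _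
        fun σ₁ h₁ => Law.seq (B := d * 15 + 10) (Law.instr (B := d * 15 + 9) _
          fun σ₂ h₂ => ?_))))).mono (by ring_nf; omega) fun _ h => h
      simp only [Instr.exec, PMF.mem_support_map_iff, c4, uniformBelow_eq] at h₁
      obtain ⟨_, ⟨u, -, rfl⟩, rfl⟩ := h₁
      simp only [Instr.exec, PMF.mem_support_map_iff, Store.setReg_reg, c10] at h₂
      norm_num [c10, uniformBelow_eq] at h₂
      obtain ⟨v, hv, rfl⟩ := h₂
      have hst : WP (Prog.blk (.store 4 32 40) [.store 5 32 41]) 3 (fun σ₃ =>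
          σ₃ = ((((σ'.setReg 40 u).setReg 41 v).setArr 4 (Function.update (σ'.arr 4) j u)).setArr 5
            (Function.update (σ'.arr 5) j v))) ((σ'.setReg 40 ↑u).setReg 41 ↑v) :=
        WP.blk rfl (by simp [hi])
      refine (Law.wp_cons (B := 3) (B' := d * 15 + 5) hst fun σ₃ hf₃ h₃ => ?_).mono (by omega)
        fun _ h => h
      have hin : WP inc 3 (fun σ₄ => σ₄ = (σ₃.setReg 32 (j + 1)).setReg 33 d) σ₃ :=
        WP.blk rfl (by
          subst h₃
          simp [hi, c2, c9]
          congr 1; omega)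
      refine (Law.wp_cons (B := 3) (B' := d * 15 + 1) hin fun σ₄ hf₄ h₄ => ?_).mono (by omega)
        fun _ h => h
      have hd : drawn r σ₄ = fun i : Fin r => if (i : ℕ) = j then ((u : ℕ), (v : ℕ))
          else drawn r σ' i := by
        subst h₄ h₃
        funext i
        by_cases hij : (i : ℕ) = j
        · simp [drawn, hij]
        · simp [drawn, hij]
      have key := ih (j + 1) σ₄ (by omega) ?_ (by subst h₄; simp) (by subst h₄; simp) ?_
      · rw [hd] at key
        simpa using key
      · refine hf.trans ?_
        subst h₄ h₃
        constructor
        · intro x hx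
          simp only [List.mem_cons, List.not_mem_nil, or_false, not_or] at hx
          simp [hx]
        · intro x hx
          simp only [List.mem_cons, List.not_mem_nil, or_false, not_or] at hx
          simp [hx]
      · intro i hij
        rw [hd]
        by_cases hij' : (i : ℕ) = j
        · simp [hij', u.2, hv]
        · simpa [hij'] using hr i (by omega)
  refine (Law.seq ?_).mono (B := r * 15 + 5) (by omega) fun _ h => h
  have hini : WP (Prog.blk (.const 32 0) [.sub 33 9 32]) 3 (fun σ₄ =>
      σ₄ = (σ.setReg 32 0).setReg 33 r) σ := WP.blk rfl (by simp [h.r])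
  refine (Law.wp_cons (B := 3) (B' := r * 15 + 1) hini fun σ₄ hf₄ h₄ => ?_).mono (by omega)
    fun _ h => h
  have key := main r 0 σ₄ (by omega) (hf₄.mono (by simp) (by simp)) (by subst h₄; simp)
    (by subst h₄; simp) (fun i hi => absurd hi (by omega))
  have : overlay (m := I.m) (k := 4 * I.ℓ) 0 r (drawn r σ₄) = vals := by
    funext ω i
    simp [overlay]
  rwa [this] at key

/-- This compares two conditional writes into a cleared row with the disjunction that defines
`EdgeData.pt`. The endpoints are distinct, so the writes do not interfere. -/
theorem update_update_eq {c c' : Prop} [Decidable c] [Decidable c'] {pos a b v : ℕ} {w : ℕ → ℕ}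
    (hw : w (pos + v) = 0) (hab : a ≠ b) :
    (if c' then Function.update (if c then Function.update w (pos + a) 1 else w) (pos + b) 1
      else (if c then Function.update w (pos + a) 1 else w)) (pos + v) =
      (decide ((v = a ∧ c) ∨ (v = b ∧ c'))).toNat := by
  by_cases h1 : v = a
  · subst h1
    by_cases hc : c <;> by_cases hc' : c' <;> simp [hc, hc', hw, hab]
  · by_cases h2 : v = b
    · subst h2
      by_cases hc : c <;> by_cases hc' : c' <;> simp [hc, hc', hw, h1]
    · by_cases hc : c <;> by_cases hc' : c' <;> simp [hc, hc', hw, h1, h2]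

/-- Write the string given by the points in the arrays `4` and `5` to the array `1` of the
learner. -/
def writeProg : PlainProg :=
  .seq (Prog.blk (.const 30 0) [.const 47 0]) (Prog.forp 32 33 9
    (.seq (Prog.blk (.load 40 4 32) [.load 41 2 40, .load 42 3 40, .load 43 5 32, .add 43 43 2])
      (Prog.forp 37 38 14
        (.seq (Prog.forp 44 45 3 (Prog.blk (.add 46 30 44) [.store 22 46 47]))
        (.seq (Prog.blk (.sub 48 43 37) [.sub 49 37 43, .add 48 48 49, .add 50 30 41])
        (.seq (.branch 48 (.instr (.store 22 50 2)) Prog.skip)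
        (.seq (Prog.blk (.add 48 37 5) [.sub 49 48 43, .sub 48 43 48, .add 48 48 49, .add 50 30 42])
        (.seq (.branch 37 Prog.skip (.instr (.const 48 1)))
        (.seq (.branch 48 (.instr (.store 22 50 2)) Prog.skip)
          (.instr (.add 30 30 3)))))))))))

theorem writeProg_spec {I : EdgeData} (hI : I.Valid) {r P q : ℕ} {σ : Store}
    (h : Holds I r P q σ) (hω : ∀ i, (drawn r σ i).1 < I.m) :
    WP writeProg (r * ((I.ℓ + 1) * (I.n * 10 + 60) + 30) + 20) (fun σ' => σ'.arr 22 = fun z =>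
      if z < r * I.width then (EdgeData.extend (I.point (I.decode r) (drawn r σ)) z).toNat
      else σ.arr 22 z) σ := by
  set x := EdgeData.extend (I.point (I.decode r) (drawn r σ)) with hx
  -- The string is produced from left to right: cells below `K` are final, all others still have
  -- their old content.
  set fill : ℕ → ℕ → ℕ := fun K z => if z < K then (x z).toNat else σ.arr 22 z with hfill
  refine (WP.seq (WP.blk rfl (WP.forp r (B := (I.ℓ + 1) * (I.n * 10 + 60) + 25)
    (fun i σ' => σ'.reg 30 = i * I.width ∧ σ'.arr 22 = fill (i * I.width))
    (by simp [h.r]) (by simp [h.one]) (by simp) (by simp) (by simp) (by simp)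
    (by simp [hfill]) ?_ (fun σ' hf hI => hI.2)))).weaken
      (by simp only [List.length]; ring_nf; omega) fun _ h => h
  intro i hi σ₀ hf hii hI₀
  have hH0 : Holds I r P q σ₀ := (h.frame (R := [30, 47]) (S := []) (σ' := (σ.setReg 30 0).setReg 47 0)
      ⟨fun x hx => by simp at hx; simp [hx], fun a _ => rfl⟩).frame hf (by simp) (by simp)
  have a4 : σ₀.arr 4 = σ.arr 4 := by simpa using hf.2 4 (by simp)
  have a5 : σ₀.arr 5 = σ.arr 5 := by simpa using hf.2 5 (by simp)
  have r47 : σ₀.reg 47 = 0 := by simpa using hf.1 47 (by simp)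
  set ω := drawn r σ ⟨i, hi⟩ with hωi
  have hω1 : ω.1 < I.m := hω ⟨i, hi⟩
  have hcell : ∀ j ≤ I.ℓ, ∀ v < I.n, x (i * I.width + j * I.n + v) = I.pt ω v j := by
    intro j hj v hv
    rw [add_assoc]
    exact EdgeData.extend_point (drawn r σ) ⟨i, hi⟩ hv hj
  have b4 : σ.arr 4 i = ω.1 := rfl
  have b5 : σ.arr 5 i = ω.2 := rfl
  refine (WP.seq (WP.blk rfl (WP.forp (I.ℓ + 1) (B := I.n * 10 + 55)
    (fun j σ' => σ'.reg 30 = i * I.width + j * I.n ∧ σ'.arr 22 = fill (i * I.width + j * I.n))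
    (by simp [hH0.succ]) (by simp [hH0.one]) (by simp) (by simp) (by simp) (by simp)
    (by simp [hI₀]) ?_ ?_))).weaken (by simp only [List.length]; ring_nf; omega) fun _ h => h
  · intro j hj σ₁ hf₁ hj₁ hI₁
    have s2 : σ₁.reg 2 = 1 := by simpa [hH0.one] using hf₁.1 2 (by simp)
    have s3 : σ₁.reg 3 = I.n := by simpa [hH0.n] using hf₁.1 3 (by simp)
    have s5 : σ₁.reg 5 = I.ℓ := by simpa [hH0.copies] using hf₁.1 5 (by simp)
    have s41 : σ₁.reg 41 = I.eu ω.1 := by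
      simpa [a4, hii, b4, hH0.eu _ hω1] using hf₁.1 41 (by simp)
    have s42 : σ₁.reg 42 = I.ev ω.1 := by
      simpa [a4, hii, b4, hH0.ev _ hω1] using hf₁.1 42 (by simp)
    have s43 : σ₁.reg 43 = ω.2 + 1 := by
      simpa [a5, hii, b5, hH0.one] using hf₁.1 43 (by simp)
    have s47 : σ₁.reg 47 = 0 := by simpa [r47] using hf₁.1 47 (by simp)
    set pos := i * I.width + j * I.n with hpos
    refine (WP.seq' (WP.forp I.n (B := 3) (fun v σ' => σ'.arr 22 = fun z =>
      if pos ≤ z ∧ z < pos + v then 0 else fill pos z) (by simp [s3]) (by simp [s2]) (by simp)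
      (by simp) (by simp) (by simp) ?_ ?_ (fun σ' hf hI => hI)) fun σ₂ hf₂ hI₂ =>
      WP.seq (B := 7) (B' := 38) (WP.blk rfl ?_)).weaken (by omega) fun _ h => h
    · funext z
      simp [hI₁.2]
    · intro v hv σ' hf' hv' hI'
      have t30 : σ'.reg 30 = pos := by simpa [hI₁.1] using hf'.1 30 (by simp)
      have t47 : σ'.reg 47 = 0 := by simpa [s47] using hf'.1 47 (by simp)
      refine WP.blk rfl ?_
      funext z
      simp only [List.foldl, Instr.det, Store.setReg_reg, Store.setReg_arr, Store.setArr_arr,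
        if_true, t30, hv', hI', Function.update_apply]
      norm_num [t47, t30, hv']
      by_cases hz : z = pos + v
      · rw [if_pos hz, if_pos (by omega)]
      · rw [if_neg hz]
        by_cases hz' : pos ≤ z ∧ z < pos + v
        · rw [if_pos hz', if_pos (by omega)]
        · rw [if_neg hz', if_neg (by omega)]
    · have u2 : σ₂.reg 2 = 1 := by rw [hf₂.1 2 (by simp), s2]
      have u3 : σ₂.reg 3 = I.n := by rw [hf₂.1 3 (by simp), s3]
      have u5 : σ₂.reg 5 = I.ℓ := by rw [hf₂.1 5 (by simp), s5]
      have u30 : σ₂.reg 30 = pos := by rw [hf₂.1 30 (by simp), hI₁.1]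
      have u37 : σ₂.reg 37 = j := by rw [hf₂.1 37 (by simp), hj₁]
      have u41 : σ₂.reg 41 = I.eu ω.1 := by rw [hf₂.1 41 (by simp), s41]
      have u42 : σ₂.reg 42 = I.ev ω.1 := by rw [hf₂.1 42 (by simp), s42]
      have u43 : σ₂.reg 43 = ω.2 + 1 := by rw [hf₂.1 43 (by simp), s43]
      have hwrite : ∀ (c : Prop) [Decidable c] (τ : Store), (τ.reg 48 ≠ 0 ↔ c) → τ.reg 2 = 1 →
          WP (.branch 48 (.instr (.store 22 50 2)) Prog.skip) 2 (fun τ' => τ'.arr 22 =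
            if c then Function.update (τ.arr 22) (τ.reg 50) 1 else τ.arr 22) τ := by
        intro c _ τ hc h2
        refine WP.branch (fun h' => WP.instr rfl ?_) fun h' => WP.skip ?_
        · simp [hc.1 h', h2]
        · have : ¬c := fun hcc => absurd h' (hc.2 hcc)
          simp [this]
      -- Register 48 is the distance of the copy `j` from the removed copy, first for `eu` and then,
      -- shifted by ℓ, for `ev`. For `j = 0` the second distance is replaced by 1, since copy 0 is
      -- never removed.
      refine (WP.seq' (hwrite (j ≠ ω.2 + 1) _ (by simp [u37, u43]; omega) (by simp [u2]))
        fun σ₃ hf₃ h₃ => WP.seq' (B := 9) (P := fun τ => τ.reg 48 = (ω.2 + 1 - (j + I.ℓ)) +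
          (j + I.ℓ - (ω.2 + 1)) ∧ τ.reg 50 = pos + I.ev ω.1 ∧ τ.arr 22 = σ₃.arr 22)
          (WP.blk rfl ?_) fun σ₄ hf₄ h₄ => WP.seq' (B := 2) (P := fun τ =>
            (τ.reg 48 ≠ 0 ↔ ¬(1 ≤ j ∧ j + I.ℓ = ω.2 + 1)) ∧ τ.reg 50 = pos + I.ev ω.1 ∧
            τ.arr 22 = σ₃.arr 22) (WP.branch (fun h' => WP.skip ?_) fun h' => WP.instr rfl ?_)
          fun σ₅ hf₅ h₅ => WP.seq' (hwrite _ σ₅ h₅.1 ?_) fun σ₆ hf₆ h₆ =>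
            WP.instr rfl ?_).weaken (by norm_num) fun _ h => h
      · have v3 : ∀ y ∉ [48, 49, 50, 99], σ₃.reg y = σ₂.reg y := by
          intro y hy
          simp only [List.mem_cons, List.not_mem_nil, or_false, not_or] at hy
          rw [hf₃.1 y (by simp [hy])]
          simp [hy]
        simp [v3, u37, u5, u43, u30, u42]
      all_goals
        have v3 : ∀ y ∉ [48, 49, 50, 99], σ₃.reg y = σ₂.reg y := by
          intro y hy
          simp only [List.mem_cons, List.not_mem_nil, or_false, not_or] at hy
          rw [hf₃.1 y (by simp [hy])]
          simp [hy]
        have v4 : ∀ y ∉ [48, 49, 50, 99], σ₄.reg y = σ₂.reg y := by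
          intro y hy
          rw [← v3 y hy]
          simp only [List.mem_cons, List.not_mem_nil, or_false, not_or] at hy
          exact hf₄.1 y (by simp [hy])
      · have : σ₄.reg 37 = j := by rw [v4 37 (by simp), u37]
        rw [this] at h'
        refine ⟨?_, by simp [h₄], by simp [h₄]⟩
        simp [h₄]
        omega
      · have : σ₄.reg 37 = j := by rw [v4 37 (by simp), u37]
        rw [this] at h'
        refine ⟨?_, by simp [h₄], by simp [h₄]⟩
        simp [h']
      · rw [hf₅.1 2 (by simp), v4 2 (by simp), u2]
      · have w30 : σ₆.reg 30 = pos := by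
          rw [hf₆.1 30 (by simp), hf₅.1 30 (by simp), v4 30 (by simp), u30]
        have w3 : σ₆.reg 3 = I.n := by
          rw [hf₆.1 3 (by simp), hf₅.1 3 (by simp), v4 3 (by simp), u3]
        have hne := hI.ne _ hω1
        have hlu := hI.lt_u _ hω1
        have hlv := hI.lt_v _ hω1
        refine ⟨by simp [w30, w3, hpos]; ring, ?_⟩
        have h₃' : σ₃.arr 22 = if j ≠ ω.2 + 1 then
            Function.update (σ₂.arr 22) (pos + I.eu ω.1) 1 else σ₂.arr 22 := by
          rw [h₃]; simp [u30, u41]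
        have e1 : i * I.width + (j + 1) * I.n = pos + I.n := by rw [hpos]; ring
        simp only [Instr.det, Store.setReg_arr, h₆, h₅.2.1, h₅.2.2, h₃', e1, hI₂]
        funext z
        by_cases hz : pos ≤ z ∧ z < pos + I.n
        · obtain ⟨v, rfl⟩ : ∃ v, z = pos + v := ⟨z - pos, by omega⟩
          have hv : v < I.n := by omega
          have e2 : fill (pos + I.n) (pos + v) = (I.pt ω v j).toNat := by
            simp only [hfill]
            rw [if_pos (by omega), hcell j (by omega) v hv]
          rw [e2, EdgeData.pt]
          exact update_update_eq (by simp [hv]) hne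
        · have e2 : fill (pos + I.n) z = fill pos z := by
            simp only [hfill]
            by_cases hz' : z < pos
            · rw [if_pos hz', if_pos (by omega)]
            · rw [if_neg hz', if_neg (by omega)]
          rw [e2]
          have z1 : z ≠ pos + I.eu ω.1 := by omega
          have z2 : z ≠ pos + I.ev ω.1 := by omega
          split_ifs <;> simp [z1, z2, hz]
  · intro σ' hf' hI'
    have : i * I.width + (I.ℓ + 1) * I.n = (i + 1) * I.width := by
      rw [EdgeData.width]; ring
    rw [this] at hI'
    simpa using hI'

/-! ### The oracles of the learner -/

/-- The distribution of the examples. -/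
noncomputable def EdgeData.examples (I : EdgeData) (r : ℕ) [Nonempty (Fin I.m)]
    [Nonempty (Fin (4 * I.ℓ))] : PMF (Fin (r * I.width) → Bool) :=
  (PMF.uniformOfFintype (Fin r → Fin I.m × Fin (4 * I.ℓ))).map fun ω =>
    I.point (I.decode r) (vals ω)

/-- The target on strings of the right length. -/
noncomputable def EdgeData.goal (I : EdgeData) (r : ℕ) (x : Fin (r * I.width) → Bool) : Bool :=
  I.target r (EdgeData.extend x)

/-- The subroutines for the oracle calls. -/
def oracleProg : LearnCall → PlainProg
  | .query => evalProg 20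
  | .sample => .seq drawProg (.seq writeProg (evalProg 22))

/-- The memory during the simulation; the register `15` holds the budget of the search. -/
def Ready (I : EdgeData) (r P q b : ℕ) (σ : Store) : Prop := Holds I r P q σ ∧ σ.reg 15 = b

theorem Ready.frame {I : EdgeData} {r P q b : ℕ} {σ σ' : Store} (h : Ready I r P q b σ)
    {R S : List ℕ} (hf : Frame R S σ σ') (hR : ∀ x ∈ R, 16 ≤ x := by decide)
    (hS : ∀ a ∈ S, 4 ≤ a := by decide) : Ready I r P q b σ' :=
  ⟨h.1.frame hf (fun x hx => by have := hR x hx; omega) hS,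
    (hf.1 15 fun hx => by have := hR _ hx; omega).trans h.2⟩

theorem Ready.sameAux {I : EdgeData} {r P q b : ℕ} {σ σ' : Store} (h : Ready I r P q b σ)
    (hs : SameAux σ σ') : Ready I r P q b σ' := by
  have h1 : ∀ x < 15, σ'.reg x = σ.reg x := fun x hx =>
    hs.1 x (by omega) (by omega) (by omega) (by omega)
  have h2 : ∀ a < 4, σ'.arr a = σ.arr a := fun a ha => hs.2 a (by omega)
  obtain ⟨h, h'⟩ := h
  refine ⟨?_, (hs.1 15 (by omega) (by omega) (by omega) (by omega)).trans h'⟩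
  constructor <;> (first | rw [h1 _ (by norm_num)] | rw [h2 _ (by norm_num)])
  exacts [h.one, h.n, h.m, h.copies, h.width, h.N, h.rows, h.r, h.range, h.P, h.q, h.succ, h.eu,
    h.ev]

theorem regs_evalProg (a : ℕ) : ∀ x ∈ (evalProg a).regs, 30 ≤ x := by
  simp [evalProg, countProg, edgeProg, copyProg]

theorem arrs_evalProg (a : ℕ) : (evalProg a).arrs = [] := by
  simp [evalProg, countProg, edgeProg, copyProg]

theorem regs_writeProg : ∀ x ∈ writeProg.regs, 30 ≤ x ∧ x < 100 := by
  simp [writeProg]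

theorem arrs_writeProg : ∀ x ∈ writeProg.arrs, x = 22 := by
  simp [writeProg]

/-- The number of steps for an oracle call. -/
def EdgeData.callCost (I : EdgeData) (r : ℕ) : ℕ :=
  r * ((I.ℓ + 1) * (I.n * 21 + 60) + I.n * 26 + I.m * 20 + 105) + 60

/-- The target depends only on the first `r * I.width` cells, so it can be evaluated directly on the
learner's arrays. An example is a deterministic function of the drawn points, so its law is the
image of their uniform law. -/
theorem oracleProg_law {I : EdgeData} (hI : I.Valid) {r P q b : ℕ} [Nonempty (Fin I.m)]
    [Nonempty (Fin (4 * I.ℓ))] (i : LearnCall) (σ : Store) (h : Ready I r P q b σ) :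
    Law [oracleProg i] σ (I.callCost r)
      (fun σ' => Ready I r P q b σ' ∧ σ'.reg 17 = σ.reg 17) Store.learner
      (learnOracle (I.goal r) (I.examples r) i σ.learner) := by
  cases i with
  | query =>
    have hb : r * (I.n * (I.ℓ * 11 + 26) + I.m * 20 + 60) + 20 ≤ I.callCost r := by
      unfold EdgeData.callCost
      gcongr ?_ + ?_
      · gcongr
        nlinarith [Nat.zero_le (I.n * I.ℓ)]
        norm_num
      · norm_num
    refine Law.of_wp ((evalProg_spec (a := 20) h.1).weaken hb fun _ h => h) fun σ' hf hQ =>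
      ⟨⟨h.frame hf (fun x hx => ?_) ?_, hf.1 17 fun hx => ?_⟩, ?_⟩
    · have := regs_evalProg _ x hx; omega
    · rw [oracleProg, arrs_evalProg]; simp
    · have := regs_evalProg _ _ hx; omega
    · rw [hQ]
      congr 2
      refine EdgeData.target_congr hI fun z hz => ?_
      rw [EdgeData.extend, dif_pos hz]
      rfl
  | sample =>
    set κ : (Fin r → ℕ × ℕ) → Store := fun w =>
      (σ.learner.setReg 2 (I.goal r (I.point (I.decode r) w)).toNat).setArr 1 fun j =>
        if hj : j < r * I.width then (I.point (I.decode r) w ⟨j, hj⟩).toNat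
        else σ.learner.arr 1 j with hκ
    have e : learnOracle (I.goal r) (I.examples r) LearnCall.sample σ.learner =
        ((PMF.uniformOfFintype (Fin r → Fin I.m × Fin (4 * I.ℓ))).map vals).bind fun w =>
          PMF.pure (κ w) := by
      rw [show (fun w => PMF.pure (κ w)) = PMF.pure ∘ κ from rfl, PMF.bind_pure_comp, PMF.map_comp,
        learnOracle, EdgeData.examples, PMF.map_comp]
      rfl
    rw [e]
    have hb : (r * 15 + 15) + ((r * ((I.ℓ + 1) * (I.n * 10 + 60) + 30) + 20) +
        (r * (I.n * (I.ℓ * 11 + 26) + I.m * 20 + 60) + 20) + 1) + 1 ≤ I.callCost r := by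
      unfold EdgeData.callCost
      nlinarith [Nat.zero_le (r * (I.n * I.ℓ)), Nat.zero_le (r * I.n), Nat.zero_le (r * I.ℓ)]
    refine (Law.seq ((drawProg_law h.1).append (ks' := [.seq writeProg (evalProg 22)])
      fun σ₁ h₁ => ?_)).mono hb fun _ h => h
    obtain ⟨hf₁, hω⟩ := h₁
    have hR₁ := h.frame hf₁
    refine Law.of_wp (Q := fun σ' => σ'.learner = κ (drawn r σ₁))
      (WP.seq' (writeProg_spec hI hR₁.1 fun i => (hω i).1) fun σ₂ hf₂ h₂ =>
      (evalProg_spec (a := 22) (hR₁.frame hf₂ (fun x hx => ?_) fun a ha => ?_).1).weaken le_rfl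
      fun σ₃ h₃ => ?_) fun σ₃ hf₃ h₃ =>
      ⟨⟨hR₁.frame hf₃ (fun x hx => ?_) fun a ha => ?_, ?_⟩, h₃⟩
    · have := regs_writeProg x hx; omega
    · have := arrs_writeProg a ha; omega
    · have hl₁ : σ₁.learner = σ.learner := hf₁.learner_eq (by simp) (by simp)
      have hr₂ : σ₂.learner.reg = σ.learner.reg := by
        rw [← hl₁]
        funext x
        exact hf₂.1 (lreg x) fun hx => by have := regs_writeProg _ hx; unfold lreg at this; omega
      have ha₂ : σ₂.learner.arr = Function.update σ.learner.arr 1 fun j =>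
          if hj : j < r * I.width then (I.point (I.decode r) (drawn r σ₁) ⟨j, hj⟩).toNat
          else σ.learner.arr 1 j := by
        funext a
        rw [← hl₁]
        by_cases h1 : a = 1
        · subst h1
          rw [Function.update_self]
          change σ₂.arr 22 = _
          rw [h₂]
          funext z
          by_cases hz : z < r * I.width
          · rw [if_pos hz, dif_pos hz, EdgeData.extend, dif_pos hz]
          · rw [if_neg hz, dif_neg hz]
            rfl
        · rw [Function.update_of_ne h1]
          exact hf₂.2 (larr a) fun hx => by
            have := arrs_writeProg _ hx; unfold larr at this; omega
      have hb22 : I.target r (bits (σ₂.arr 22)) = I.goal r (I.point (I.decode r) (drawn r σ₁)) := by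
        refine EdgeData.target_congr hI fun z hz => ?_
        rw [bits, h₂]
        simp only [if_pos hz]
        cases EdgeData.extend (I.point (I.decode r) (drawn r σ₁)) z <;> rfl
      rw [h₃, hb22, hκ]
      unfold Store.setReg Store.setArr
      rw [hr₂, ha₂]
    · simp only [Prog.regs, List.mem_append] at hx
      rcases hx with hx | hx
      · have := regs_writeProg x hx; omega
      · have := regs_evalProg _ x hx; omega
    · simp only [Prog.arrs, List.mem_append, arrs_evalProg] at ha
      rcases ha with ha | ha
      · have := arrs_writeProg a ha; omega
      · simp at ha
    · rw [hf₃.1 17 fun hx => ?_, hf₁.1 17 (by simp)]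
      simp only [Prog.regs, List.mem_append] at hx
      rcases hx with hx | hx
      · have := regs_writeProg _ hx; omega
      · have := regs_evalProg _ _ hx; omega

/-! ### Depth first search of the output of the learner -/

namespace EdgeData

variable (I : EdgeData)

/-- The set of vertices that are marked in the row at the offset `o`. -/
def rowAt (c : ℕ → ℕ) (o : ℕ) : Finset ℕ := (Finset.range I.n).filter fun v => c (o + v) ≠ 0

open Classical in
/-- Mark the vertex `v` in the row at the offset `o` if it covers a new edge. -/
noncomputable def mark (c : ℕ → ℕ) (o v : ℕ) : ℕ → ℕ :=
  if I.Useful (I.rowAt c o) v then Function.update c (o + v) 1 else c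

end EdgeData

/-- Copy the `R` cells at `o` to the next `R` cells. -/
def dup (c : ℕ → ℕ) (o R : ℕ) : ℕ → ℕ :=
  fun z => if o + R ≤ z ∧ z < o + R + R then c (z - R) else c z

/-- The state of the search. -/
structure Search : Type where
  (ptr top height : ℕ)
  found : Bool
  cells : ℕ → ℕ

/-- One step of the search; `a` is the sequence of the tokens, and `base` and `vtx` are the offset
of the block and the vertex for a token. -/
noncomputable def Search.next (I : EdgeData) (r P q : ℕ) (a base vtx : ℕ → ℕ) (s : Search) :
    Search :=
  if s.height = 0 then s
  else if 2 ≤ a s.ptr then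
    { ptr := s.ptr + 1
      top := s.top + r * I.n
      height := s.height + 1
      found := s.found || decide (q * I.cand (I.rowAt (I.mark s.cells (s.top + base (a s.ptr))
        (vtx (a s.ptr))) (s.top + base (a s.ptr))) ≤ P)
      cells := dup (I.mark s.cells (s.top + base (a s.ptr)) (vtx (a s.ptr))) s.top (r * I.n) }
  else
    { ptr := s.ptr + 1
      top := s.top - r * I.n
      height := s.height - 1
      found := s.found
      cells := s.cells }

/-- Below the rows `W`, the test fails at all inner nodes of the tree. -/
noncomputable def EdgeData.Passes (I : EdgeData) {r N : ℕ} (dec : Fin N → Fin r × ℕ × ℕ)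
    (P q : ℕ) : DTree N → (Fin r → Finset ℕ) → Prop
  | .leaf _, _ => True
  | .node x T T', W =>
    P < q * I.cand (I.greedy (W (dec x).1) (dec x).2.1) ∧
    EdgeData.Passes I dec P q T (Function.update W (dec x).1 (I.greedy (W (dec x).1) (dec x).2.1)) ∧
    EdgeData.Passes I dec P q T' (Function.update W (dec x).1 (I.greedy (W (dec x).1) (dec x).2.1))

namespace EdgeData

variable {I : EdgeData}

/-- The greedy cover depends on the queried vertices but not on the answers, so both children of a
node see the same rows. The cover of a block at a leaf is the initial one, covered by `hH`, or has
been tested at the last query to that block. -/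
theorem Passes.largeLeaves {r N : ℕ} {dec : Fin N → Fin r × ℕ × ℕ} {P q k : ℕ}
    (hk : ∀ c, P < q * c → k ≤ c) {T : DTree N} {H : Fin r → Hist}
    (hT : I.Passes dec P q T fun i => I.cover (H i)) (hH : ∀ i, P < q * I.cand (I.cover (H i))) :
    I.LargeLeaves dec k T H := by
  induction T generalizing H with
  | leaf b => exact fun i => hk _ (hH i)
  | node x T T' ih ih' =>
    obtain ⟨h1, h2, h3⟩ := hT
    have key : ∀ b, (fun i => I.cover (Function.update H (dec x).1
        (((dec x).2.1, (dec x).2.2, b) :: H (dec x).1) i)) =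
        Function.update (fun i => I.cover (H i)) (dec x).1
          (I.greedy (I.cover (H (dec x).1)) (dec x).2.1) := by
      intro b
      funext i
      by_cases hi : i = (dec x).1
      · subst hi; simp [cover]
      · simp [hi]
    have key2 : ∀ b i, P < q * I.cand (I.cover (Function.update H (dec x).1
        (((dec x).2.1, (dec x).2.2, b) :: H (dec x).1) i)) := by
      intro b i
      rw [show I.cover (Function.update H (dec x).1
        (((dec x).2.1, (dec x).2.2, b) :: H (dec x).1) i) = _ from congrFun (key b) i]
      by_cases hi : i = (dec x).1
      · subst hi; simpa using h1
      · simpa [hi] using hH i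
    exact ⟨ih (by rw [key]; exact h2) (key2 _), ih' (by rw [key]; exact h3) (key2 _)⟩

theorem rowAt_congr {c c' : ℕ → ℕ} {o o' : ℕ} (h : ∀ v < I.n, c (o + v) = c' (o' + v)) :
    I.rowAt c o = I.rowAt c' o' := by
  unfold rowAt
  refine Finset.filter_congr fun v hv => ?_
  rw [h v (by simpa using hv)]

theorem rowAt_mark_self {c : ℕ → ℕ} {o v : ℕ} (hv : v < I.n) :
    I.rowAt (I.mark c o v) o = I.greedy (I.rowAt c o) v := by
  unfold mark greedy
  split_ifs with h
  · ext w
    simp only [rowAt, Finset.mem_filter, Finset.mem_range, Finset.mem_insert,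
      Function.update_apply, Nat.add_left_cancel_iff]
    by_cases hw : w = v
    · simp [hw, hv]
    · simp [hw]
  · rfl

theorem mark_apply_of_ne {c : ℕ → ℕ} {o v z : ℕ} (hz : z ≠ o + v) : I.mark c o v z = c z := by
  unfold mark
  split_ifs
  · simp [hz]
  · rfl

end EdgeData

/-- The tables for the tokens of the variables. -/
def Tables (I : EdgeData) (r : ℕ) (base vtx : ℕ → ℕ) : Prop :=
  ∀ z < r * I.width, base (z + 2) = z / I.width * I.n ∧ vtx (z + 2) = z % I.width % I.n

/-- Reading the code of a subtree pops exactly one stack frame and leaves the frames below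
unchanged. Both children start from the same marks: the left one works on a copy pushed on top, the
right one on the original. For `h = 0` the final `top` is a truncated 0, and no further row is read.
-/
theorem Search.iterate_encode {I : EdgeData} {r P q : ℕ} {a base vtx : ℕ → ℕ}
    (hn : 0 < I.n) (ht : Tables I r base vtx)
    (T : DTree (r * I.width)) (s : Search) (h : ℕ) (hh : s.height = h + 1)
    (htop : s.top = h * (r * I.n))
    (ha : ∀ (j : ℕ) (hj : j < T.encode.length), a (s.ptr + j) = T.encode[j])
    (W : Fin r → Finset ℕ) (hW : ∀ i : Fin r, I.rowAt s.cells (s.top + i * I.n) = W i) :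
    let s' := (Search.next I r P q a base vtx)^[T.encode.length] s
    s'.ptr = s.ptr + T.encode.length ∧ s'.height = h ∧ s'.top = h * (r * I.n) - r * I.n ∧
      (∀ z < h * (r * I.n), s'.cells z = s.cells z) ∧
      (s'.found = false → s.found = false ∧ I.Passes (I.decode r) P q T W) := by
  induction T generalizing s h W with
  | leaf b =>
    have h0 : a s.ptr = b.toNat := by simpa [DTree.encode] using ha 0 (by simp [DTree.encode])
    have h1 : ¬(2 ≤ a s.ptr) := by rw [h0]; cases b <;> simp
    simp [DTree.encode, Search.next, hh, h1, htop, EdgeData.Passes]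
  | node x T T' ih ih' =>
    intro s'
    set R := r * I.n with hR
    have h0 : a s.ptr = x + 2 := by simpa [DTree.encode] using ha 0 (by simp [DTree.encode])
    obtain ⟨hb, hv⟩ := ht x x.2
    set i := (I.decode r x).1 with hi
    set v := (I.decode r x).2.1 with hvd
    have hb' : base (a s.ptr) = i * I.n := by rw [h0, hb]; rfl
    have hv' : vtx (a s.ptr) = v := by rw [h0, hv]; rfl
    have hvn : v < I.n := by rw [hvd]; exact Nat.mod_lt _ hn
    set c := I.mark s.cells (s.top + i * I.n) v with hc
    have hiR : (i : ℕ) * I.n + I.n ≤ R := by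
      calc (i : ℕ) * I.n + I.n = (i + 1) * I.n := by ring
        _ ≤ _ := Nat.mul_le_mul_right _ i.2
    set W' := Function.update W i (I.greedy (W i) v) with hW'
    have hcW : ∀ i' : Fin r, I.rowAt c (s.top + i' * I.n) = W' i' := by
      intro i'
      by_cases hii : i' = i
      · rw [hii, hc, EdgeData.rowAt_mark_self hvn, hW i, hW', Function.update_self]
      · rw [hW', Function.update_of_ne hii, ← hW i']
        refine EdgeData.rowAt_congr fun w hw => EdgeData.mark_apply_of_ne fun he => hii ?_
        have e : (i' : ℕ) * I.n + w = i * I.n + v := by omega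
        ext
        have e1 : ((i' : ℕ) * I.n + w) / I.n = i' := by
          rw [mul_comm, Nat.mul_add_div hn, Nat.div_eq_of_lt hw, add_zero]
        have e2 : ((i : ℕ) * I.n + v) / I.n = i := by
          rw [mul_comm, Nat.mul_add_div hn, Nat.div_eq_of_lt hvn, add_zero]
        rw [← e1, e, e2]
    set s₁ := Search.next I r P q a base vtx s with hs₁
    have e₁ : s₁ = ⟨s.ptr + 1, s.top + R, s.height + 1,
        s.found || decide (q * I.cand (I.rowAt c (s.top + i * I.n)) ≤ P), dup c s.top R⟩ := by
      rw [hs₁, Search.next, if_neg (by omega), if_pos (by omega), hb', hv']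
    have hfound : s₁.found = false → s.found = false ∧ P < q * I.cand (I.greedy (W i) v) := by
      rw [e₁]
      simp only [Bool.or_eq_false_iff, decide_eq_false_iff_not, not_le]
      rintro ⟨h1, h2⟩
      refine ⟨h1, ?_⟩
      rwa [hcW, hW', Function.update_self] at h2
    have hlow : ∀ z < s.top + R, s₁.cells z = c z := by
      intro z hz
      rw [e₁]
      simp only [dup]
      rw [if_neg (by omega)]
    have hlen : (DTree.node x T T').encode.length = T'.encode.length + (T.encode.length + 1) := by
      simp [DTree.encode]; omega
    have hsucc : (h + 1) * R = h * R + R := by ring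
    obtain ⟨a1, a2, a3, a4, a5⟩ := ih s₁ (h + 1) (by rw [e₁, ← hh]) (by rw [e₁, hsucc, htop])
      (by
        intro j hj
        have := ha (j + 1) (by rw [hlen]; omega)
        rw [show s₁.ptr + j = s.ptr + (j + 1) by rw [e₁]; simp only; omega, this]
        simp [DTree.encode, List.getElem_append_left hj])
      W' (by
        intro i'
        rw [← hcW i']
        have hi'R : (i' : ℕ) * I.n + I.n ≤ R := by
          calc (i' : ℕ) * I.n + I.n = (i' + 1) * I.n := by ring
            _ ≤ _ := Nat.mul_le_mul_right _ i'.2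
        refine EdgeData.rowAt_congr fun w hw => ?_
        rw [e₁]
        simp only [dup]
        rw [if_pos (by omega)]
        congr 1; omega)
    set s₂ := (Search.next I r P q a base vtx)^[T.encode.length] s₁ with hs₂
    -- The left subtree has consumed the copy, so `s₂.top` equals `s.top`, and the frame found there
    -- still contains the new mark.
    obtain ⟨b1, b2, b3, b4, b5⟩ := ih' s₂ h a2 (by rw [a3, hsucc]; omega)
      (by
        intro j hj
        have := ha (T.encode.length + 1 + j) (by rw [hlen]; omega)
        rw [show s₂.ptr + j = s.ptr + (T.encode.length + 1 + j) by
          rw [a1, e₁]; simp only; omega, this]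
        have e : T.encode.length + 1 + j = (T.encode.length + j) + 1 := by omega
        simp only [DTree.encode, e, List.getElem_cons_succ]
        rw [List.getElem_append_right (by omega)]
        congr 1; omega)
      W' (by
        intro i'
        rw [← hcW i']
        have hi'R : (i' : ℕ) * I.n + I.n ≤ R := by
          calc (i' : ℕ) * I.n + I.n = (i' + 1) * I.n := by ring
            _ ≤ _ := Nat.mul_le_mul_right _ i'.2
        refine EdgeData.rowAt_congr fun w hw => ?_
        have : s₂.top = s.top := by rw [a3, htop, hsucc]; omega
        rw [this, a4 _ (by rw [hsucc, ← htop]; omega), hlow _ (by omega)])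
    have hs' : s' = (Search.next I r P q a base vtx)^[T'.encode.length] s₂ := by
      change (Search.next I r P q a base vtx)^[(DTree.node x T T').encode.length] s = _
      rw [hlen, Function.iterate_add_apply, Function.iterate_succ_apply]
    rw [hs']
    refine ⟨?_, b2, b3, fun z hz => ?_, fun hf => ?_⟩
    · rw [b1, a1, e₁, hlen]; simp only; omega
    · rw [b4 z hz, a4 z (by rw [hsucc]; omega), hlow z (by omega)]
      exact EdgeData.mark_apply_of_ne (by omega)
    · obtain ⟨f2, p2⟩ := b5 hf
      obtain ⟨f1, p1⟩ := a5 f2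
      obtain ⟨f0, p0⟩ := hfound f1
      exact ⟨f0, p0, p1, p2⟩

theorem Search.iterate_zero {I : EdgeData} {r P q : ℕ} {a base vtx : ℕ → ℕ} {s : Search}
    (h : s.height = 0) (j : ℕ) : (Search.next I r P q a base vtx)^[j] s = s := by
  induction j with
  | zero => rfl
  | succ j ih => rw [Function.iterate_succ_apply', ih, Search.next, if_pos h]

/-- No assumption on the tokens or the cells is needed: every successful test is performed on an
actual set of vertices, even if the learner has written nonsense. -/
theorem Search.found_sound {I : EdgeData} {r P q : ℕ} {a base vtx : ℕ → ℕ} {s : Search}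
    (h : s.found = false) (j : ℕ)
    (hj : ((Search.next I r P q a base vtx)^[j] s).found = true) :
    ∃ W, q * I.cand W ≤ P := by
  induction j with
  | zero => rw [Function.iterate_zero, id, h] at hj; exact absurd hj (by simp)
  | succ j ih =>
    rw [Function.iterate_succ_apply', Search.next] at hj
    split_ifs at hj
    · exact ih hj
    · simp only [Bool.or_eq_true, decide_eq_true_iff] at hj
      rcases hj with hj | hj
      · exact ih hj
      · exact ⟨_, hj⟩
    · exact ih hj

/-- If the search over the serialization of a tree fails, then the tree passes. -/
theorem Search.passes {I : EdgeData} {r P q b : ℕ} {a base vtx : ℕ → ℕ} (hn : 0 < I.n)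
    (ht : Tables I r base vtx) (T : DTree (r * I.width))
    (ha : ∀ (j : ℕ) (hj : j < T.encode.length), a j = T.encode[j]) (hb : T.encode.length ≤ b)
    {c : ℕ → ℕ} (hc : ∀ z < r * I.n, c z = 0)
    (hf : ((Search.next I r P q a base vtx)^[b] ⟨0, 0, 1, false, c⟩).found = false) :
    I.Passes (I.decode r) P q T fun _ => ∅ := by
  obtain ⟨-, h2, -, -, h5⟩ := Search.iterate_encode (P := P) (q := q) hn ht T ⟨0, 0, 1, false, c⟩ 0
    rfl (by simp) (by simpa using ha) (fun _ => ∅) (by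
      intro i
      have hiR : (i : ℕ) * I.n + I.n ≤ r * I.n := by
        calc (i : ℕ) * I.n + I.n = (i + 1) * I.n := by ring
          _ ≤ _ := Nat.mul_le_mul_right _ i.2
      ext v
      simp only [EdgeData.rowAt, Finset.mem_filter, Finset.mem_range, Finset.notMem_empty,
        iff_false, not_and, not_not]
      intro hv
      exact hc _ (by omega))
  -- After the code has been read the height is 0, and the rest of the budget is spent idly.
  obtain ⟨d, rfl⟩ := Nat.exists_eq_add_of_le' hb
  rw [Function.iterate_add_apply, Search.iterate_zero h2] at hf
  exact (h5 hf).2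

/-! ### The program for the search -/

/-- Tabulate the offset of the block and the vertex for the tokens of the variables. -/
def tableProg : PlainProg :=
  .seq (Prog.blk (.const 50 2) [.const 51 0]) (Prog.forp 55 56 9
    (.seq (Prog.forp 57 58 14 (Prog.forp 59 60 3
      (Prog.blk (.store 6 50 51) [.store 7 50 59, .add 50 50 2])))
    (.instr (.add 51 51 3))))

theorem EdgeData.digits {I : EdgeData} {i j v : ℕ} (hj : j ≤ I.ℓ) (hv : v < I.n) :
    (i * I.width + (j * I.n + v)) / I.width = i ∧
      (i * I.width + (j * I.n + v)) % I.width % I.n = v := by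
  have hlt := lt_width hv hj
  constructor
  · rw [mul_comm i, Nat.mul_add_div (by omega), Nat.div_eq_of_lt hlt, add_zero]
  · rw [mul_comm i, Nat.mul_add_mod, Nat.mod_eq_of_lt hlt, mul_comm j, Nat.mul_add_mod,
      Nat.mod_eq_of_lt hv]

/-- Instead of dividing, the program enumerates the variables in their natural order by block, copy
and vertex. The pointer starts at 2 because the token of the variable `z` is `z + 2`. -/
theorem tableProg_spec {I : EdgeData} {r P q : ℕ} {σ : Store} (h : Holds I r P q σ) :
    WP tableProg (r * ((I.ℓ + 1) * (I.n * 10 + 10) + 12) + 9)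
      (fun σ' => Tables I r (σ'.arr 6) (σ'.arr 7)) σ := by
  set Inv : ℕ → ℕ → Store → Prop := fun K o σ' => σ'.reg 50 = K + 2 ∧ σ'.reg 51 = o ∧
    ∀ z < K, σ'.arr 6 (z + 2) = z / I.width * I.n ∧ σ'.arr 7 (z + 2) = z % I.width % I.n with hInv
  have hset : ∀ {K o : ℕ} {σ' : Store} {x v y w : ℕ}, x ≠ 50 → x ≠ 51 → y ≠ 50 → y ≠ 51 →
      Inv K o σ' → Inv K o ((σ'.setReg x v).setReg y w) := by
    intro K o σ' x v y w h1 h2 h3 h4 hI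
    simpa [hInv, h1.symm, h2.symm, h3.symm, h4.symm] using hI
  refine (WP.seq (WP.blk rfl (WP.forp r (B := (I.ℓ + 1) * (I.n * 10 + 10) + 7)
    (fun i σ' => Inv (i * I.width) (i * I.n) σ') (by simp [h.r]) (by simp [h.one]) (by simp)
    (by simp) (by simp) (by simp) (hset (by simp) (by simp) (by simp) (by simp) (by simp [hInv])) ?_
    (fun σ' hf hI z hz => hI.2.2 z hz)))).weaken
      (by simp only [List.length]; ring_nf; omega) fun _ h => h
  intro i hi σ₁ hf₁ hi₁ hI₁
  have c2 : σ₁.reg 2 = 1 := by simpa [h.one] using hf₁.1 2 (by simp)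
  have c3 : σ₁.reg 3 = I.n := by simpa [h.n] using hf₁.1 3 (by simp)
  have c14 : σ₁.reg 14 = I.ℓ + 1 := by simpa [h.succ] using hf₁.1 14 (by simp)
  refine (WP.seq' (WP.forp (I.ℓ + 1) (B := I.n * 10 + 5)
    (fun j σ' => Inv (i * I.width + j * I.n) (i * I.n) σ') c14 c2 (by simp)
    (by simp) (by simp) (by simp) (hset (by simp) (by simp) (by simp) (by simp) (by simpa using hI₁))
    ?_ (fun σ' hf hI => hI)) fun σ₂ hf₂ hI₂ => WP.instr rfl ?_).weaken
      (by ring_nf; omega) fun _ h => h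
  · intro j hj σ₂ hf₂ hj₂ hI₂
    have d2 : σ₂.reg 2 = 1 := by rw [hf₂.1 2 (by simp), c2]
    have d3 : σ₂.reg 3 = I.n := by rw [hf₂.1 3 (by simp), c3]
    refine WP.forp I.n (B := 5) (fun v σ' => Inv (i * I.width + j * I.n + v) (i * I.n) σ') d3 d2
      (by simp) (by simp) (by simp) (by simp)
      (hset (by simp) (by simp) (by simp) (by simp) (by simpa using hI₂)) ?_ ?_
    · intro v hv σ₃ hf₃ hv₃ hI₃
      have e2 : σ₃.reg 2 = 1 := by rw [hf₃.1 2 (by simp), d2]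
      refine WP.blk rfl (hset (by simp) (by simp) (by simp) (by simp) ?_)
      obtain ⟨h50, h51, hz⟩ := hI₃
      refine ⟨by simp [h50, e2]; omega, by simp [h51], fun z hz' => ?_⟩
      obtain ⟨q1, q2⟩ := EdgeData.digits (I := I) (i := i) (j := j) (v := v) (by omega) hv
      rw [← add_assoc] at q1 q2
      by_cases hzK : z = i * I.width + j * I.n + v
      · subst hzK
        rw [q1, q2]
        simp [h50, h51, hv₃]
      · have := hz z (by omega)
        simpa [h50, Function.update_apply, hzK] using this
    · intro σ₃ hf₃ hI₃
      have : i * I.width + (j + 1) * I.n = i * I.width + j * I.n + I.n := by ring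
      rw [this]
      exact hset (by simp) (by simp) (by simp) (by simp) hI₃
  · have c3' : σ₂.reg 3 = I.n := by rw [hf₂.1 3 (by simp), c3]
    have e : i * I.width + (I.ℓ + 1) * I.n = (i + 1) * I.width := by rw [EdgeData.width]; ring
    rw [e] at hI₂
    refine hset (by simp) (by simp) (by simp) (by simp) ⟨by simp [hI₂.1], ?_, fun z hz => ?_⟩
    · simp [hI₂.2.1, c3']; ring
    · simpa using hI₂.2.2 z hz

/-- Decide whether the vertex in register `63` covers a new edge for the row at the offset in
register `64`. -/
def usefulProg : PlainProg :=
  .seq (.instr (.const 65 0)) (Prog.forp 57 58 4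
    (.seq (Prog.blk (.load 67 2 57) [.load 68 3 57, .add 69 64 67, .load 69 8 69, .add 70 64 68,
      .load 70 8 70, .sub 71 67 63, .sub 72 63 67, .add 71 71 72, .sub 73 68 63, .sub 74 63 68,
      .add 73 73 74])
    (.branch 69 Prog.skip (.branch 70 Prog.skip
      (.branch 71 (.branch 73 Prog.skip (.instr (.const 65 1))) (.instr (.const 65 1)))))))

theorem EdgeData.mem_rowAt {I : EdgeData} {c : ℕ → ℕ} {o v : ℕ} (hv : v < I.n) :
    v ∈ I.rowAt c o ↔ c (o + v) ≠ 0 := by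
  simp [rowAt, hv]

/-- Equality of an endpoint with the given vertex is tested by adding the two truncated differences,
a sum that vanishes only for equal numbers. -/
theorem usefulProg_spec {I : EdgeData} (hI : I.Valid) {r P q : ℕ} {σ : Store}
    (h : Holds I r P q σ) :
    WP usefulProg (I.m * 35 + 8) (fun σ' => σ'.reg 65 ≠ 0 ↔
      I.Useful (I.rowAt (σ.arr 8) (σ.reg 64)) (σ.reg 63)) σ := by
  set p : ℕ → Prop := fun e => (I.eu e = σ.reg 63 ∨ I.ev e = σ.reg 63) ∧
      I.eu e ∉ I.rowAt (σ.arr 8) (σ.reg 64) ∧ I.ev e ∉ I.rowAt (σ.arr 8) (σ.reg 64) with hp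
  refine (WP.seq (WP.instr rfl (WP.forp I.m (fun j σ' => σ'.reg 65 ≠ 0 ↔ ∃ e < j, p e) (B := 29)
      (by simp [h.m]) (by simp [h.one]) (by simp) (by simp) (by simp) (by simp)
      (by simp) ?_ (fun σ' hf hI => hI)))).weaken (by omega) fun _ h => h
  intro j hj σ' hf hi hI'
  have e63 : σ'.reg 63 = σ.reg 63 := by simpa using hf.1 63 (by simp)
  have e64 : σ'.reg 64 = σ.reg 64 := by simpa using hf.1 64 (by simp)
  have ea : σ'.arr 8 = σ.arr 8 := by simpa using hf.2 8 (by simp)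
  have eu : σ'.arr 2 j = I.eu j := by rw [hf.2 2 (by simp)]; exact h.eu j hj
  have ev : σ'.arr 3 j = I.ev j := by rw [hf.2 3 (by simp)]; exact h.ev j hj
  have m1 := EdgeData.mem_rowAt (c := σ.arr 8) (o := σ.reg 64) (hI.lt_u j hj)
  have m2 := EdgeData.mem_rowAt (c := σ.arr 8) (o := σ.reg 64) (hI.lt_v j hj)
  refine WP.seq (B := 23) (B' := 5) (WP.blk rfl (WP.branch
    (fun h1 => WP.skip_le (by norm_num) ?_) fun h1 => WP.branch
    (fun h2 => WP.skip_le (by norm_num) ?_) fun h2 => WP.branch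
    (fun h3 => WP.branch (fun h4 => WP.skip ?_) fun h4 => WP.instr rfl ?_)
    fun h3 => WP.instr_le rfl (by norm_num) ?_))
  all_goals
    rw [exists_lt_succ_iff]
    norm_num [hi, eu, ev, e64, ea, e63] at h1
  · have : ¬p j := by simp [hp, m1, h1]
    simpa [this] using hI'
  all_goals norm_num [hi, eu, ev, e64, ea, e63] at h2
  · have : ¬p j := by simp [hp, m2, h2]
    simpa [this] using hI'
  all_goals norm_num [hi, eu, ev, e64, ea, e63] at h3
  all_goals try norm_num [hi, eu, ev, e64, ea, e63] at h4
  · have : ¬p j := by simp only [hp]; omega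
    simpa [this] using hI'
  · have : p j := by
      refine ⟨by omega, ?_, ?_⟩
      · rw [m1]; simpa using h1
      · rw [m2]; simpa using h2
    simp [this]
  · have : p j := by
      refine ⟨by omega, ?_, ?_⟩
      · rw [m1]; simpa using h1
      · rw [m2]; simpa using h2
    simp [this]

/-- Compute the weight of the cover given by the row at the offset in register `64`. -/
def candProg : PlainProg :=
  .seq (.instr (.const 66 0)) (.seq
    (Prog.forp 57 58 3 (.seq (Prog.blk (.add 69 64 57) [.load 69 8 69])
      (.branch 69 (.instr (.add 66 66 12)) Prog.skip)))
    (Prog.forp 57 58 4 (.seq (Prog.blk (.load 67 2 57) [.load 68 3 57, .add 69 64 67, .load 69 8 69,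
      .add 70 64 68, .load 70 8 70])
      (.branch 69 Prog.skip (.branch 70 Prog.skip (.instr (.add 66 66 12)))))))

/-- Register 66 is increased by `q` for each marked vertex and each uncovered edge. The comparison
with ρk can thus be made in natural numbers and without a multiplication. -/
theorem candProg_spec {I : EdgeData} (hI : I.Valid) {r P q : ℕ} {σ : Store}
    (h : Holds I r P q σ) :
    WP candProg (I.n * 11 + I.m * 20 + 13) (fun σ' => σ'.reg 66 =
      q * I.cand (I.rowAt (σ.arr 8) (σ.reg 64))) σ := by
  set W := I.rowAt (σ.arr 8) (σ.reg 64) with hW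
  refine (WP.seq (WP.instr rfl (WP.seq' (WP.forp I.n (fun j σ' => σ'.reg 66 =
      q * ((Finset.range j).filter fun v => v ∈ W).card) (B := 6)
      (by simp [h.n]) (by simp [h.one]) (by simp) (by simp) (by simp) (by simp)
      (by simp) ?_ (fun σ' hf hI => hI)) fun σ₁ hf₁ h₁ => WP.forp I.m (fun j σ' => σ'.reg 66 =
      q * (W.card + ((Finset.range j).filter fun e => I.eu e ∉ W ∧ I.ev e ∉ W).card)) (B := 15)
      ?_ ?_ (by simp) (by simp) (by simp) (by simp) ?_ ?_ (fun σ' hf hI => hI)))).weaken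
      (by omega) fun _ h => h
  · intro j hj σ' hf hi hI'
    have e64 : σ'.reg 64 = σ.reg 64 := by simpa using hf.1 64 (by simp)
    have ea : σ'.arr 8 = σ.arr 8 := by simpa using hf.2 8 (by simp)
    have e12 : σ'.reg 12 = q := by simpa [h.q] using hf.1 12 (by simp)
    have m1 := EdgeData.mem_rowAt (c := σ.arr 8) (o := σ.reg 64) hj
    rw [← hW] at m1
    refine WP.seq (B := 3) (B' := 2) (WP.blk rfl (WP.branch (fun hx => WP.instr rfl ?_) fun hx =>
      WP.skip ?_))
    · simp [e64, ea, hi] at hx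
      simp [Finset.range_add_one, Finset.filter_insert, m1, hx, hI', e12]
      ring
    · simp [e64, ea, hi] at hx
      simp [Finset.range_add_one, Finset.filter_insert, m1, hx, hI']
  · simpa [h.m] using hf₁.1 4 (by simp)
  · simpa [h.one] using hf₁.1 2 (by simp)
  · have : (Finset.range I.n).filter (fun v => v ∈ W) = W := by
      ext v
      simp only [Finset.mem_filter, Finset.mem_range, and_iff_right_iff_imp]
      intro hv
      exact Finset.mem_range.1 (Finset.mem_filter.1 hv).1
    rw [this] at h₁
    simp [h₁]
  · intro j hj σ' hf hi hI'
    have e64 : σ'.reg 64 = σ.reg 64 := by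
      rw [hf.1 64 (by simp)]
      simpa using hf₁.1 64 (by simp)
    have ea : σ'.arr 8 = σ.arr 8 := by
      rw [hf.2 8 (by simp)]
      simpa using hf₁.2 8 (by simp)
    have e12 : σ'.reg 12 = q := by
      rw [hf.1 12 (by simp)]
      simpa [h.q] using hf₁.1 12 (by simp)
    have eu : σ'.arr 2 j = I.eu j := by
      rw [hf.2 2 (by simp), hf₁.2 2 (by simp)]; exact h.eu j hj
    have ev : σ'.arr 3 j = I.ev j := by
      rw [hf.2 3 (by simp), hf₁.2 3 (by simp)]; exact h.ev j hj
    have m1 := EdgeData.mem_rowAt (c := σ.arr 8) (o := σ.reg 64) (hI.lt_u j hj)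
    have m2 := EdgeData.mem_rowAt (c := σ.arr 8) (o := σ.reg 64) (hI.lt_v j hj)
    rw [← hW] at m1 m2
    refine WP.seq (B := 11) (B' := 3) (WP.blk rfl (WP.branch
      (fun h1 => WP.skip_le (by norm_num) ?_) fun h1 => WP.branch
      (fun h2 => WP.skip ?_) fun h2 => WP.instr rfl ?_))
    all_goals norm_num [hi, eu, ev, e64, ea] at h1
    · simp [Finset.range_add_one, Finset.filter_insert, m1, h1, hI']
    all_goals norm_num [hi, eu, ev, e64, ea] at h2
    · simp [Finset.range_add_one, Finset.filter_insert, m2, h2, hI']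
    · simp [Finset.range_add_one, Finset.filter_insert, m1, m2, h1, h2, hI', e12]
      ring

/-- Copy the top row of the stack. -/
def dupProg : PlainProg :=
  .seq (.instr (.add 75 51 8)) (Prog.forp 57 58 8
    (Prog.blk (.add 69 51 57) [.load 70 8 69, .add 69 75 57, .store 8 69 70]))

theorem dupProg_spec {I : EdgeData} {r P q : ℕ} {σ : Store} (h : Holds I r P q σ) :
    WP dupProg (r * I.n * 12 + 7) (fun σ' => σ'.arr 8 = dup (σ.arr 8) (σ.reg 51) (r * I.n)) σ := by
  set R := r * I.n with hR
  refine (WP.seq (WP.instr rfl (WP.forp R (fun j σ' => σ'.arr 8 = fun z =>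
      if σ.reg 51 + R ≤ z ∧ z < σ.reg 51 + R + j then σ.arr 8 (z - R) else σ.arr 8 z) (B := 7)
      (by simp [h.rows, hR]) (by simp [h.one]) (by simp) (by simp) (by simp) (by simp)
      ?_ ?_ (fun σ' hf hI => hI)))).weaken (by omega) fun _ h => h
  · funext z
    simp only [add_zero]
    rw [if_neg (by omega)]
    simp
  · intro j hj σ' hf hi hI'
    have e51 : σ'.reg 51 = σ.reg 51 := by simpa using hf.1 51 (by simp)
    have e75 : σ'.reg 75 = σ.reg 51 + R := by simpa [h.rows] using hf.1 75 (by simp)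
    refine WP.blk rfl ?_
    have e : ((((σ'.setReg 69 (σ.reg 51 + j)).setReg 70 (σ.arr 8 (σ.reg 51 + j))).setReg 69
      (σ.reg 51 + R + j)).setArr 8 (Function.update (σ'.arr 8) (σ.reg 51 + R + j)
        (σ.arr 8 (σ.reg 51 + j)))).arr 8 = Function.update (σ'.arr 8) (σ.reg 51 + R + j)
        (σ.arr 8 (σ.reg 51 + j)) := by simp
    have hr : σ'.arr 8 (σ.reg 51 + j) = σ.arr 8 (σ.reg 51 + j) := by
      rw [hI']
      simp only
      rw [if_neg (by omega)]
    norm_num [e51, e75, hi, hr]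
    rw [hI']
    funext z
    rw [Function.update_apply]
    by_cases hz : z = σ.reg 51 + R + j
    · rw [if_pos hz, if_pos (by omega)]
      congr 1; omega
    · rw [if_neg hz]
      by_cases hz' : σ.reg 51 + R ≤ z ∧ z < σ.reg 51 + R + j
      · rw [if_pos hz', if_pos (by omega)]
      · rw [if_neg hz', if_neg (by omega)]

/-- The memory represents the state of the search. -/
def Stored (σ : Store) (s : Search) : Prop :=
  σ.reg 50 = s.ptr ∧ σ.reg 51 = s.top ∧ σ.reg 52 = s.height ∧ σ.reg 53 = s.found.toNat ∧
    σ.arr 8 = s.cells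

/-- One step of the search. -/
def nextProg : PlainProg :=
  .branch 52
    (.seq (Prog.blk (.load 62 24 50) [.add 50 50 2, .sub 61 62 2])
      (.branch 61
        (.seq (Prog.blk (.load 64 6 62) [.load 63 7 62, .add 64 51 64])
        (.seq usefulProg
        (.seq (.branch 65 (Prog.blk (.add 76 64 63) [.store 8 76 2]) Prog.skip)
        (.seq candProg
        (.seq (.instr (.sub 76 66 11))
        (.seq (.branch 76 Prog.skip (.instr (.const 53 1)))
        (.seq dupProg
          (Prog.blk (.add 51 51 8) [.add 52 52 2]))))))))
        (Prog.blk (.sub 52 52 2) [.sub 51 51 8])))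
    Prog.skip

/-- The number of steps for one step of the search. -/
def EdgeData.nextCost (I : EdgeData) (r : ℕ) : ℕ := I.m * 55 + I.n * 11 + r * I.n * 12 + 70

theorem nextProg_spec {I : EdgeData} (hI : I.Valid) {r P q : ℕ} {σ : Store}
    (h : Holds I r P q σ) {s : Search} (hs : Stored σ s) :
    WP nextProg (I.nextCost r) (fun σ' =>
      Stored σ' (Search.next I r P q (σ.arr 24) (σ.arr 6) (σ.arr 7) s)) σ := by
  obtain ⟨s1, s2, s3, s4, s5⟩ := hs
  refine (WP.branch (B := I.m * 55 + I.n * 11 + r * I.n * 12 + 65) (fun h52 => ?_) fun h52 =>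
    WP.skip_le (by omega) ?_).weaken (by unfold EdgeData.nextCost; omega) fun _ h => h
  swap
  · rw [Search.next, if_pos (by omega)]
    simpa [Stored] using ⟨s1, s2, s3, s4, s5⟩
  rw [Search.next, if_neg (by omega)]
  refine (WP.seq (B := 5) (B' := I.m * 55 + I.n * 11 + r * I.n * 12 + 59) (WP.blk rfl
    (WP.branch (B := I.m * 55 + I.n * 11 + r * I.n * 12 + 58) (fun h61 => ?_) fun h61 =>
      WP.blk_le rfl (by simp only [List.length]; omega) ?_))).weaken (by omega) fun _ h => h
  swap
  · have : ¬(2 ≤ σ.arr 24 s.ptr) := by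
      norm_num [h.one, s1] at h61; omega
    rw [if_neg this]
    norm_num [Stored, h.one, s1, s2, s3, s4, s5, h.rows]
  · have h2 : 2 ≤ σ.arr 24 s.ptr := by
      norm_num [h.one, s1] at h61; omega
    rw [if_pos h2]
    set τ := List.foldl (fun τ o => Instr.det o τ) ((Instr.load 62 24 50).det σ)
      [.add 50 50 2, .sub 61 62 2] with hτ
    have hfτ : Frame [62, 50, 61] [] σ τ := by
      constructor
      · intro x hx
        simp only [List.mem_cons, List.not_mem_nil, or_false, not_or] at hx
        simp [hτ, hx]
      · intro a _; simp [hτ]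
    have t62 : τ.reg 62 = σ.arr 24 s.ptr := by norm_num [hτ, s1]
    have t50 : τ.reg 50 = s.ptr + 1 := by norm_num [hτ, s1, h.one]
    have hH := h.frame hfτ
    set x := σ.arr 24 s.ptr with hx
    set o := s.top + σ.arr 6 x with ho
    set v := σ.arr 7 x with hv
    have ha : τ.arr = σ.arr := by rw [hτ]; simp
    have t51 : τ.reg 51 = s.top := by rw [hfτ.1 51 (by simp), s2]
    have t52 : τ.reg 52 = s.height := by rw [hfτ.1 52 (by simp), s3]
    have t53 : τ.reg 53 = s.found.toNat := by rw [hfτ.1 53 (by simp), s4]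
    set c := I.mark s.cells o v with hc
    refine (WP.seq' (B := 5) (B' := I.m * 55 + I.n * 11 + r * I.n * 12 + 44)
      (P := fun τ' => τ'.reg 64 = o ∧ τ'.reg 63 = v) (WP.blk rfl ?_) fun σ₁ hf₁ h₁ => ?_).weaken
      (by omega) fun _ h => h
    · norm_num [ha, t62, t51, ho, hv]
    have hH₁ := hH.frame hf₁
    refine (WP.seq' (B' := I.n * 11 + I.m * 20 + r * I.n * 12 + 35) (usefulProg_spec hI hH₁)
      fun σ₂ hf₂ h₂ => ?_).weaken (by omega) fun _ h => h
    have hH₂ := hH₁.frame hf₂ (by simp [usefulProg]) (by simp [usefulProg])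
    have a₁ : σ₁.arr 8 = s.cells := by rw [hf₁.2 8 (by simp), ha, s5]
    have a₂ : σ₂.arr 8 = s.cells := by rw [hf₂.2 8 (by simp [usefulProg]), a₁]
    have g64 : σ₂.reg 64 = o := by rw [hf₂.1 64 (by simp [usefulProg]), h₁.1]
    have g63 : σ₂.reg 63 = v := by rw [hf₂.1 63 (by simp [usefulProg]), h₁.2]
    rw [a₁, h₁.1, h₁.2] at h₂
    refine (WP.seq' (B := 4) (B' := I.n * 11 + I.m * 20 + r * I.n * 12 + 30)
      (P := fun τ' => τ'.arr 8 = c) (WP.branch (fun hu => WP.blk rfl ?_)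
      fun hu => WP.skip_le (by norm_num) ?_) fun σ₃ hf₃ h₃ => ?_).weaken (by omega) fun _ h => h
    · rw [h₂] at hu
      norm_num [g64, g63, hH₂.one, a₂, hc, EdgeData.mark, if_pos hu]
    · have : ¬I.Useful (I.rowAt s.cells o) v := fun h => h₂.2 h hu
      simp [a₂, hc, EdgeData.mark, this]
    have hH₃ := hH₂.frame hf₃
    have k64 : σ₃.reg 64 = o := by rw [hf₃.1 64 (by simp), g64]
    refine (WP.seq' (B' := r * I.n * 12 + 16) (candProg_spec hI hH₃) fun σ₄ hf₄ h₄ => ?_).weaken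
      (by omega) fun _ h => h
    have hH₄ := hH₃.frame hf₄ (by simp [candProg]) (by simp [candProg])
    have hlow : ∀ y ∈ [50, 51, 52, 53], σ₄.reg y = τ.reg y := by
      intro y hy
      simp only [List.mem_cons, List.not_mem_nil, or_false] at hy
      rw [hf₄.1 y (by rcases hy with rfl | rfl | rfl | rfl <;> simp [candProg]),
        hf₃.1 y (by rcases hy with rfl | rfl | rfl | rfl <;> simp),
        hf₂.1 y (by rcases hy with rfl | rfl | rfl | rfl <;> simp [usefulProg]),
        hf₁.1 y (by rcases hy with rfl | rfl | rfl | rfl <;> simp)]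
    have a₄ : σ₄.arr 8 = c := by rw [hf₄.2 8 (by simp [candProg]), h₃]
    rw [h₃, k64] at h₄
    -- Register 76 becomes the truncated difference of the weight and `P`, so it is 0 exactly if the
    -- test succeeds.
    refine (WP.seq (B := 1) (B' := 2 + (r * I.n * 12 + 11) + 1) (WP.instr rfl (WP.seq' (B := 2)
      (B' := r * I.n * 12 + 11) (P := fun τ' =>
        τ'.reg 53 = (s.found || decide (q * I.cand (I.rowAt c o) ≤ P)).toNat)
      (WP.branch (fun hc => WP.skip ?_) fun hc => WP.instr rfl ?_) fun σ₅ hf₅ h₅ => ?_))).weaken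
      (by omega) fun _ h => h
    · simp [h₄, hH₄.P] at hc
      have : ¬(q * I.cand (I.rowAt c o) ≤ P) := by omega
      simp [this, hlow, t53]
    · simp [h₄, hH₄.P] at hc
      have : q * I.cand (I.rowAt c o) ≤ P := by omega
      simp [this]
    have hH₅ : Holds I r P q σ₅ := (hH₄.frame (Instr.det_frame (.sub 76 66 11) σ₄)
      (by simp) (by simp)).frame hf₅
    have a₅ : σ₅.arr 8 = c := by rw [hf₅.2 8 (by simp)]; simpa using a₄
    have l₅ : ∀ y ∈ [50, 51, 52], σ₅.reg y = τ.reg y := by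
      intro y hy
      rw [← hlow y (by simp only [List.mem_cons, List.not_mem_nil, or_false] at hy ⊢; tauto)]
      simp only [List.mem_cons, List.not_mem_nil, or_false] at hy
      rcases hy with rfl | rfl | rfl <;> rw [hf₅.1 _ (by simp)] <;> simp
    refine (WP.seq' (dupProg_spec hH₅) fun σ₆ hf₆ h₆ => WP.blk rfl ?_).weaken
      (by simp only [List.length]; omega) fun _ h => h
    have hH₆ := hH₅.frame hf₆ (by simp [dupProg]) (by simp [dupProg])
    have l₆ : ∀ y ∈ [50, 51, 52, 53], σ₆.reg y = σ₅.reg y := by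
      intro y hy
      simp only [List.mem_cons, List.not_mem_nil, or_false] at hy
      rw [hf₆.1 y (by rcases hy with rfl | rfl | rfl | rfl <;> simp [dupProg])]
    rw [a₅, l₅ 51 (by simp), t51] at h₆
    refine ⟨?_, ?_, ?_, ?_, ?_⟩
    · simp [l₆, l₅, t50]
    · simp [l₆, l₅, t51, hH₆.rows]
    · simp [l₆, l₅, t52, hH₆.one]
    · simp [l₆, h₅]
    · simp [h₆]

/-- The search. -/
def searchProg : PlainProg :=
  .seq tableProg (.seq (Prog.forp 57 58 8 (Prog.blk (.const 69 0) [.store 8 57 69]))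
    (.seq (Prog.blk (.const 50 0) [.const 51 0, .const 52 1, .const 53 0])
      (.seq (Prog.forp 55 56 15 nextProg) (Prog.blk (.const 0 0) [.add 0 0 53]))))

/-- The number of steps of the search with budget `b`. -/
def EdgeData.searchCost (I : EdgeData) (r b : ℕ) : ℕ :=
  r * ((I.ℓ + 1) * (I.n * 10 + 10) + 12) + r * I.n * 8 + b * (I.nextCost r + 5) + 40

/-- The tables and cells are known only on the tokens of variables and on the first frame. Their
other values are whatever the memory holds, hence the existential form. -/
theorem searchProg_spec {I : EdgeData} (hI : I.Valid) {r P q b : ℕ} {σ : Store}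
    (h : Ready I r P q b σ) :
    WP searchProg (I.searchCost r b) (fun σ' => ∃ base vtx c, Tables I r base vtx ∧
      (∀ z < r * I.n, c z = 0) ∧ σ'.reg 0 = ((Search.next I r P q (σ.arr 24) base vtx)^[b]
        ⟨0, 0, 1, false, c⟩).found.toNat) σ := by
  refine (WP.seq' (B' := r * I.n * 8 + b * (I.nextCost r + 5) + 30) (tableProg_spec h.1)
    fun σ₁ hf₁ h₁ => ?_).weaken (by unfold EdgeData.searchCost; omega) fun _ h => h
  have hR₁ := h.frame hf₁ (by simp [tableProg]) (by simp [tableProg])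
  have a₁ : σ₁.arr 24 = σ.arr 24 := hf₁.2 24 (by simp [tableProg])
  refine (WP.seq' (B' := 7 + (b * (I.nextCost r + 5) + 10) + 1) (WP.forp (r * I.n) (B := 3) (fun j σ' => ∀ z < j, σ'.arr 8 z = 0)
    hR₁.1.rows hR₁.1.one (by simp) (by simp) (by simp) (by simp) (by simp) ?_
    (fun σ' hf hI => hI)) fun σ₂ hf₂ h₂ => WP.seq (B := 7) (B' := b * (I.nextCost r + 5) + 10)
    (WP.blk rfl ?_)).weaken (by omega) fun _ h => h
  · intro j hj σ' hf hi hI' 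
    refine WP.blk rfl fun z hz => ?_
    by_cases hzj : z = j
    · simp [hi, hzj]
    · simpa [hi, Function.update_apply, hzj] using hI' z (by omega)
  · have hR₂ := hR₁.frame hf₂
    set τ := List.foldl (fun τ o => Instr.det o τ) ((Instr.const 50 0).det σ₂)
      [.const 51 0, .const 52 1, .const 53 0] with hτ
    have hfτ : Frame [50, 51, 52, 53] [] σ₂ τ := by
      constructor
      · intro x hx
        simp only [List.mem_cons, List.not_mem_nil, or_false, not_or] at hx
        simp [hτ, hx]
      · intro a _; simp [hτ]
    have hRτ := hR₂.frame hfτ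
    have hsτ : Stored τ ⟨0, 0, 1, false, σ₂.arr 8⟩ := by
      simp [Stored, hτ]
    have e₂ : ∀ a ≠ 8, σ₂.arr a = σ₁.arr a := fun a ha => hf₂.2 a (by simp [ha])
    refine (WP.seq' (WP.forp b (B := I.nextCost r) (fun j σ' => Stored σ'
      ((Search.next I r P q (σ.arr 24) (σ₁.arr 6) (σ₁.arr 7))^[j] ⟨0, 0, 1, false, σ₂.arr 8⟩))
      hRτ.2 hRτ.1.one (by simp [nextProg, usefulProg, candProg, dupProg])
      (by simp [nextProg, usefulProg, candProg, dupProg])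
      (by simp [nextProg, usefulProg, candProg, dupProg]) (by simp)
      (by simpa [Stored] using hsτ) ?_ (fun σ' hf hI => hI)) fun σ₃ hf₃ h₃ =>
        WP.blk (o := .const 0 0) (os := [.add 0 0 53]) rfl
        ⟨σ₁.arr 6, σ₁.arr 7, σ₂.arr 8, h₁, h₂, ?_⟩).weaken
      (by simp only [List.length]; omega) fun _ h => h
    · intro j hj σ' hf hi hI'
      have := nextProg_spec hI ((hRτ.frame hf (by simp [nextProg, usefulProg, candProg, dupProg])
        (by simp [nextProg, usefulProg, candProg, dupProg])).1) hI'
      have hr : ∀ a ∈ [24, 6, 7], σ'.arr a = σ₁.arr a := by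
        intro a ha
        rw [hf.2 a (by simp at ha; rcases ha with rfl | rfl | rfl <;>
          simp [nextProg, usefulProg, candProg, dupProg]), hfτ.2 a (by simp),
          e₂ a (by rintro rfl; simp at ha)]
      rw [hr 24 (by simp), hr 6 (by simp), hr 7 (by simp), a₁] at this
      refine this.weaken le_rfl fun σ'' h'' => ?_
      rw [Function.iterate_succ_apply']
      simpa [Stored] using h''
    · simpa using h₃.2.2.2.1

/-! ### Reading the graph -/

/-- The vertex `u` of the graph with adjacency matrix `a` is not isolated. -/
def Touched (n : ℕ) (a : ℕ → ℕ) (u : ℕ) : Prop := ∃ v < n, a (u * n + v) ≠ 0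

/-- The cell `z` of the adjacency matrix holds an edge below the diagonal. -/
def Lower (n : ℕ) (a : ℕ → ℕ) (z : ℕ) : Prop := a z ≠ 0 ∧ z % n < z / n

open Classical in
/-- The label of a vertex: the number of smaller vertices that are not isolated. -/
noncomputable def label (n : ℕ) (a : ℕ → ℕ) (u : ℕ) : ℕ := Nat.count (Touched n a) u

open Classical in
/-- The number of edges below the diagonal that come before the cell `z`. -/
noncomputable def rank (n : ℕ) (a : ℕ → ℕ) (z : ℕ) : ℕ := Nat.count (Lower n a) z

open Classical in
theorem label_succ (n : ℕ) (a : ℕ → ℕ) (u : ℕ) :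
    label n a (u + 1) = label n a u + if Touched n a u then 1 else 0 := Nat.count_succ _ _

open Classical in
theorem rank_succ (n : ℕ) (a : ℕ → ℕ) (u : ℕ) :
    rank n a (u + 1) = rank n a u + if Lower n a u then 1 else 0 := Nat.count_succ _ _

/-- Compute the labels of the vertices into the array `1`, and their number into register `3`. -/
def labelProg : PlainProg :=
  .seq (.instr (.const 60 0)) (Prog.forp 51 52 0
    (.seq (.instr (.const 53 0))
    (.seq (Prog.forp 54 55 0 (.seq (Prog.blk (.load 56 0 60) [.add 60 60 2])
      (.branch 56 (.instr (.const 53 1)) Prog.skip)))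
    (.seq (.instr (.store 1 51 3)) (.branch 53 (.instr (.add 3 3 2)) Prog.skip)))))

/-- Register 60 runs through the matrix cell by cell, so that the index `u * n + v` never has to be
computed. -/
theorem labelProg_spec {n : ℕ} {σ : Store} (h0 : σ.reg 0 = n) (h2 : σ.reg 2 = 1)
    (h3 : σ.reg 3 = 0) :
    WP labelProg (n * (n * 11 + 20) + 7) (fun σ' => σ'.reg 3 = label n (σ.arr 0) n ∧
      ∀ u < n, σ'.arr 1 u = label n (σ.arr 0) u) σ := by
  refine (WP.seq (WP.instr rfl (WP.forp n (B := n * 11 + 15) (fun u σ' => σ'.reg 60 = u * n ∧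
    σ'.reg 3 = label n (σ.arr 0) u ∧ ∀ w < u, σ'.arr 1 w = label n (σ.arr 0) w)
    (by simp [h0]) (by simp [h2]) (by simp) (by simp) (by simp) (by simp) (by simp [h3, label])
    ?_ (fun σ' hf hI => hI.2)))).weaken (by ring_nf; omega) fun _ h => h
  intro u hu σ₁ hf₁ hu₁ hI₁
  have c0 : σ₁.reg 0 = n := by simpa [h0] using hf₁.1 0 (by simp)
  have c2 : σ₁.reg 2 = 1 := by simpa [h2] using hf₁.1 2 (by simp)
  have ca : σ₁.arr 0 = σ.arr 0 := by simpa using hf₁.2 0 (by simp)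
  refine (WP.seq (B := 1) (WP.instr rfl (WP.seq' (WP.forp n (B := 6) (fun v σ' =>
    σ'.reg 60 = u * n + v ∧ (σ'.reg 53 ≠ 0 ↔ ∃ w < v, σ.arr 0 (u * n + w) ≠ 0)) (by simp [c0])
    (by simp [c2]) (by simp) (by simp) (by simp) (by simp) (by simp [hI₁.1]) ?_
    (fun σ' hf hI => hI)) fun σ₂ hf₂ h₂ => WP.seq (B := 1) (B' := 2) (WP.instr rfl (WP.branch
      (fun hx => WP.instr rfl ?_) fun hx => WP.skip ?_))))).weaken (by omega) fun _ h => h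
  · intro v hv σ' hf hv' hI'
    have d2 : σ'.reg 2 = 1 := by simpa [c2] using hf.1 2 (by simp)
    have da : σ'.arr 0 = σ.arr 0 := by simpa [ca] using hf.2 0 (by simp)
    refine WP.seq (B := 3) (B' := 2) (WP.blk rfl (WP.branch (fun hx => WP.instr rfl ?_)
      fun hx => WP.skip ?_))
    · norm_num [hI'.1, da] at hx
      rw [exists_lt_succ_iff]
      simp [hI'.1, d2, hx, add_assoc]
    · norm_num [hI'.1, da] at hx
      rw [exists_lt_succ_iff, ← hI'.2]
      simp [hI'.1, d2, hx, add_assoc]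
  all_goals
    have e2 : σ₂.reg 2 = 1 := by simpa [c2] using hf₂.1 2 (by simp)
    have e3 : σ₂.reg 3 = label n (σ.arr 0) u := by simpa [hI₁.2.1] using hf₂.1 3 (by simp)
    have e51 : σ₂.reg 51 = u := by simpa [hu₁] using hf₂.1 51 (by simp)
    have ea : σ₂.arr 1 = σ₁.arr 1 := by simpa using hf₂.2 1 (by simp)
    have harr : ∀ w < u + 1, Function.update (σ₁.arr 1) u (label n (σ.arr 0) u) w =
        label n (σ.arr 0) w := by
      intro w hw
      by_cases hwu : w = u
      · simp [hwu]
      · simpa [hwu] using hI₁.2.2 w (by omega)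
    have e60 : σ₂.reg 60 = (u + 1) * n := by rw [h₂.1]; ring
  · have ht : Touched n (σ.arr 0) u := h₂.2.1 (by simpa using hx)
    refine ⟨by simp [e60], by simp [e3, e2, label_succ, ht], ?_⟩
    simpa [e51, e3, ea] using harr
  · have ht : ¬Touched n (σ.arr 0) u := fun ht => h₂.2.2 ht (by simpa using hx)
    refine ⟨by simp [e60], by simp [e3, label_succ, ht], ?_⟩
    simpa [e51, e3, ea] using harr

/-- List the edges in the arrays `2` and `3`; their number is counted in register `4`, and their
weight in register `13`. -/
def listProg : PlainProg :=
  .seq (.instr (.const 60 0)) (Prog.forp 51 52 0 (Prog.forp 54 55 0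
    (.seq (Prog.blk (.load 56 0 60) [.sub 57 51 54, .add 60 60 2])
      (.branch 56 (.branch 57 (Prog.blk (.load 58 1 51) [.store 2 4 58, .load 58 1 54,
        .store 3 4 58, .add 4 4 2, .add 13 13 12]) Prog.skip) Prog.skip))))

theorem rank_lt_rank {n : ℕ} {a : ℕ → ℕ} {z z' : ℕ} (hz : Lower n a z) (hzz : z < z') :
    rank n a z < rank n a z' := by
  classical
  exact (Nat.count_strict_mono hz hzz)

theorem listProg_spec {n q : ℕ} {σ : Store} (h0 : σ.reg 0 = n) (h2 : σ.reg 2 = 1)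
    (h4 : σ.reg 4 = 0) (h13 : σ.reg 13 = 0) (h12 : σ.reg 12 = q)
    (h1 : ∀ u < n, σ.arr 1 u = label n (σ.arr 0) u) :
    WP listProg (n * (n * 24 + 10) + 7) (fun σ' => σ'.reg 4 = rank n (σ.arr 0) (n * n) ∧
      σ'.reg 13 = q * rank n (σ.arr 0) (n * n) ∧ ∀ z < n * n, Lower n (σ.arr 0) z →
        σ'.arr 2 (rank n (σ.arr 0) z) = label n (σ.arr 0) (z / n) ∧
        σ'.arr 3 (rank n (σ.arr 0) z) = label n (σ.arr 0) (z % n)) σ := by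
  set a := σ.arr 0 with ha
  set Inv : ℕ → Store → Prop := fun K σ' => σ'.reg 60 = K ∧ σ'.reg 4 = rank n a K ∧
      σ'.reg 13 = q * rank n a K ∧ ∀ z < K, Lower n a z →
        σ'.arr 2 (rank n a z) = label n a (z / n) ∧
        σ'.arr 3 (rank n a z) = label n a (z % n) with hInv
  have hset : ∀ {K : ℕ} {σ' : Store} {x v y w : ℕ}, x ∉ [60, 4, 13] → y ∉ [60, 4, 13] →
      Inv K σ' → Inv K ((σ'.setReg x v).setReg y w) := by
    intro K σ' x v y w hx hy hI
    simp only [List.mem_cons, List.not_mem_nil, or_false, not_or] at hx hy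
    simpa [hInv, Ne.symm hx.1, Ne.symm hx.2.1, Ne.symm hx.2.2, Ne.symm hy.1, Ne.symm hy.2.1,
      Ne.symm hy.2.2] using hI
  refine (WP.seq (WP.instr rfl (WP.forp n (B := n * 24 + 5) (fun u σ' => Inv (u * n) σ')
    (by simp [h0]) (by simp [h2]) (by simp) (by simp) (by simp) (by simp)
    (hset (by simp) (by simp) (by simp [hInv, rank, h4, h13]))
    ?_ (fun σ' hf hI => hI.2)))).weaken (by ring_nf; omega) fun _ h => h
  intro u hu σ₁ hf₁ hu₁ hI₁
  have c0 : σ₁.reg 0 = n := by simpa [h0] using hf₁.1 0 (by simp)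
  have c2 : σ₁.reg 2 = 1 := by simpa [h2] using hf₁.1 2 (by simp)
  have c12 : σ₁.reg 12 = q := by simpa [h12] using hf₁.1 12 (by simp)
  have ca : σ₁.arr 0 = a := by simpa using hf₁.2 0 (by simp)
  have c1 : σ₁.arr 1 = σ.arr 1 := by simpa using hf₁.2 1 (by simp)
  refine (WP.forp n (B := 19) (fun v σ' => Inv (u * n + v) σ') c0 c2 (by simp) (by simp) (by simp)
    (by simp) (hset (by simp) (by simp) (by simpa using hI₁)) ?_ (fun σ' hf hI => ?_)).weaken
    (by omega) fun _ h => h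
  swap
  · rw [show (u + 1) * n = u * n + n by ring]
    exact hset (by simp) (by simp) hI
  intro v hv σ' hf hv' hI'
  have d2 : σ'.reg 2 = 1 := by rw [hf.1 2 (by simp), c2]
  have d12 : σ'.reg 12 = q := by rw [hf.1 12 (by simp), c12]
  have d51 : σ'.reg 51 = u := by rw [hf.1 51 (by simp), hu₁]
  have da : σ'.arr 0 = a := by rw [hf.2 0 (by simp), ca]
  have d1 : σ'.arr 1 = σ.arr 1 := by rw [hf.2 1 (by simp), c1]
  obtain ⟨i60, i4, i13, iz⟩ := hI'
  have hn : 0 < n := by omega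
  have hdiv : (u * n + v) / n = u := by
    rw [mul_comm, Nat.mul_add_div hn, Nat.div_eq_of_lt hv, add_zero]
  have hmod : (u * n + v) % n = v := by
    rw [mul_comm, Nat.mul_add_mod, Nat.mod_eq_of_lt hv]
  have hno : ¬Lower n a (u * n + v) → ∀ z < u * n + v + 1, Lower n a z →
        σ'.arr 2 (rank n a z) = label n a (z / n) ∧ σ'.arr 3 (rank n a z) = label n a (z % n) := by
    intro hL z hz hzL
    refine iz z ?_ hzL
    rcases Nat.lt_succ_iff_lt_or_eq.1 hz with h | rfl
    · exact h
    · exact absurd hzL hL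
  refine WP.seq (B := 5) (B' := 13) (WP.blk rfl (WP.branch (fun hx => WP.branch
    (fun hy => WP.blk rfl (hset (by simp) (by simp) ?_)) fun hy => WP.skip_le (by norm_num)
      (hset (by simp) (by simp) ?_))
    fun hx => WP.skip_le (by norm_num) (hset (by simp) (by simp) ?_)))
  all_goals norm_num [i60, da] at hx
  · norm_num [d51, hv'] at hy
    have hL : Lower n a (u * n + v) := ⟨hx, by rw [hdiv, hmod]; omega⟩
    refine ⟨by simp [i60, d2, add_assoc], by simp [i4, d2, ← add_assoc, rank_succ, hL],
      by simp [i13, d12, ← add_assoc, rank_succ, hL]; ring, fun z hz hzL => ?_⟩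
    norm_num [i4, d51, hv', d1, h1 u hu, h1 v hv]
    have hz' : z < u * n + v ∨ z = u * n + v := by omega
    rcases hz' with h | rfl
    -- Listed cells have strictly increasing ranks, so the new entry does not overwrite an earlier
    -- one.
    · have := rank_lt_rank hzL h
      rw [Function.update_of_ne (by omega), Function.update_of_ne (by omega)]
      exact iz z h hzL
    · rw [hdiv, hmod]; simp
  · norm_num [d51, hv'] at hy
    have hL : ¬Lower n a (u * n + v) := fun h => by
      have := h.2; rw [hdiv, hmod] at this; omega
    exact ⟨by simp [i60, d2, add_assoc], by simp [i4, ← add_assoc, rank_succ, hL],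
      by simp [i13, ← add_assoc, rank_succ, hL], fun z hz => by simpa using hno hL z hz⟩
  · have hL : ¬Lower n a (u * n + v) := fun h => h.1 hx
    exact ⟨by simp [i60, d2, add_assoc], by simp [i4, ← add_assoc, rank_succ, hL],
      by simp [i13, ← add_assoc, rank_succ, hL], fun z hz => by simpa using hno hL z hz⟩

/-! ### The graph and its edge list -/

/-- `I` lists the edges of `G`, where the vertices that are not isolated are labelled by `lab`. -/
structure Encodes {n : ℕ} (G : SimpleGraph (Fin n)) (I : EdgeData) (lab : Fin n → ℕ) : Prop where
  lt : ∀ u w, G.Adj u w → lab u < I.n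
  inj : ∀ u u' w w', G.Adj u w → G.Adj u' w' → lab u = lab u' → u = u'
  surj : ∀ x < I.n, ∃ u w, G.Adj u w ∧ lab u = x
  edge : ∀ e < I.m, ∃ u v, G.Adj u v ∧ v < u ∧ I.eu e = lab u ∧ I.ev e = lab v
  edge_inj : ∀ e < I.m, ∀ e' < I.m, I.eu e = I.eu e' → I.ev e = I.ev e' → e = e'
  all : ∀ u v, G.Adj u v → v < u → ∃ e < I.m, I.eu e = lab u ∧ I.ev e = lab v

/-! ### Labels and ranks as consecutive numberings -/

section Count

variable {n : ℕ} {G : SimpleGraph (Fin n)} [DecidableRel G.Adj]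

theorem adjArray_ne_zero (u v : Fin n) : adjArray G (u * n + v) ≠ 0 ↔ G.Adj u v := by
  have hn : 0 < n := u.pos
  unfold adjArray
  constructor
  · intro h
    split_ifs at h with h'
    · obtain ⟨u', v', ha, he⟩ := h'
      have e1 : u' = u := by
        ext
        have := congrArg (· / n) he
        simpa [mul_comm _ n, Nat.mul_add_div hn, Nat.div_eq_of_lt u'.2, Nat.div_eq_of_lt v'.2,
          Nat.div_eq_of_lt v.2] using this
      have e2 : v' = v := by
        ext
        have := congrArg (· % n) he
        simpa [mul_comm _ n, Nat.mul_add_mod, Nat.mod_eq_of_lt v'.2, Nat.mod_eq_of_lt v.2] using this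
      rwa [← e1, ← e2]
    · exact absurd rfl h
  · intro h
    rw [if_pos ⟨u, v, h, rfl⟩]
    exact one_ne_zero

theorem touched_iff (u : Fin n) : Touched n (adjArray G) u ↔ ∃ w, G.Adj u w := by
  constructor
  · rintro ⟨v, hv, h⟩
    exact ⟨⟨v, hv⟩, (adjArray_ne_zero u ⟨v, hv⟩).1 h⟩
  · rintro ⟨w, h⟩
    exact ⟨w, w.2, (adjArray_ne_zero u w).2 h⟩

theorem Nat.exists_count_eq {p : ℕ → Prop} [DecidablePred p] {x n : ℕ} (h : x < Nat.count p n) :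
    ∃ u < n, p u ∧ Nat.count p u = x := by
  induction n with
  | zero => simp at h
  | succ n ih =>
    rw [Nat.count_succ] at h
    by_cases hx : x < Nat.count p n
    · obtain ⟨u, hu, h'⟩ := ih hx
      exact ⟨u, by omega, h'⟩
    · split_ifs at h with hp
      · exact ⟨n, by omega, hp, by omega⟩
      · omega

/-- Counting the earlier elements that satisfy a predicate numbers these elements injectively and
without gaps. This applies to the vertices that are not isolated and to the edges below the
diagonal, where each edge occurs once. -/
theorem encodes_of_lists {I : EdgeData} (h1 : I.n = label n (adjArray G) n)
    (h2 : I.m = rank n (adjArray G) (n * n))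
    (h3 : ∀ z < n * n, Lower n (adjArray G) z →
      I.eu (rank n (adjArray G) z) = label n (adjArray G) (z / n) ∧
      I.ev (rank n (adjArray G) z) = label n (adjArray G) (z % n)) :
    Encodes G I fun u => label n (adjArray G) u := by
  classical
  set a := adjArray G with ha
  have hlow : ∀ z < n * n, Lower n a z → ∃ u v : Fin n, G.Adj u v ∧ v < u ∧ z / n = u ∧
      z % n = v ∧ z = u * n + v := by
    intro z hz hL
    have hn : 0 < n := by
      rcases Nat.eq_zero_or_pos n with h | h
      · simp [h] at hz
      · exact h
    have e : z = z / n * n + z % n := by rw [mul_comm]; exact (Nat.div_add_mod z n).symm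
    refine ⟨⟨z / n, Nat.div_lt_of_lt_mul hz⟩, ⟨z % n, Nat.mod_lt _ hn⟩, ?_, hL.2, rfl, rfl, e⟩
    rw [← adjArray_ne_zero]
    have := hL.1
    rw [e] at this
    exact this
  have hup : ∀ u v : Fin n, G.Adj u v → v < u → (u * n + v : ℕ) < n * n ∧ Lower n a (u * n + v) ∧
      (u * n + v : ℕ) / n = u ∧ (u * n + v : ℕ) % n = v := by
    intro u v huv hvu
    have e1 : (u * n + v : ℕ) / n = u := by
      rw [mul_comm, Nat.mul_add_div u.pos, Nat.div_eq_of_lt v.2, add_zero]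
    have e2 : (u * n + v : ℕ) % n = v := by rw [mul_comm, Nat.mul_add_mod, Nat.mod_eq_of_lt v.2]
    refine ⟨?_, ⟨(adjArray_ne_zero u v).2 huv, by rw [e1, e2]; exact hvu⟩, e1, e2⟩
    have := u.2
    have := v.2
    calc (u * n + v : ℕ) < u * n + n := by omega
      _ = (u + 1) * n := by ring
      _ ≤ n * n := Nat.mul_le_mul_right _ (by omega)
  have hlab : ∀ u u' : Fin n, ∀ w w', G.Adj u w → G.Adj u' w' → label n a u = label n a u' →
      u = u' := fun u u' w w' h h' he =>
    Fin.ext (Nat.count_injective ((touched_iff u).2 ⟨w, h⟩) ((touched_iff u').2 ⟨w', h'⟩) he)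
  have hedge : ∀ e < I.m, ∃ u v : Fin n, G.Adj u v ∧ v < u ∧ I.eu e = label n a u ∧
      I.ev e = label n a v ∧ e = rank n a (u * n + v) := by
    intro e he
    rw [h2] at he
    obtain ⟨z, hz, hL, rfl⟩ := Nat.exists_count_eq he
    obtain ⟨u, v, huv, hvu, e1, e2, e3⟩ := hlow z hz hL
    obtain ⟨f1, f2⟩ := h3 z hz hL
    exact ⟨u, v, huv, hvu, by rw [← e1]; exact f1, by rw [← e2]; exact f2, by rw [← e3]; rfl⟩
  refine ⟨fun u w h => ?_, hlab, fun x hx => ?_, fun e he => ?_, fun e he e' he' h h' => ?_,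
    fun u v huv hvu => ?_⟩
  · rw [h1]
    exact Nat.count_strict_mono ((touched_iff u).2 ⟨w, h⟩) u.2
  · rw [h1] at hx
    obtain ⟨u, hu, ht, rfl⟩ := Nat.exists_count_eq hx
    obtain ⟨w, hw⟩ := (touched_iff (⟨u, hu⟩ : Fin n)).1 ht
    exact ⟨⟨u, hu⟩, w, hw, rfl⟩
  · obtain ⟨u, v, huv, hvu, e1, e2, -⟩ := hedge e he
    exact ⟨u, v, huv, hvu, e1, e2⟩
  · obtain ⟨u, v, huv, hvu, e1, e2, e3⟩ := hedge e he
    obtain ⟨u', v', huv', hvu', e1', e2', e3'⟩ := hedge e' he'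
    have hu : u = u' := hlab u u' v v' huv huv' (by rw [← e1, ← e1', h])
    have hv : v = v' := hlab v v' u u' huv.symm huv'.symm (by rw [← e2, ← e2', h'])
    rw [e3, e3', hu, hv]
  · obtain ⟨z1, z2, z3, z4⟩ := hup u v huv hvu
    obtain ⟨f1, f2⟩ := h3 _ z1 z2
    rw [z3] at f1
    rw [z4] at f2
    refine ⟨_, ?_, f1, f2⟩
    rw [h2]
    exact Nat.count_strict_mono z2 z1

end Count

/-! ### Vertex covers of the graph and of the edge list -/

namespace Encodes

variable {n : ℕ} {G : SimpleGraph (Fin n)} {I : EdgeData} {lab : Fin n → ℕ}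

theorem valid (h : Encodes G I lab) : I.Valid := by
  refine ⟨fun e he => ?_, fun e he => ?_, fun e he hne => ?_, fun e he e' he' => ?_⟩
  · obtain ⟨u, v, huv, hvu, e1, e2⟩ := h.edge e he
    rw [e1]; exact h.lt u v huv
  · obtain ⟨u, v, huv, hvu, e1, e2⟩ := h.edge e he
    rw [e2]; exact h.lt v u huv.symm
  · obtain ⟨u, v, huv, hvu, e1, e2⟩ := h.edge e he
    exact huv.ne (h.inj u v v u huv huv.symm (by rw [← e1, ← e2, hne]))
  · rintro (⟨h1, h2⟩ | ⟨h1, h2⟩)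
    · exact h.edge_inj e he e' he' h1 h2
    -- Every listed pair has its larger vertex first, so no pair is the reverse of another.
    · obtain ⟨u, v, huv, hvu, e1, e2⟩ := h.edge e he
      obtain ⟨u', v', huv', hvu', e1', e2'⟩ := h.edge e' he'
      have p1 : u = v' := h.inj u v' v u' huv huv'.symm (by rw [← e1, ← e2', h1])
      have p2 : v = u' := h.inj v u' u v' huv.symm huv' (by rw [← e2, ← e1', h2])
      subst p1 p2
      exact absurd hvu (not_lt.2 hvu'.le)

/-- A vertex cover of the graph covers the listed edges. -/
theorem exists_list (h : Encodes G I lab) {S : Finset (Fin n)} (hS : G.IsVertexCover S) :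
    ∃ us : List ℕ, us.length ≤ S.card ∧ (∀ u ∈ us, u < I.n) ∧
      ∀ e < I.m, I.eu e ∈ us ∨ I.ev e ∈ us := by
  classical
  refine ⟨((S.filter fun u => ∃ w, G.Adj u w).toList).map lab, ?_, ?_, ?_⟩
  · rw [List.length_map, Finset.length_toList]
    exact Finset.card_filter_le _ _
  · intro u hu
    simp only [List.mem_map, Finset.mem_toList, Finset.mem_filter] at hu
    obtain ⟨u, ⟨-, w, hw⟩, rfl⟩ := hu
    exact h.lt u w hw
  · intro e he
    obtain ⟨u, v, huv, hvu, e1, e2⟩ := h.edge e he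
    simp only [List.mem_map, Finset.mem_toList, Finset.mem_filter]
    rcases hS huv with hu | hv
    · exact Or.inl ⟨u, ⟨by simpa using hu, v, huv⟩, e1.symm⟩
    · exact Or.inr ⟨v, ⟨by simpa using hv, u, huv.symm⟩, e2.symm⟩

/-- A set of labels yields a vertex cover of the graph. -/
theorem exists_cover (h : Encodes G I lab) (W : Finset ℕ) :
    ∃ S : Finset (Fin n), G.IsVertexCover S ∧ S.card ≤ I.cand W := by
  classical
  set A : Finset (Fin n) := Finset.univ.filter fun u => (∃ w, G.Adj u w) ∧ lab u ∈ W with hA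
  set B : Finset (Fin n) := Finset.univ.filter fun u => (∃ w, G.Adj u w) ∧
    ∃ e ∈ I.unc W, I.eu e = lab u with hB
  refine ⟨A ∪ B, ?_, ?_⟩
  · have key : ∀ u v, G.Adj u v → v < u → u ∈ A ∪ B ∨ v ∈ A ∪ B := by
      intro u v huv hvu
      obtain ⟨e, he, e1, e2⟩ := h.all u v huv hvu
      by_cases hu : lab u ∈ W
      · exact Or.inl (Finset.mem_union_left _ (by simp [hA, hu]; exact ⟨v, huv⟩))
      by_cases hv : lab v ∈ W
      · exact Or.inr (Finset.mem_union_left _ (by simp [hA, hv]; exact ⟨u, huv.symm⟩))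
      · refine Or.inl (Finset.mem_union_right _ ?_)
        simp only [hB, Finset.mem_filter, Finset.mem_univ, true_and]
        exact ⟨⟨v, huv⟩, e, EdgeData.mem_unc.2 ⟨he, by rwa [e1], by rwa [e2]⟩, e1⟩
    intro u v huv
    rcases lt_trichotomy u v with hlt | rfl | hlt
    · exact (key v u huv.symm hlt).symm
    · exact absurd rfl huv.ne
    · exact key u v huv hlt
  · refine (Finset.card_union_le _ _).trans (Nat.add_le_add ?_ ?_)
    · refine Finset.card_le_card_of_injOn lab (fun u hu => ?_) fun u hu u' hu' he => ?_
      · simp only [hA, Finset.coe_filter, Finset.mem_univ, true_and, Set.mem_ofPred_eq] at hu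
        exact hu.2
      · simp only [hA, Finset.coe_filter, Finset.mem_univ, true_and, Set.mem_ofPred_eq] at hu hu'
        obtain ⟨⟨w, hw⟩, -⟩ := hu
        obtain ⟨⟨w', hw'⟩, -⟩ := hu'
        exact h.inj u u' w w' hw hw' he
    · have : (B.image lab) ⊆ (I.unc W).image I.eu := by
        intro x hx
        simp only [hB, Finset.mem_image, Finset.mem_filter, Finset.mem_univ, true_and] at hx
        obtain ⟨u, ⟨-, e, he, e1⟩, rfl⟩ := hx
        exact Finset.mem_image.2 ⟨e, he, e1⟩
      rw [← Finset.card_image_of_injOn (s := B) (f := lab)]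
      · exact (Finset.card_le_card this).trans Finset.card_image_le
      · intro u hu u' hu' he
        simp only [hB, Finset.coe_filter, Finset.mem_univ, true_and, Set.mem_ofPred_eq] at hu hu'
        obtain ⟨⟨w, hw⟩, -⟩ := hu
        obtain ⟨⟨w', hw'⟩, -⟩ := hu'
        exact h.inj u u' w w' hw hw' he

theorem card_le (h : Encodes G I lab) : I.n ≤ n := by
  classical
  have : Finset.range I.n ⊆ Finset.univ.image lab := by
    intro x hx
    obtain ⟨u, w, -, rfl⟩ := h.surj x (by simpa using hx)
    simp
  have := (Finset.card_le_card this).trans Finset.card_image_le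
  simpa using this

/-- This is what dropping the isolated vertices is for: the number of variables becomes bounded by a
multiple of the tree size, as the learner requires. -/
theorem n_le (h : Encodes G I lab) : I.n ≤ 2 * I.m := by
  classical
  have : Finset.range I.n ⊆ (Finset.range I.m).image I.eu ∪ (Finset.range I.m).image I.ev := by
    intro x hx
    obtain ⟨u, w, huw, rfl⟩ := h.surj x (by simpa using hx)
    simp only [Finset.mem_union, Finset.mem_image, Finset.mem_range]
    rcases lt_or_gt_of_ne huw.ne with hlt | hlt
    · obtain ⟨e, he, e1, e2⟩ := h.all w u huw.symm hlt
      exact Or.inr ⟨e, he, e2⟩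
    · obtain ⟨e, he, e1, e2⟩ := h.all u w huw hlt
      exact Or.inl ⟨e, he, e1⟩
  have h1 := (Finset.card_le_card this).trans (Finset.card_union_le _ _)
  have h2 := Finset.card_image_le (s := Finset.range I.m) (f := I.eu)
  have h3 := Finset.card_image_le (s := Finset.range I.m) (f := I.ev)
  simp only [Finset.card_range] at h1 h2 h3
  omega

/-- Every edge is incident to a vertex of the cover, and each of these has at most `d` edges. For a
cover of size k this gives m ≤ dk, the source of the factor `d` in the approximation ratio. -/
theorem m_le_of_cover (h : Encodes G I lab) [DecidableRel G.Adj] {d : ℕ}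
    (hd : ∀ v, G.degree v ≤ d) {S : Finset (Fin n)} (hS : G.IsVertexCover S) :
    I.m ≤ d * S.card := by
  classical
  have hinj : I.m ≤ (S.biUnion fun u => G.incidenceFinset u).card := by
    rcases Nat.eq_zero_or_pos I.m with h0 | h0
    · rw [h0]; exact Nat.zero_le _
    have : Nonempty (Fin n) := ⟨(h.edge 0 h0).choose⟩
    choose! u v huv hvu e1 e2 using h.edge
    rw [← Finset.card_range I.m]
    refine Finset.card_le_card_of_injOn (fun e => s(u e, v e)) (fun e he => ?_)
      fun e he e' he' heq => ?_
    · have he : e < I.m := by simpa using he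
      simp only [Finset.coe_biUnion, Set.mem_iUnion, Finset.mem_coe]
      rcases hS (huv e he) with hu | hv
      · exact ⟨u e, by simpa using hu, by
          simp [SimpleGraph.mem_incidenceFinset,
            huv e he]⟩
      · exact ⟨v e, by simpa using hv, by
          simp [SimpleGraph.mem_incidenceFinset, SimpleGraph.mk'_mem_incidenceSet_right_iff,
            huv e he]⟩
    · have he : e < I.m := by simpa using he
      have he' : e' < I.m := by simpa using he'
      simp only [Sym2.eq_iff] at heq
      rcases heq with ⟨h1, h2⟩ | ⟨h1, h2⟩
      · exact h.edge_inj e he e' he' (by rw [e1 e he, e1 e' he', h1])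
          (by rw [e2 e he, e2 e' he', h2])
      · have p1 := hvu e he
        have p2 := hvu e' he'
        rw [h1, h2] at p1
        exact absurd p1 (not_lt.2 p2.le)
  refine hinj.trans (Finset.card_biUnion_le.trans ?_)
  rw [mul_comm]
  refine Finset.sum_le_card_nsmul _ _ _ fun w _ => ?_
  rw [SimpleGraph.card_incidenceFinset_eq_degree]
  exact hd w

/-- The vertices that are not isolated form a cover, and the labels embed them into the numbers
below `I.n`. -/
theorem m_le (h : Encodes G I lab) [DecidableRel G.Adj] {d : ℕ}
    (hd : ∀ v, G.degree v ≤ d) : I.m ≤ d * I.n := by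
  classical
  have hS : G.IsVertexCover ((Finset.univ.filter fun u => ∃ w, G.Adj u w : Finset (Fin n))) := by
    intro u v huv
    left
    simp only [Finset.coe_filter, Finset.mem_univ, true_and, Set.mem_ofPred_eq]
    exact ⟨v, huv⟩
  refine (h.m_le_of_cover hd hS).trans (Nat.mul_le_mul_left _ ?_)
  rw [← Finset.card_range I.n]
  refine Finset.card_le_card_of_injOn lab (fun u hu => ?_) fun u hu u' hu' he => ?_
  · simp only [Finset.coe_filter, Finset.mem_univ, true_and, Set.mem_ofPred_eq] at hu
    obtain ⟨w, hw⟩ := hu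
    simpa using h.lt u w hw
  · simp only [Finset.coe_filter, Finset.mem_univ, true_and, Set.mem_ofPred_eq] at hu hu'
    obtain ⟨w, hw⟩ := hu
    obtain ⟨w', hw'⟩ := hu'
    exact h.inj u u' w w' hw hw' he

end Encodes

/-! ### Computing the parameters -/

/-- Multiplication. -/
def mulProg (x y z : ℕ) : PlainProg :=
  .seq (.instr (.const x 0)) (Prog.forp 51 52 y (.instr (.add x x z)))

theorem mulProg_spec {x y z : ℕ} {σ : Store} (h2 : σ.reg 2 = 1) (hx : x ∉ [2, 51, 52, y, z])
    (hy : y ∉ [51, 52]) (hz : z ∉ [51, 52]) :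
    WP (mulProg x y z) (σ.reg y * 6 + 7) (fun σ' => σ'.reg x = σ.reg y * σ.reg z) σ := by
  simp only [List.mem_cons, List.not_mem_nil, or_false, not_or] at hx hy hz
  obtain ⟨x2, x51, x52, xy, xz⟩ := hx
  refine (WP.seq (WP.instr rfl (WP.forp (σ.reg y) (B := 1) (fun j σ' => σ'.reg x = j * σ.reg z)
    (by simp [Ne.symm xy]) (by simp [h2, Ne.symm x2]) (by simp [Ne.symm x51])
    (by simp [hy, Ne.symm xy]) (by simp [Ne.symm x2]) (by simp) (by simp [x51, x52]) ?_
    (fun σ' hf hI => hI)))).weaken (by omega) fun _ h => h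
  intro j hj σ' hf hi hI
  have e : σ'.reg z = σ.reg z := by
    rw [hf.1 z (by simp [hz, Ne.symm xz])]
    simp [Ne.symm xz]
  refine WP.instr rfl ?_
  simp [x51, x52, hI, e]
  ring

theorem regs_mulProg (x y z : ℕ) : ∀ w ∈ (mulProg x y z).regs, w = x ∨ w = 51 ∨ w = 52 := by
  simp [mulProg]

theorem arrs_mulProg (x y z : ℕ) : (mulProg x y z).arrs = [] := by
  simp [mulProg]

/-- A multiplication, and the registers that it leaves unchanged. -/
theorem mulProg_spec' {x y z : ℕ} {σ : Store} (h2 : σ.reg 2 = 1) (hx : x ∉ [2, 51, 52, y, z])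
    (hy : y ∉ [51, 52]) (hz : z ∉ [51, 52]) {a b : ℕ} (ha : σ.reg y = a) (hb : σ.reg z = b) :
    WP (mulProg x y z) (a * 6 + 7) (fun σ' => σ'.reg x = a * b ∧
      (∀ w, w ≠ x → w ≠ 51 → w ≠ 52 → σ'.reg w = σ.reg w) ∧ σ'.arr = σ.arr) σ := by
  subst ha hb
  refine (mulProg_spec h2 hx hy hz).mono le_rfl fun σ' hf h => ⟨h, fun w h1 h2 h3 => ?_, ?_⟩
  · exact hf.1 w fun hw => by rcases regs_mulProg x y z w hw with h | h | h <;> contradiction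
  · funext a
    exact hf.2 a (by rw [arrs_mulProg]; simp)

/-- Compute the power of the number in register `66` into register `16`. -/
def powProg : PlainProg :=
  .seq (.instr (.const 16 1)) (Prog.forp 67 68 9
    (.seq (mulProg 69 66 16) (Prog.blk (.const 16 0) [.add 16 16 69])))

theorem powProg_spec {σ : Store} {r s : ℕ} (h2 : σ.reg 2 = 1) (h9 : σ.reg 9 = r)
    (h66 : σ.reg 66 = s) :
    WP powProg (r * (s * 6 + 16) + 7) (fun σ' => σ'.reg 16 = s ^ r ∧
      (∀ w, w < 51 → w ≠ 16 → σ'.reg w = σ.reg w) ∧ σ'.arr = σ.arr) σ := by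
  refine ((WP.seq (WP.instr rfl (WP.forp r (B := s * 6 + 11) (fun j σ' => σ'.reg 16 = s ^ j)
    (by simp [h9]) (by simp [h2]) (by simp [mulProg]) (by simp [mulProg]) (by simp [mulProg])
    (by simp) (by simp) ?_ (fun σ' hf hI => hI)))).weaken (by ring_nf; omega) fun _ h => h).mono
    le_rfl fun σ' hf h => ⟨h, fun w h1 h2 => hf.1 w ?_, funext fun a => hf.2 a ?_⟩
  · intro j hj σ' hf hi hI
    have e2 : σ'.reg 2 = 1 := by
      rw [hf.1 2 (by simp [mulProg])]; simp [h2]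
    have e66 : σ'.reg 66 = s := by
      rw [hf.1 66 (by simp [mulProg])]; simp [h66]
    refine (WP.seq' (mulProg_spec' (x := 69) (y := 66) (z := 16) e2 (by simp) (by simp) (by simp)
      e66 hI) fun σ₁ _ h₁ => WP.blk rfl ?_).weaken (by simp only [List.length]; omega) fun _ h => h
    simp [h₁.1, pow_succ]
    ring
  · simp [mulProg]; omega
  · simp [mulProg]

/-- Compute the parameters of the instance; `C` is the ratio of the number of the copies to the
number of the vertices. -/
def sizesProg (C : ℕ) : PlainProg :=
  .seq (.instr (.const 61 C)) (.seq (mulProg 5 61 3) (.seq (.instr (.add 14 5 2))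
  (.seq (mulProg 6 3 14) (.seq (mulProg 7 9 6) (.seq (mulProg 8 9 3)
  (.seq (Prog.blk (.add 10 5 5) [.add 10 10 10, .add 65 14 3])
  (.seq (mulProg 63 14 1) (.seq (mulProg 64 4 65)
  (.seq (Prog.blk (.add 66 63 64) [.add 66 66 2])
  (.seq powProg (Prog.blk (.const 101 0) [.add 101 101 16])))))))))))

/-- The size of the tree for one block. -/
def EdgeData.blockSize (I : EdgeData) (k : ℕ) : ℕ :=
  1 + k * (I.ℓ + 1) + I.m * (I.ℓ + I.n + 1)

/-- The size bound is stored twice: register 16 keeps it for the learner, and register 101 is the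
input register of the renamed program for the time bound. -/
theorem sizesProg_spec {C r P q k : ℕ} {I : EdgeData} {σ : Store} (hℓ : I.ℓ = C * I.n)
    (h1 : σ.reg 1 = k) (h2 : σ.reg 2 = 1) (h3 : σ.reg 3 = I.n) (h4 : σ.reg 4 = I.m)
    (h9 : σ.reg 9 = r) (h11 : σ.reg 11 = P) (h12 : σ.reg 12 = q) (heu : σ.arr 2 = I.eu)
    (hev : σ.arr 3 = I.ev) :
    WP (sizesProg C) (C * 6 + I.n * 6 + r * 12 + I.ℓ * 6 + I.m * 6 +
      r * (I.blockSize k * 6 + 16) + 100) (fun σ' => Holds I r P q σ' ∧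
      σ'.reg 16 = I.blockSize k ^ r ∧ σ'.reg 101 = I.blockSize k ^ r) σ := by
  refine (WP.seq (B := 1) (WP.instr rfl (WP.seq' (mulProg_spec' (a := C) (b := I.n) ?_ (by simp)
    (by simp) (by simp) ?_ ?_) fun σ₁ hf₁ ⟨m₁, k₁, a₁⟩ => WP.seq' (B := 1)
    (P := fun σ' => σ'.reg 14 = I.ℓ + 1 ∧ (∀ w, w ≠ 14 → σ'.reg w = σ₁.reg w) ∧ σ'.arr = σ₁.arr)
    (WP.instr rfl ?_) fun σ₂ hf₂ ⟨m₂, k₂, a₂⟩ => WP.seq' (mulProg_spec' (a := I.n) (b := I.ℓ + 1)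
    ?_ (by simp) (by simp) (by simp) ?_ ?_) fun σ₃ hf₃ ⟨m₃, k₃, a₃⟩ => WP.seq' (mulProg_spec'
    (a := r) (b := I.width) ?_ (by simp) (by simp) (by simp) ?_ ?_) fun σ₄ hf₄ ⟨m₄, k₄, a₄⟩ =>
    WP.seq' (mulProg_spec' (a := r) (b := I.n) ?_ (by simp) (by simp) (by simp) ?_ ?_)
    fun σ₅ hf₅ ⟨m₅, k₅, a₅⟩ => WP.seq' (B := 5) (P := fun σ' => σ'.reg 10 = 4 * I.ℓ ∧
      σ'.reg 65 = I.ℓ + I.n + 1 ∧ (∀ w, w ≠ 10 → w ≠ 65 → σ'.reg w = σ₅.reg w) ∧ σ'.arr = σ₅.arr)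
    (WP.blk rfl ?_) fun σ₆ hf₆ ⟨m₆, m₆', k₆, a₆⟩ => WP.seq' (mulProg_spec' (a := I.ℓ + 1) (b := k)
    ?_ (by simp) (by simp) (by simp) ?_ ?_) fun σ₇ hf₇ ⟨m₇, k₇, a₇⟩ => WP.seq' (mulProg_spec'
    (a := I.m) (b := I.ℓ + I.n + 1) ?_ (by simp) (by simp) (by simp) ?_ ?_)
    fun σ₈ hf₈ ⟨m₈, k₈, a₈⟩ => WP.seq' (B := 3) (P := fun σ' => σ'.reg 66 = I.blockSize k ∧
      (∀ w, w ≠ 66 → σ'.reg w = σ₈.reg w) ∧ σ'.arr = σ₈.arr) (WP.blk rfl ?_)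
    fun σ₉ hf₉ ⟨m₉, k₉, a₉⟩ => WP.seq' (powProg_spec (r := r) ?_ ?_ m₉)
    fun σ₁₀ hf₁₀ ⟨m₁₀, k₁₀, a₁₀⟩ => WP.blk rfl ?_))).weaken
    (by simp only [List.length]; ring_nf; omega) fun _ h => h
  · simp [h2]
  · simp
  · simp [h3]
  · refine ⟨by simp [m₁, k₁, h2, hℓ], fun w hw => by simp [hw], by simp⟩
  · simp [k₂, k₁, h2]
  · simp [k₂, k₁, h3]
  · exact m₂
  · simp [k₃, k₂, k₁, h2]
  · simp [k₃, k₂, k₁, h9]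
  · simp [m₃, EdgeData.width]
  · simp [k₄, k₃, k₂, k₁, h2]
  · simp [k₄, k₃, k₂, k₁, h9]
  · simp [k₄, k₃, k₂, k₁, h3]
  · have e5 : σ₅.reg 5 = I.ℓ := by simp [k₅, k₄, k₃, k₂, m₁, hℓ]
    have e14 : σ₅.reg 14 = I.ℓ + 1 := by simp [k₅, k₄, k₃, m₂]
    have e3 : σ₅.reg 3 = I.n := by simp [k₅, k₄, k₃, k₂, k₁, h3]
    refine ⟨by norm_num [e5]; ring, by norm_num [e14, e3]; ring, fun w hw hw' => by simp [hw, hw'],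
      by simp⟩
  · simp [k₆, k₅, k₄, k₃, k₂, k₁, h2]
  · simp [k₆, k₅, k₄, k₃, m₂]
  · simp [k₆, k₅, k₄, k₃, k₂, k₁, h1]
  · simp [k₇, k₆, k₅, k₄, k₃, k₂, k₁, h2]
  · simp [k₇, k₆, k₅, k₄, k₃, k₂, k₁, h4]
  · simp [k₇, m₆']
  · have e63 : σ₈.reg 63 = (I.ℓ + 1) * k := by simp [k₈, m₇]
    have e2 : σ₈.reg 2 = 1 := by simp [k₈, k₇, k₆, k₅, k₄, k₃, k₂, k₁, h2]
    refine ⟨by norm_num [e63, m₈, e2, EdgeData.blockSize]; ring, fun w hw => by simp [hw], by simp⟩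
  · simp [k₉, k₈, k₇, k₆, k₅, k₄, k₃, k₂, k₁, h2]
  · simp [k₉, k₈, k₇, k₆, k₅, k₄, k₃, k₂, k₁, h9]
  · have ha : σ₁₀.arr = σ.arr := by
      rw [a₁₀, a₉, a₈, a₇, a₆, a₅, a₄, a₃, a₂, a₁]; simp
    refine ⟨?_, by simp [m₁₀], by simp [m₁₀]⟩
    constructor
    · simp [k₁₀, k₉, k₈, k₇, k₆, k₅, k₄, k₃, k₂, k₁, h2]
    · simp [k₁₀, k₉, k₈, k₇, k₆, k₅, k₄, k₃, k₂, k₁, h3]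
    · simp [k₁₀, k₉, k₈, k₇, k₆, k₅, k₄, k₃, k₂, k₁, h4]
    · simp [k₁₀, k₉, k₈, k₇, k₆, k₅, k₄, k₃, k₂, m₁, hℓ]
    · simp [k₁₀, k₉, k₈, k₇, k₆, k₅, k₄, m₃, EdgeData.width]
    · simp [k₁₀, k₉, k₈, k₇, k₆, k₅, m₄]
    · simp [k₁₀, k₉, k₈, k₇, k₆, m₅]
    · simp [k₁₀, k₉, k₈, k₇, k₆, k₅, k₄, k₃, k₂, k₁, h9]
    · simp [k₁₀, k₉, k₈, k₇, m₆]
    · simp [k₁₀, k₉, k₈, k₇, k₆, k₅, k₄, k₃, k₂, k₁, h11]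
    · simp [k₁₀, k₉, k₈, k₇, k₆, k₅, k₄, k₃, k₂, k₁, h12]
    · simp [k₁₀, k₉, k₈, k₇, k₆, k₅, k₄, k₃, m₂]
    · intro e _; simp [ha, heu]
    · intro e _; simp [ha, hev]

/-- Read the graph, and compare the weights of the trivial cover and of the budget. -/
def readProg (r p q : ℕ) : PlainProg :=
  .seq (Prog.blk (.const 2 1) [.const 9 r, .const 12 q]) (.seq labelProg (.seq listProg
    (.seq (.instr (.const 61 p)) (.seq (mulProg 11 61 1) (.instr (.sub 62 13 11))))))

/-- Register 62 is a truncated difference that vanishes exactly if taking one endpoint of every edge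
already meets the threshold. Beyond the listed edges nothing is said about the edge arrays. -/
theorem readProg_spec {n k r p q : ℕ} {a : ℕ → ℕ} :
    WP (readProg r p q) (n * (n * 35 + 30) + p * 6 + 40) (fun σ => ∃ eu ev : ℕ → ℕ,
      (∀ z < n * n, Lower n a z → eu (rank n a z) = label n a (z / n) ∧
        ev (rank n a z) = label n a (z % n)) ∧ σ.arr 2 = eu ∧ σ.arr 3 = ev ∧
      σ.reg 1 = k ∧ σ.reg 2 = 1 ∧ σ.reg 3 = label n a n ∧ σ.reg 4 = rank n a (n * n) ∧
      σ.reg 9 = r ∧ σ.reg 11 = p * k ∧ σ.reg 12 = q ∧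
      σ.reg 62 = q * rank n a (n * n) - p * k) (inputStore n k a) := by
  set σ₀ := inputStore n k a with hσ₀
  have z0 : σ₀.reg 0 = n := by simp [hσ₀, inputStore]
  have z1 : σ₀.reg 1 = k := by simp [hσ₀, inputStore]
  have zr : ∀ x, 2 ≤ x → σ₀.reg x = 0 := fun x hx => by
    simp only [hσ₀, inputStore]
    rw [if_neg (by omega), if_neg (by omega)]
  have za : σ₀.arr 0 = a := by simp [hσ₀, inputStore]
  set τ := List.foldl (fun τ o => Instr.det o τ) ((Instr.const 2 1).det σ₀)
    [.const 9 r, .const 12 q] with hτ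
  have t0 : τ.reg 0 = n := by simp [hτ, z0]
  have t1 : τ.reg 1 = k := by simp [hτ, z1]
  have t2 : τ.reg 2 = 1 := by simp [hτ]
  have t3 : τ.reg 3 = 0 := by simp [hτ, zr]
  have t4 : τ.reg 4 = 0 := by simp [hτ, zr]
  have t9 : τ.reg 9 = r := by simp [hτ]
  have t12 : τ.reg 12 = q := by simp [hτ]
  have t13 : τ.reg 13 = 0 := by simp [hτ, zr]
  have ta : τ.arr 0 = a := by simp [hτ, za]
  have hl := labelProg_spec t0 t2 t3
  rw [ta] at hl
  refine (WP.seq (WP.blk rfl (WP.seq' hl fun σ₁ hf₁ h₁ => ?_))).weaken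
    (B := 5 + (n * (n * 11 + 20) + 7 + ((n * (n * 24 + 10) + 7) + (1 + ((p * 6 + 7) + 1 + 1) + 1)
      + 1) + 1) + 1) (by ring_nf; omega) fun _ h => h
  have a0 : σ₁.arr 0 = a := by rw [hf₁.2 0 (by simp [labelProg]), ta]
  have hl₂ := listProg_spec (n := n) (q := q) (σ := σ₁)
    (by rw [hf₁.1 0 (by simp [labelProg]), t0]) (by rw [hf₁.1 2 (by simp [labelProg]), t2])
    (by rw [hf₁.1 4 (by simp [labelProg]), t4]) (by rw [hf₁.1 13 (by simp [labelProg]), t13])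
    (by rw [hf₁.1 12 (by simp [labelProg]), t12]) (by rw [a0]; exact h₁.2)
  rw [a0] at hl₂
  refine WP.seq' hl₂ fun σ₂ hf₂ h₂ => WP.seq (B := 1) (WP.instr rfl
    (WP.seq' (B := p * 6 + 7) (B' := 1) (mulProg_spec' (x := 11) (y := 61) (z := 1) (a := p) (b := k) ?_ (by simp) (by simp) (by simp) (by simp) ?_)
    fun σ₃ hf₃ ⟨m₃, k₃, a₃⟩ => WP.instr rfl ?_))
  · simp [hf₂.1 2 (by simp [listProg]), hf₁.1 2 (by simp [labelProg])]
  · simp [hf₂.1 1 (by simp [listProg]), hf₁.1 1 (by simp [labelProg]), z1]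
  · refine ⟨_, _, h₂.2.2, by simp [a₃], by simp [a₃], ?_, ?_, ?_, ?_, ?_, ?_, ?_, ?_⟩
    · simp [k₃, hf₂.1 1 (by simp [listProg]), hf₁.1 1 (by simp [labelProg]), z1]
    · simp [k₃, hf₂.1 2 (by simp [listProg]), hf₁.1 2 (by simp [labelProg])]
    · simp [k₃, hf₂.1 3 (by simp [listProg]), h₁.1]
    · simp [k₃, h₂.1]
    · simp [k₃, hf₂.1 9 (by simp [listProg]), hf₁.1 9 (by simp [labelProg])]
    · simp [m₃]
    · simp [k₃, hf₂.1 12 (by simp [listProg]), hf₁.1 12 (by simp [labelProg])]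
    · simp [k₃, m₃, h₂.2.1]

/-! ### The whole program -/

/-- The outcome of the simulation and of the search. -/
def Outcome (I : EdgeData) (r P q b : ℕ) (σ : Store) : Prop :=
  ∃ base vtx z, Tables I r base vtx ∧ (∀ i < r * I.n, z i = 0) ∧
    σ.reg 0 = ((Search.next I r P q (σ.learner.arr 2) base vtx)^[b]
      ⟨0, 0, 1, false, z⟩).found.toNat

theorem regs_searchProg : ∀ x ∈ searchProg.regs, x < 100 := by
  simp [searchProg, tableProg, nextProg, usefulProg, candProg, dupProg]

theorem arrs_searchProg : ∀ x ∈ searchProg.arrs, x < 20 := by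
  simp [searchProg, tableProg, nextProg, usefulProg, candProg, dupProg]

theorem core_law {I : EdgeData} (hI : I.Valid) {r P q b c : ℕ} [Nonempty (Fin I.m)]
    [Nonempty (Fin (4 * I.ℓ))] {σ : Store} (h : Ready I r P q b σ) (hc : σ.reg 17 = c)
    (L : Prog LearnCall) :
    Law [L.sim oracleProg, searchProg] σ (c * (I.callCost r + 20) + 5 + I.searchCost r b)
      (Outcome I r P q b) Store.learner
      ((runFor (learnOracle (I.goal r) (I.examples r)) c ([L], σ.learner)).map fun y => y.2) := by
  have h1 := sim_law (S := oracleProg) (J := Ready I r P q b) (fun σ σ' => Ready.sameAux)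
    (fun σ h => h.1.one) (fun i σ h => oracleProg_law hI i σ h) c [(false, L)] σ h hc
  have h2 := h1.append (ks' := [searchProg]) (B' := I.searchCost r b) (I' := Outcome I r P q b)
    (obs' := Store.learner) (κ := PMF.pure) fun σ' h' => Law.of_wp (searchProg_spec hI h')
      fun σ'' hf hQ => ?_
  · rw [PMF.bind_pure] at h2
    exact h2
  · have hl := hf.learner_eq regs_searchProg arrs_searchProg
    refine ⟨?_, hl⟩
    obtain ⟨base, vtx, z, h3, h4, h5⟩ := hQ
    refine ⟨base, vtx, z, h3, h4, ?_⟩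
    rw [h5, hl]
    rfl

/-- The location of the registers of the program for the time bound. -/
def treg (x : ℕ) : ℕ := 2 * x + 101

/-- The location of the arrays of the program for the time bound. -/
def tarr (a : ℕ) : ℕ := 2 * a + 21

theorem treg_injective : Function.Injective treg := fun x y h => by unfold treg at h; omega

theorem tarr_injective : Function.Injective tarr := fun x y h => by unfold tarr at h; omega

/-- Set the step counter and the budget of the search, and the input of the learner. -/
def handoffProg : PlainProg :=
  Prog.blk (.const 17 0) [.add 17 17 101, .add 15 17 17, .add 15 15 2, .const 100 0, .add 100 100 7,
    .const 102 0, .add 102 102 16]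

/-- The program for vertex cover: `p` computes the time bound of the learner `L`. -/
def mainProg (L : Prog LearnCall) (p : PlainProg) (r u q C : ℕ) : PlainProg :=
  .seq (readProg r u q) (.branch 62 (.seq (sizesProg C) (.seq (Prog.ren treg tarr p)
    (.seq handoffProg (.seq (L.sim oracleProg) searchProg)))) (.instr (.const 0 1)))

theorem Law.with_support {α : Type*} {ks : List PlainProg} {σ : Store} {B : ℕ} {I : Store → Prop}
    {obs : Store → α} {μ : PMF α} (h : Law ks σ B I obs μ) :
    Law ks σ B (fun σ' => I σ' ∧ obs σ' ∈ μ.support) obs μ := by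
  obtain ⟨ν, h1, h2, h3⟩ := h
  refine ⟨ν, h1, fun y hy => ⟨h2 y hy, ?_⟩, h3⟩
  rw [← h3, PMF.mem_support_map_iff]
  exact ⟨y, hy, rfl⟩

/-- Prepend a random program whose random choices do not matter. -/
theorem Law.cons_of_law {α β : Type*} {p : PlainProg} {ks : List PlainProg} {σ : Store} {B B' : ℕ}
    {I I' : Store → Prop} {obs : Store → α} {obs' : Store → β} {μ : PMF α} {μ' : PMF β}
    (h : Law [p] σ B I obs μ) (h' : ∀ σ', I σ' → Law ks σ' B' I' obs' μ') :
    Law (p :: ks) σ (B + B') I' obs' μ' := by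
  have := h.append (κ := fun _ => μ') h'
  rwa [PMF.bind_const] at this

/-- An event of probability one contains the whole support, so the time bound is computed correctly
for all random choices. These can then be forgotten, leaving the trivial observation. -/
theorem time_law {c : ℕ} {g : ℕ → ℕ} {p : PlainProg}
    (hp : ∀ x : ℕ, HaltsWithin noOracle p (inputStore x 0 fun _ => 0) (c * g x) ∧
      outcomeProb noOracle p (inputStore x 0 fun _ => 0) (c * g x) (fun σ => σ.reg 0 = g x) = 1)
    {σ : Store} {x : ℕ} (hσ : σ.view treg tarr = inputStore x 0 fun _ => 0) :
    Law [Prog.ren treg tarr p] σ (c * g x)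
      (fun σ' => OutFrame treg tarr σ σ' ∧ σ'.reg 101 = g x) (fun _ => ()) (PMF.pure ()) := by
  have h := (ren_law treg_injective tarr_injective (c * g x) [p] σ (by
    rw [hσ]; exact (hp x).1)).with_support
  have h' := h.map fun _ => ()
  rw [show ∀ μ : PMF Store, μ.map (fun _ => ()) = PMF.pure () from fun μ => PMF.map_const μ ()]
    at h'
  refine h'.mono le_rfl fun σ' ⟨h1, h2⟩ => ⟨h1, ?_⟩
  rw [PMF.mem_support_map_iff] at h2
  obtain ⟨y, hy, he⟩ := h2
  rw [hσ] at hy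
  have := (hp x).2
  rw [outcomeProb, PMF.toOuterMeasure_apply_eq_one_iff] at this
  have hy' := (this hy).2
  rw [he] at hy'
  exact hy'

/-- The number of steps to read a graph with `n` vertices. -/
def readCost (n u : ℕ) : ℕ := n * (n * 35 + 30) + u * 6 + 40

/-- The number of steps to compute the parameters. -/
def EdgeData.sizesCost (I : EdgeData) (C r k : ℕ) : ℕ :=
  C * 6 + I.n * 6 + r * 12 + I.ℓ * 6 + I.m * 6 + r * (I.blockSize k * 6 + 16) + 100

theorem regs_sizesProg (C : ℕ) : ∀ x ∈ (sizesProg C).regs, x < 100 ∨ x = 101 := by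
  simp [sizesProg, mulProg, powProg]

theorem arrs_sizesProg (C : ℕ) : (sizesProg C).arrs = [] := by
  simp [sizesProg, mulProg, powProg]

theorem regs_readProg (r u q : ℕ) : ∀ x ∈ (readProg r u q).regs, x < 100 := by
  simp [readProg, labelProg, listProg, mulProg]

theorem arrs_readProg (r u q : ℕ) : ∀ x ∈ (readProg r u q).arrs, x < 20 := by
  simp [readProg, labelProg, listProg, mulProg]

/-- Up to the learner's simulation everything relevant is determined, so the law of the learner's
final memory is that of `g s` steps of the learner on a clean input, with `s = I.blockSize k ^ r`.
The budget `2 * g s + 1` suffices for the code of a tree written in `g s` steps. -/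
theorem mainProg_law {n k r u q C c : ℕ} {a : ℕ → ℕ} {g : ℕ → ℕ} {p : PlainProg}
    (hp : ∀ x : ℕ, HaltsWithin noOracle p (inputStore x 0 fun _ => 0) (c * g x) ∧
      outcomeProb noOracle p (inputStore x 0 fun _ => 0) (c * g x) (fun σ => σ.reg 0 = g x) = 1)
    (L : Prog LearnCall) :
    ∃ I : EdgeData, I.n = label n a n ∧ I.m = rank n a (n * n) ∧ I.ℓ = C * I.n ∧
      (∀ z < n * n, Lower n a z → I.eu (rank n a z) = label n a (z / n) ∧
        I.ev (rank n a z) = label n a (z % n)) ∧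
      (q * I.m ≤ u * k → Law [mainProg L p r u q C] (inputStore n k a) (readCost n u + 3)
        (fun σ => σ.reg 0 = 1) (fun _ => ()) (PMF.pure ())) ∧
      (u * k < q * I.m → I.Valid → ∀ [Nonempty (Fin I.m)] [Nonempty (Fin (4 * I.ℓ))],
        Law [mainProg L p r u q C] (inputStore n k a)
          (readCost n u + I.sizesCost C r k + c * g (I.blockSize k ^ r) +
            (g (I.blockSize k ^ r) * (I.callCost r + 20) + 5 +
              I.searchCost r (2 * g (I.blockSize k ^ r) + 1)) + 25)
          (Outcome I r (u * k) q (2 * g (I.blockSize k ^ r) + 1)) Store.learner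
          ((runFor (learnOracle (I.goal r) (I.examples r)) (g (I.blockSize k ^ r))
            ([L], inputStore (r * I.width) (I.blockSize k ^ r) fun _ => 0)).map fun y => y.2)) := by
  -- The edge data are read off from the final memory of the reading phase, irrelevant cells
  -- included.
  obtain ⟨σ₁, c₁, hx, hc₁, eu, ev, hl, h2, h3, r1, r2, r3, r4, r9, r11, r12, r62⟩ :=
    readProg_spec (n := n) (k := k) (r := r) (p := u) (q := q) (a := a)
  have hwp : WP (readProg r u q) (readCost n u) (fun σ => σ = σ₁) (inputStore n k a) :=
    ⟨σ₁, c₁, hx, hc₁, rfl⟩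
  have hf₁ := hx.frame
  set I : EdgeData := ⟨label n a n, rank n a (n * n), C * label n a n, eu, ev⟩ with hI
  refine ⟨I, rfl, rfl, rfl, hl, fun hle => ?_, fun hlt hV _ _ => ?_⟩
  · refine (Law.seq (Law.wp_cons (B' := 2) hwp fun σ _ hσ => ?_)).mono (by omega) fun _ h => h
    subst hσ
    refine Law.branch ?_
    rw [if_neg (by rw [r62]; simp only [not_not]; exact Nat.sub_eq_zero_of_le hle)]
    exact Law.of_wp (WP.instr (Q := fun σ' => σ'.reg 0 = 1) rfl (by simp)) fun σ' _ h => ⟨h, rfl⟩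
  · set s := I.blockSize k ^ r with hs
    set b := 2 * g s + 1 with hb
    set B₀ := g s * (I.callCost r + 20) + 5 + I.searchCost r b with hB₀
    refine (Law.seq (Law.wp_cons (B' := I.sizesCost C r k + c * g s + B₀ + 20) hwp
      fun σ _ hσ => ?_)).mono (by omega) fun _ h => h
    subst hσ
    refine (Law.branch (B := I.sizesCost C r k + c * g s + B₀ + 19) ?_).mono (by omega)
      fun _ h => h
    rw [if_pos (by rw [r62]; have : rank n a (n * n) = I.m := rfl; rw [this]; omega)]
    refine (Law.seq (B := I.sizesCost C r k + c * g s + B₀ + 18) ((Law.wp_cons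
      (B' := c * g s + B₀ + 18) (sizesProg_spec (C := C) (I := I) rfl r1 r2 r3 r4 r9 r11 r12 h2 h3)
      fun σ₂ hf₂ hQ₂ => ?_).mono (by unfold EdgeData.sizesCost; omega) fun _ h => h)).mono (by omega) fun _ h => h
    obtain ⟨hH₂, q16, q101⟩ := hQ₂
    -- The registers of the two embedded programs are still zero, apart from the input just written;
    -- this makes their views equal to fresh input memories.
    have z₂ : ∀ x, 100 ≤ x → x ≠ 101 → σ₂.reg x = 0 := by
      intro x hx hx'
      rw [hf₂.1 x fun hm => by have := regs_sizesProg C x hm; omega,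
        hf₁.1 x fun hm => by have := regs_readProg r u q x hm; omega]
      simp only [inputStore]
      rw [if_neg (by omega), if_neg (by omega)]
    have y₂ : ∀ x, 20 ≤ x → σ₂.arr x = fun _ => 0 := by
      intro x hx
      rw [hf₂.2 x (by rw [arrs_sizesProg]; simp),
        hf₁.2 x fun hm => by have := arrs_readProg r u q x hm; omega]
      simp only [inputStore]
      rw [if_neg (by omega)]
    have hview : σ₂.view treg tarr = inputStore s 0 fun _ => 0 := by
      unfold Store.view inputStore
      congr 1
      · funext x
        by_cases hx : x = 0
        · subst hx; rw [if_pos rfl]; exact q101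
        · rw [if_neg hx, ite_self]
          exact z₂ _ (by unfold treg; omega) (by unfold treg; omega)
      · funext x
        rw [ite_self]
        exact y₂ _ (by unfold tarr; omega)
    refine (Law.seq (B := c * g s + B₀ + 17) ((Law.cons_of_law (B' := B₀ + 17) (time_law hp hview)
      fun σ₃ h₃ => ?_).mono (by omega) fun _ h => h)).mono (by omega) fun _ h => h
    obtain ⟨hO, hg⟩ := h₃
    have hlow : ∀ x < 100, σ₃.reg x = σ₂.reg x := fun x hx =>
      hO.1 x (by rintro ⟨y, rfl⟩; unfold treg at hx; omega)
    have halow : ∀ x < 20, σ₃.arr x = σ₂.arr x := fun x hx =>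
      hO.2 x (by rintro ⟨y, rfl⟩; unfold tarr at hx; omega)
    have hH₃ : Holds I r (u * k) q σ₃ := by
      constructor <;> (first | rw [hlow _ (by norm_num)] | rw [halow _ (by norm_num)])
      exacts [hH₂.one, hH₂.n, hH₂.m, hH₂.copies, hH₂.width, hH₂.N, hH₂.rows, hH₂.r, hH₂.range,
        hH₂.P, hH₂.q, hH₂.succ, hH₂.eu, hH₂.ev]
    have hl₃ : ∀ x, σ₃.reg (lreg x) = 0 := by
      intro x
      rw [hO.1 _ (by rintro ⟨y, hy⟩; unfold treg lreg at hy; omega)]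
      exact z₂ _ (by unfold lreg; omega) (by unfold lreg; omega)
    have ha₃ : ∀ x, σ₃.arr (larr x) = fun _ => 0 := by
      intro x
      rw [hO.2 _ (by rintro ⟨y, hy⟩; unfold tarr larr at hy; omega)]
      exact y₂ _ (by unfold larr; omega)
    have p16 : σ₃.reg 16 = s := by rw [hlow 16 (by norm_num), q16]
    set τ := List.foldl (fun τ o => Instr.det o τ) ((Instr.const 17 0).det σ₃)
      [.add 17 17 101, .add 15 17 17, .add 15 15 2, .const 100 0, .add 100 100 7,
        .const 102 0, .add 102 102 16] with hτ
    have hfτ : Frame [17, 15, 100, 102] [] σ₃ τ := by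
      constructor
      · intro x hx
        simp only [List.mem_cons, List.not_mem_nil, or_false, not_or] at hx
        simp [hτ, hx]
      · intro x _; simp [hτ]
    have hRτ : Ready I r (u * k) q b τ := ⟨hH₃.frame hfτ, by
      norm_num [hτ, hg, hH₃.one, hb]; ring⟩
    have t17 : τ.reg 17 = g s := by norm_num [hτ, hg]
    have hlτ : τ.learner = inputStore (r * I.width) s fun _ => 0 := by
      unfold Store.learner Store.view inputStore
      congr 1
      · funext x
        by_cases h0 : x = 0
        · subst h0
          rw [if_pos rfl]
          change τ.reg 100 = _
          norm_num [hτ, hH₃.N]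
        · by_cases h1 : x = 1
          · subst h1
            rw [if_neg h0, if_pos rfl]
            change τ.reg 102 = _
            norm_num [hτ, p16]
          · rw [if_neg h0, if_neg h1, hfτ.1 _ (by
              simp only [List.mem_cons, List.not_mem_nil, or_false, not_or]
              unfold lreg; omega), hl₃]
      · funext x
        rw [ite_self, hfτ.2 _ (by simp), ha₃]
    refine (Law.seq (B := B₀ + 16) ((Law.wp_cons (B := 15) (B' := B₀ + 1) (WP.blk
      (Q := fun σ' => σ' = τ) rfl rfl) fun σ₄ _ h₄ => ?_).mono (by omega) fun _ h => h)).mono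
      (by omega) fun _ h => h
    subst h₄
    refine Law.seq ?_
    rw [← hlτ]
    exact core_law hV hRτ t17 L

/-! ### The output of a good learner passes the search only if it is found -/

theorem vals_injective {r m k : ℕ} : Function.Injective (vals : (Fin r → Fin m × Fin k) → _) := by
  intro ω ω' h
  funext i
  have := congrFun h i
  simp only [vals, Prod.mk.injEq] at this
  exact Prod.ext (Fin.ext this.1) (Fin.ext this.2)

/-- The examples come from (4mℓ)^r equally likely choices of points, so the disagreement is the
fraction of choices on which the tree errs. -/
theorem EdgeData.card_errors_le {I : EdgeData} (hI : I.Valid) {r : ℕ} [Nonempty (Fin I.m)]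
    [Nonempty (Fin (4 * I.ℓ))] {T : DTree (r * I.width)} {ε : ℝ} (hε : 0 ≤ ε)
    (h : disagreement (I.examples r) T.eval (I.goal r) ≤ ENNReal.ofReal ε) :
    ((I.errors (I.decode r) EdgeData.parity T fun _ => []).card : ℝ) ≤
      ε * (I.m * (4 * I.ℓ) : ℝ) ^ r := by
  classical
  rw [disagreement, EdgeData.examples, PMF.toOuterMeasure_map_apply,
    PMF.toOuterMeasure_uniformOfFintype_apply] at h
  set S : Set (Fin r → Fin I.m × Fin (4 * I.ℓ)) :=
    (fun ω => I.point (I.decode r) (vals ω)) ⁻¹' {x | T.eval x ≠ I.goal r x} with hS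
  have hc : Fintype.card (Fin r → Fin I.m × Fin (4 * I.ℓ)) = (I.m * (4 * I.ℓ)) ^ r := by simp
  have hpos : 0 < (I.m * (4 * I.ℓ)) ^ r := by rw [← hc]; exact Fintype.card_pos
  have hle : (I.errors (I.decode r) EdgeData.parity T fun _ => []).card ≤ Fintype.card S := by
    rw [← Set.toFinset_card, ← Finset.card_image_of_injective _ vals_injective]
    refine Finset.card_le_card fun ω hω => ?_
    rw [mem_errors] at hω
    obtain ⟨h1, -, h3⟩ := hω
    refine Finset.mem_image.2 ⟨fun i => (⟨(ω i).1, (h1 i).1⟩, ⟨(ω i).2, (h1 i).2⟩), ?_, rfl⟩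
    rw [Set.mem_toFinset, hS]
    change T.eval (I.point (I.decode r) ω) ≠ I.goal r (I.point (I.decode r) ω)
    rw [goal, target_point hI h1]
    exact h3
  rw [hc, ENNReal.div_le_iff (by simpa using hpos.ne') (ENNReal.natCast_ne_top _)] at h
  have h2 : ((Fintype.card S : ℕ) : ℝ) ≤ ε * (((I.m * (4 * I.ℓ)) ^ r : ℕ) : ℝ) := by
    have := ENNReal.toReal_mono (ENNReal.mul_ne_top ENNReal.ofReal_ne_top
      (ENNReal.natCast_ne_top _)) h
    rwa [ENNReal.toReal_natCast, ENNReal.toReal_mul, ENNReal.toReal_ofReal hε,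
      ENNReal.toReal_natCast] at this
  have h3 : ((I.errors (I.decode r) EdgeData.parity T fun _ => []).card : ℝ) ≤ Fintype.card S := by
    exact_mod_cast hle
  refine (h3.trans h2).trans_eq ?_
  push_cast
  ring

/-- If all tests failed, then `cand` would be at least `P / q + 1` at all leaves, since that is the
least integer above P/q; at the empty history this is `hP`. The lower bound for the size plus the
errors would then contradict `hB`. -/
theorem Outcome.eq_one {I : EdgeData} (hI : I.Valid) (hn : 0 < I.n) {r P q t : ℕ}
    (hP : P < q * I.m) [Nonempty (Fin I.m)] [Nonempty (Fin (4 * I.ℓ))] {σ : Store}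
    (h : Outcome I r P q (2 * t + 1) σ) {T : DTree (r * I.width)}
    (hT : OutputsTree T σ.learner)
    (hw : ∃ s : Finset ℕ, (∀ j, σ.learner.arr 2 j ≠ 0 → j ∈ s) ∧ s.card ≤ t) {B ε : ℝ} (hε : 0 ≤ ε)
    (hs : (T.size : ℝ) ≤ B)
    (hd : disagreement (I.examples r) T.eval (I.goal r) ≤ ENNReal.ofReal ε)
    (hB : B + ε * (I.m * (4 * I.ℓ) : ℝ) ^ r < (((I.ℓ - 1) * (I.m + (P / q + 1))) ^ r : ℕ)) :
    σ.reg 0 = 1 := by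
  obtain ⟨base, vtx, z, h1, h2, h3⟩ := h
  rw [h3]
  by_contra hf
  have hf' : ((Search.next I r P q (σ.learner.arr 2) base vtx)^[2 * t + 1]
      ⟨0, 0, 1, false, z⟩).found = false := by
    cases hc : ((Search.next I r P q (σ.learner.arr 2) base vtx)^[2 * t + 1]
      ⟨0, 0, 1, false, z⟩).found
    · rfl
    · rw [hc] at hf; exact absurd rfl hf
  -- At most `t` cells were written, so the tree has at most `t + 1` leaves, and its code has one
  -- token fewer than twice that number.
  have hlen : T.encode.length ≤ 2 * t + 1 := by
    obtain ⟨s, hs1, hs2⟩ := hw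
    have h4 := T.size_le_of_written (σ.learner.arr 2) hT
    have h5 : ((Finset.range T.encode.length).filter fun j => σ.learner.arr 2 j ≠ 0).card ≤
        s.card := Finset.card_le_card fun j hj => hs1 j (Finset.mem_filter.1 hj).2
    have h6 := T.length_encode
    omega
  have hpass := Search.passes hn h1 T hT hlen h2 hf'
  have h0 : I.cand (I.cover []) = I.m := by
    simp [EdgeData.cand, EdgeData.cover, EdgeData.unc]
  have hLL : I.LargeLeaves (I.decode r) (P / q + 1) T fun _ => [] := by
    refine EdgeData.Passes.largeLeaves (P := P) (q := q) (fun c hc => ?_) ?_ fun i => ?_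
    · exact Nat.div_lt_of_lt_mul hc
    · exact hpass
    · rw [h0]; exact hP
  have key := EdgeData.pow_le_size hI (I.decode_le r) EdgeData.parity_update T hLL
  have key' : ((((I.ℓ - 1) * (I.m + (P / q + 1))) ^ r : ℕ) : ℝ) ≤
      T.size + (I.errors (I.decode r) EdgeData.parity T fun _ => []).card := by
    exact_mod_cast key
  have := EdgeData.card_errors_le hI hε hd
  linarith

/-- If the search finds something, then there is a small vertex cover. -/
theorem Outcome.eq_zero {I : EdgeData} {r P q b : ℕ} {σ : Store} (h : Outcome I r P q b σ)
    (hW : ∀ W, P < q * I.cand W) : σ.reg 0 = 0 := by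
  obtain ⟨base, vtx, z, -, -, h3⟩ := h
  rw [h3]
  cases hc : ((Search.next I r P q (σ.learner.arr 2) base vtx)^[b] ⟨0, 0, 1, false, z⟩).found
  · rfl
  · obtain ⟨W, hW'⟩ := Search.found_sound (s := ⟨0, 0, 1, false, z⟩) rfl b hc
    exact absurd hW' (not_le.2 (hW W))

/-! ### The choice of the parameters -/

theorem add_pow_le_pow_add {x y : ℝ} (hx : 0 ≤ x) (hy : 0 ≤ y) {r : ℕ} (hr : r ≠ 0) :
    x ^ r + y ^ r ≤ (x + y) ^ r := by
  obtain ⟨r, rfl⟩ := Nat.exists_eq_succ_of_ne_zero hr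
  induction r with
  | zero => simp
  | succ r ih =>
    have ih := ih (by omega)
    calc x ^ (r + 2) + y ^ (r + 2) ≤ (x ^ (r + 1) + y ^ (r + 1)) * (x + y) := by
          have h1 : 0 ≤ x ^ (r + 1) * y := by positivity
          have h2 : 0 ≤ y ^ (r + 1) * x := by positivity
          nlinarith [pow_succ x (r + 1), pow_succ y (r + 1)]
      _ ≤ (x + y) ^ (r + 1) * (x + y) := mul_le_mul_of_nonneg_right ih (by positivity)
      _ = (x + y) ^ (r + 2) := by ring

/-- The parameters are such that the trees for graphs with small covers are smaller than the trees
that pass the search. -/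
theorem size_lt {d r : ℕ} {δ' η ε A ρ : ℝ} (hr : 1 ≤ r) (hε : 0 < ε) (hA : 1 < A)
    (hδ : (A ^ (1 / r : ℝ) - 1 + 8 * ε ^ (1 / r : ℝ)) * d + A ^ (1 / r : ℝ) - 1 + η ≤ δ')
    (hη : 0 < η) (hρ : 1 + δ' - η / 2 ≤ ρ) (hρ' : ρ ≤ 1 + δ') {C n m k κ ℓ : ℕ} (hn : 1 ≤ n) (hk : 1 ≤ k)
    (hm : m ≤ d * k) (hℓ : ℓ = C * n) (hℓ1 : 1 ≤ ℓ) (hκ : ρ * k ≤ κ)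
    (hC : 2 * ((1 + δ') * (3 + 2 * d) + d) < η * C) :
    A * (((1 + k * (ℓ + 1) + m * (ℓ + n + 1)) ^ r : ℕ) : ℝ) + ε * (m * (4 * ℓ) : ℝ) ^ r <
      (((ℓ - 1) * (m + κ)) ^ r : ℕ) := by
  have hr0 : (r : ℝ) ≠ 0 := by positivity
  set α := A ^ (1 / r : ℝ) with hα
  set e := ε ^ (1 / r : ℝ) with he
  have hαr : α ^ r = A := by
    rw [hα, ← Real.rpow_natCast, ← Real.rpow_mul (by linarith), one_div_mul_cancel hr0,
      Real.rpow_one]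
  have her : e ^ r = ε := by
    rw [he, ← Real.rpow_natCast, ← Real.rpow_mul hε.le, one_div_mul_cancel hr0, Real.rpow_one]
  have hα1 : 1 ≤ α := Real.one_le_rpow hA.le (by positivity)
  have he0 : 0 < e := Real.rpow_pos_of_pos hε _
  have hd0 : (0 : ℝ) ≤ d := Nat.cast_nonneg d
  have hαD : α ≤ 1 + δ' := by
    have : 0 ≤ (α - 1 + 8 * e) * d := mul_nonneg (by linarith) hd0
    linarith
  set X : ℝ := α * (1 + k * (ℓ + 1) + m * (ℓ + n + 1)) with hX
  set Y : ℝ := e * (m * (4 * ℓ)) with hY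
  have hX0 : 0 ≤ X := by positivity
  have hY0 : 0 ≤ Y := by positivity
  have hlhs : A * (((1 + k * (ℓ + 1) + m * (ℓ + n + 1)) ^ r : ℕ) : ℝ) + ε * (m * (4 * ℓ) : ℝ) ^ r =
      X ^ r + Y ^ r := by
    rw [hX, hY, mul_pow α, mul_pow e, hαr, her]
    push_cast
    ring
  have hrhs : ((((ℓ - 1) * (m + κ)) ^ r : ℕ) : ℝ) = (((ℓ : ℝ) - 1) * (m + κ)) ^ r := by
    push_cast [Nat.cast_sub hℓ1]
    ring
  rw [hlhs, hrhs]
  -- Superadditivity of the power reduces the claim to the inequality `X + Y < (ℓ - 1) * (m + κ)`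
  -- for one block.
  refine (add_pow_le_pow_add hX0 hY0 (by omega)).trans_lt ?_
  refine pow_lt_pow_left₀ ?_ (by positivity) (by omega)
  have hk1 : (1 : ℝ) ≤ k := by exact_mod_cast hk
  have hn1 : (1 : ℝ) ≤ n := by exact_mod_cast hn
  have hl1 : (1 : ℝ) ≤ ℓ := by exact_mod_cast hℓ1
  have hmd : (m : ℝ) ≤ d * k := by exact_mod_cast hm
  have hm0 : (0 : ℝ) ≤ m := Nat.cast_nonneg m
  have hlC : (ℓ : ℝ) = C * n := by rw [hℓ]; push_cast; ring
  set D := 1 + δ' with hD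
  have hD0 : 0 < D := by linarith
  -- The left side collects, per unit of `k`, all terms without the factor `ℓ`. They are of order
  -- `n`, so a large ratio `C` of `ℓ` to `n` makes them smaller than one half of `η * ℓ`.
  have hbig : 2 * (D * (3 + d * (n + 1)) + d) < η * ℓ := by
    have h1 : 2 * (D * (3 + d * (n + 1)) + d) ≤ 2 * (D * (3 + 2 * d) + d) * n := by
      have h2 : (d : ℝ) ≤ d * n := le_mul_of_one_le_right hd0 hn1
      have h3 : (3 + d * (n + 1) : ℝ) ≤ (3 + 2 * d) * n := by linarith
      have h4 := mul_le_mul_of_nonneg_left h3 hD0.le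
      linarith
    have h2 : 2 * (D * (3 + 2 * d) + d) * n < η * C * n :=
      mul_lt_mul_of_pos_right hC (by linarith)
    rw [hlC, ← mul_assoc]
    exact h1.trans_lt h2
  -- These are the terms of leading order; together with `b2` the bound `m ≤ d * k` and the
  -- assumption on `δ'` absorb them.
  have b1 : (α - 1 + 4 * e) * (m * ℓ) ≤ (α - 1 + 8 * e) * d * (k * ℓ) := by
    have h1 : (m : ℝ) * ℓ ≤ d * k * ℓ := mul_le_mul_of_nonneg_right hmd (by linarith)
    calc (α - 1 + 4 * e) * (m * ℓ) ≤ (α - 1 + 8 * e) * (d * k * ℓ) := by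
          refine mul_le_mul ?_ h1 (by positivity) ?_ <;> linarith
      _ = _ := by ring
  have b2 : (α - 1 + 8 * e) * d * (k * ℓ) ≤ (D - η - α) * (k * ℓ) := by
    apply mul_le_mul_of_nonneg_right _ (by positivity)
    linarith
  have b3 : α * (1 + m * (n + 1)) ≤ k * (D * (1 + d * (n + 1))) := by
    have h1 : (1 + m * (n + 1) : ℝ) ≤ k * (1 + d * (n + 1)) := by
      have := mul_le_mul_of_nonneg_right hmd (by linarith : (0 : ℝ) ≤ n + 1)
      linarith
    calc α * (1 + m * (n + 1)) ≤ D * (k * (1 + d * (n + 1))) := by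
          apply mul_le_mul hαD h1 (by positivity) hD0.le
      _ = _ := by ring
  have b4 : ρ * k * (ℓ - 1) ≤ κ * (ℓ - 1) := mul_le_mul_of_nonneg_right hκ (by linarith)
  have b5 : (D - η / 2) * ℓ - D ≤ ρ * (ℓ - 1) := by
    have : (D - η / 2) * ℓ ≤ ρ * ℓ := mul_le_mul_of_nonneg_right (by linarith) (by linarith)
    linarith
  have b6 := mul_le_mul_of_nonneg_left b5 (by linarith : (0 : ℝ) ≤ k)
  have b7 := mul_lt_mul_of_pos_left hbig (by linarith : (0 : ℝ) < k)
  have b8 : α * k ≤ D * k := mul_le_mul_of_nonneg_right hαD (by linarith)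
  rw [hX, hY]
  linarith

/-! ### The reduction -/

theorem mul_le_pow_of_two_le {x r : ℕ} (hx : 2 ≤ x) (hr : 1 ≤ r) : r * x ≤ x ^ r := by
  obtain ⟨r, rfl⟩ := Nat.exists_eq_add_of_le' hr
  rw [pow_succ]
  exact Nat.mul_le_mul_right x (Nat.lt_pow_self (n := r) (by omega : 1 < x))

/-- The number of variables and the size bound are admissible for the learner. -/
theorem EdgeData.admissible {I : EdgeData} {d k r : ℕ} (hr : 1 ≤ r) (hn : 1 ≤ I.n)
    (hnm : I.n ≤ 2 * I.m) (hm : I.m ≤ d * I.n) (hℓ : I.n ≤ I.ℓ) (hk : k ≤ I.m) :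
    r * I.width ≤ (3 * d + 2) * I.blockSize k ^ r ∧
      I.blockSize k ^ r ≤ ((3 * d + 2) * (r * I.width)) ^ r := by
  have hw : 1 ≤ I.width := Nat.mul_pos hn (Nat.succ_pos _)
  have h1 : I.width ≤ 2 * (I.m * (I.ℓ + 1)) := by
    rw [← mul_assoc]; exact Nat.mul_le_mul_right _ hnm
  have h2 : I.m * (I.ℓ + 1) ≤ I.m * (I.ℓ + I.n + 1) := Nat.mul_le_mul_left _ (by omega)
  have h3 : I.m * (I.ℓ + 1) ≤ d * I.width := by
    unfold EdgeData.width
    rw [← mul_assoc]; exact Nat.mul_le_mul_right _ hm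
  have h4 : k * (I.ℓ + 1) ≤ I.m * (I.ℓ + 1) := Nat.mul_le_mul_right _ hk
  have h5 : I.m * (I.ℓ + I.n + 1) ≤ I.m * (2 * (I.ℓ + 1)) := Nat.mul_le_mul_left _ (by omega)
  constructor
  · have h6 : I.width ≤ 2 * I.blockSize k := by unfold EdgeData.blockSize; omega
    have h7 : 2 ≤ I.blockSize k := by unfold EdgeData.blockSize; omega
    calc r * I.width ≤ r * (2 * I.blockSize k) := Nat.mul_le_mul_left _ h6
      _ = 2 * (r * I.blockSize k) := by ring
      _ ≤ 2 * I.blockSize k ^ r := Nat.mul_le_mul_left _ (mul_le_pow_of_two_le h7 hr)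
      _ ≤ _ := Nat.mul_le_mul_right _ (by omega)
  · refine Nat.pow_le_pow_left ?_ r
    have h6 : I.blockSize k ≤ (3 * d + 2) * I.width := by
      unfold EdgeData.blockSize
      have : I.m * (2 * (I.ℓ + 1)) = 2 * (I.m * (I.ℓ + 1)) := by ring
      have : (3 * d + 2) * I.width = 3 * (d * I.width) + 2 * I.width := by ring
      omega
    exact h6.trans (Nat.mul_le_mul_left _ (Nat.le_mul_of_pos_left _ hr))

theorem EdgeData.blockSize_le {I : EdgeData} {d k n C : ℕ} (hn : 1 ≤ n) (hIn : I.n ≤ n)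
    (hm : I.m ≤ d * I.n) (hℓ : I.ℓ = C * I.n) (hk : k ≤ I.m) :
    I.blockSize k ≤ (1 + d * (C + 1) + d * (C + 2)) * n ^ 2 := by
  have h1 : I.m ≤ d * n := hm.trans (Nat.mul_le_mul_left _ hIn)
  have h2 : I.ℓ ≤ C * n := hℓ ▸ Nat.mul_le_mul_left _ hIn
  have h3 : k * (I.ℓ + 1) ≤ d * n * ((C + 1) * n) := Nat.mul_le_mul (hk.trans h1) (by linarith)
  have h4 : I.m * (I.ℓ + I.n + 1) ≤ d * n * ((C + 2) * n) := Nat.mul_le_mul h1 (by linarith)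
  have h5 : 1 ≤ n ^ 2 := Nat.one_le_pow _ _ hn
  unfold EdgeData.blockSize
  calc _ ≤ n ^ 2 + d * n * ((C + 1) * n) + d * n * ((C + 2) * n) := by omega
    _ = _ := by ring

/-- A constant for the running time. -/
def timeFactor (d u C c : ℕ) : ℕ :=
  (105 + u * 6) +
    (C * 6 + 6 + 12 + C * 6 + d * 6 + (1 + d * (C + 1) + d * (C + 2)) * 6 + 16 + 100) + c +
    ((C + 1) * 81 + 26 + d * 20 + 105 + 60 + 20 + 5) +
    ((C + 1) * 20 + 12 + 8 + 40 + 3 * (d * 55 + 11 + 12 + 70 + 5)) + 25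

/-- Each phase is compared with r n² g. An oracle call or a step of the search costs O(r n²) and
there are O(g) of them; all other phases cost O(r n²), O(g) or less. The constant does not involve
r, because r enters each of the costs at most linearly. -/
theorem EdgeData.cost_le {I : EdgeData} {d k n r u C c g : ℕ} (hn : 1 ≤ n) (hr : 1 ≤ r) (hg : 1 ≤ g)
    (hIn : I.n ≤ n) (hm : I.m ≤ d * I.n) (hℓ : I.ℓ = C * I.n) (hk : k ≤ I.m) :
    readCost n u + I.sizesCost C r k + c * g +
      (g * (I.callCost r + 20) + 5 + I.searchCost r (2 * g + 1)) + 25 ≤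
    timeFactor d u C c * r * n ^ 2 * g := by
  have hs := I.blockSize_le hn hIn hm hℓ hk
  set S := 1 + d * (C + 1) + d * (C + 2) with hS
  have h1 : I.m ≤ d * n := hm.trans (Nat.mul_le_mul_left _ hIn)
  have h2 : I.ℓ ≤ C * n := hℓ ▸ Nat.mul_le_mul_left _ hIn
  set R := r * n ^ 2 with hR
  have hnn : n ≤ n ^ 2 := Nat.le_self_pow (by norm_num) n
  have hn2 : n ^ 2 ≤ R := Nat.le_mul_of_pos_left _ hr
  have hnR : n ≤ R := hnn.trans hn2
  have hrn : r * n ≤ R := Nat.mul_le_mul_left _ hnn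
  have hrR : r ≤ R := Nat.le_mul_of_pos_right _ (by omega)
  have hR1 : 1 ≤ R := hr.trans hrR
  have e1 : readCost n u ≤ (105 + u * 6) * R := by
    unfold readCost
    nlinarith [Nat.le_mul_of_pos_right u hR1]
  have e2 : I.sizesCost C r k ≤
      (C * 6 + 6 + 12 + C * 6 + d * 6 + S * 6 + 16 + 100) * R := by
    unfold EdgeData.sizesCost
    have a1 : r * (I.blockSize k * 6 + 16) ≤ r * (S * n ^ 2 * 6 + 16) :=
      Nat.mul_le_mul_left _ (by omega)
    have a2 : r * (S * n ^ 2 * 6 + 16) = S * 6 * R + 16 * r := by rw [hR]; ring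
    have a3 : C ≤ C * R := Nat.le_mul_of_pos_right _ hR1
    have a4 : I.ℓ ≤ C * R := h2.trans (Nat.mul_le_mul_left _ hnR)
    have a5 : I.m ≤ d * R := h1.trans (Nat.mul_le_mul_left _ hnR)
    linarith
  have b1 : I.ℓ + 1 ≤ (C + 1) * n := by linarith
  have e3 : I.callCost r ≤ ((C + 1) * 81 + 26 + d * 20 + 105 + 60) * R := by
    unfold EdgeData.callCost
    have a1 : (I.ℓ + 1) * (I.n * 21 + 60) ≤ (C + 1) * n * (81 * n) := Nat.mul_le_mul b1 (by omega)
    have a2 : I.m ≤ d * n ^ 2 := h1.trans (Nat.mul_le_mul_left _ hnn)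
    have a3 : r * ((I.ℓ + 1) * (I.n * 21 + 60) + I.n * 26 + I.m * 20 + 105) ≤
        r * ((C + 1) * n * (81 * n) + n ^ 2 * 26 + d * n ^ 2 * 20 + n ^ 2 * 105) :=
      Nat.mul_le_mul_left _ (by omega)
    have a4 : r * ((C + 1) * n * (81 * n) + n ^ 2 * 26 + d * n ^ 2 * 20 + n ^ 2 * 105) =
        ((C + 1) * 81 + 26 + d * 20 + 105) * R := by rw [hR]; ring
    linarith
  have e4 : I.nextCost r + 5 ≤ (d * 55 + 11 + 12 + 70 + 5) * R := by
    unfold EdgeData.nextCost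
    have a1 : r * I.n ≤ R := (Nat.mul_le_mul_left _ hIn).trans hrn
    have a2 : I.m ≤ d * R := h1.trans (Nat.mul_le_mul_left _ hnR)
    linarith
  have e5 : I.searchCost r (2 * g + 1) ≤
      ((C + 1) * 20 + 12 + 8 + 40) * R + 3 * (d * 55 + 11 + 12 + 70 + 5) * (R * g) := by
    unfold EdgeData.searchCost
    have a1 : (I.ℓ + 1) * (I.n * 10 + 10) ≤ (C + 1) * n * (20 * n) := Nat.mul_le_mul b1 (by omega)
    have a2 : r * ((I.ℓ + 1) * (I.n * 10 + 10) + 12) ≤ r * ((C + 1) * n * (20 * n) + n ^ 2 * 12) :=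
      Nat.mul_le_mul_left _ (by omega)
    have a3 : r * ((C + 1) * n * (20 * n) + n ^ 2 * 12) = ((C + 1) * 20 + 12) * R := by
      rw [hR]; ring
    have a4 : r * I.n ≤ R := (Nat.mul_le_mul_left _ hIn).trans hrn
    have a5 : (2 * g + 1) * (I.nextCost r + 5) ≤ 3 * g * ((d * 55 + 11 + 12 + 70 + 5) * R) :=
      Nat.mul_le_mul (by omega) e4
    linarith
  have hRg : R ≤ R * g := Nat.le_mul_of_pos_right _ hg
  have hgR : g ≤ R * g := Nat.le_mul_of_pos_left _ hR1
  have f1 := e1.trans (Nat.mul_le_mul_left (105 + u * 6) hRg)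
  have f2 := e2.trans (Nat.mul_le_mul_left _ hRg)
  have f3 : g * (I.callCost r + 20) ≤
      ((C + 1) * 81 + 26 + d * 20 + 105 + 60 + 20) * (R * g) := by
    have := Nat.mul_le_mul_left g e3
    linarith
  have f4 := Nat.mul_le_mul_left ((C + 1) * 20 + 12 + 8 + 40) hRg
  have f5 := Nat.mul_le_mul_left c hgR
  have : timeFactor d u C c * r * n ^ 2 * g = timeFactor d u C c * (R * g) := by rw [hR]; ring
  rw [this]
  unfold timeFactor
  rw [← hS]
  linarith

/-- The success probability of the learner is inherited by a program that reproduces the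
distribution of its final memory. -/
theorem Law.learner_success {N T B T' : ℕ} {f : (Fin N → Bool) → Bool} {D : PMF (Fin N → Bool)}
    {L : Prog LearnCall} {τ σ : Store} (hτ : ∀ j, τ.arr 2 j = 0) {p : PlainProg}
    {I E E' : Store → Prop} {obs : Store → Store}
    (h : Law [p] σ B I obs ((runFor (learnOracle f D) T ([L], τ)).map fun y => y.2))
    (hB : B ≤ T')
    (hE : ∀ σ', I σ' → E (obs σ') →
      (∃ s : Finset ℕ, (∀ j, (obs σ').arr 2 j ≠ 0 → j ∈ s) ∧ s.card ≤ T) → E' σ') :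
    outcomeProb (learnOracle f D) L τ T E ≤ outcomeProb noOracle p σ T' E' := by
  refine le_trans ?_ (h.le_outcomeProb hB (s := {υ | E υ ∧
    ∃ s : Finset ℕ, (∀ j, υ.arr 2 j ≠ 0 → j ∈ s) ∧ s.card ≤ T}) fun σ' h1 h2 =>
      hE σ' h1 h2.1 h2.2)
  rw [PMF.toOuterMeasure_map_apply]
  refine PMF.toOuterMeasure_mono_support _ fun y hy hyE => ⟨hyE.2, ?_⟩
  simpa using card_written_le f D T [L] τ ∅ (fun j hj => absurd (hτ j) hj) y hy

theorem PMF.toOuterMeasure_univ {α : Type*} (p : PMF α) : p.toOuterMeasure Set.univ = 1 :=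
  (p.toOuterMeasure_apply_eq_one_iff Set.univ).2 (Set.subset_univ _)

theorem Law.outcomeProb_of_forall {α : Type*} {p : PlainProg} {σ : Store} {B T : ℕ}
    {I E : Store → Prop} {obs : Store → α} {μ : PMF α} (h : Law [p] σ B I obs μ) (hT : B ≤ T)
    (hE : ∀ σ', I σ' → E σ') : 2 / 3 ≤ outcomeProb noOracle p σ T E := by
  have := h.le_outcomeProb hT (s := Set.univ) fun σ' h1 _ => hE σ' h1
  rw [PMF.toOuterMeasure_univ] at this
  refine le_trans ?_ this
  rw [ENNReal.div_le_iff (by norm_num) (by norm_num)]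
  norm_num

/-- The reduction, for fixed parameters: the program `mainProg L p r u q C` solves the
approximation problem if `u / q` is slightly smaller than `1 + δ'` and `C` is large. -/
theorem mainProg_approximates {d u q C c r : ℕ} {δ' η ε A : ℝ} (hη : 0 < η) (hq : 0 < q)
    (huq : q ≤ u) (hρ : 1 + δ' - η / 2 ≤ (u / q : ℝ)) (hρ' : (u / q : ℝ) < 1 + δ')
    (hC1 : 1 ≤ C) (hC : 2 * ((1 + δ') * (3 + 2 * d) + d) < η * C) (hr : 1 ≤ r) (hε : 0 < ε)
    (hA : 1 < A)
    (hδ : (A ^ (1 / r : ℝ) - 1 + 8 * ε ^ (1 / r : ℝ)) * d + A ^ (1 / r : ℝ) - 1 + η ≤ δ')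
    {g : ℕ → ℕ} (hg : Monotone g) (hg1 : ∀ s, 1 ≤ g s) {p : PlainProg}
    (hp : ∀ x : ℕ, HaltsWithin noOracle p (inputStore x 0 fun _ => 0) (c * g x) ∧
      outcomeProb noOracle p (inputStore x 0 fun _ => 0) (c * g x) (fun σ => σ.reg 0 = g x) = 1)
    {L : Prog LearnCall} (hL : ∀ n s : ℕ, n ≤ (3 * d + 2) * s → s ≤ ((3 * d + 2) * n) ^ r →
      SolvesDTLearn L A ε g n s) :
    ApproximatesVertexCover (mainProg L p r u q C) (1 + δ') d fun n =>
      timeFactor d u C c * r * n ^ 2 * g ((timeFactor d u C c * n ^ 2) ^ r) := by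
  classical
  intro n G _ k hn hk hdeg
  obtain ⟨I, hIn, hIm, hIℓ, hl, hyes, hno⟩ :=
    mainProg_law (n := n) (k := k) (r := r) (u := u) (q := q) (C := C) (a := adjArray G) hp L
  have hG := encodes_of_lists hIn hIm hl
  set F := timeFactor d u C c with hF
  set t := g ((F * n ^ 2) ^ r) with ht
  have ht1 : 1 ≤ t := hg1 _
  have hq' : (0 : ℝ) < q := by exact_mod_cast hq
  have hk' : (0 : ℝ) < k := by exact_mod_cast hk
  -- In this case one endpoint per edge is a cover with fewer than `(1 + δ') * k` vertices, so Yes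
  -- is a correct answer and the promise of a No instance is contradictory.
  by_cases hle : q * I.m ≤ u * k
  · have h := hyes hle
    have hB : readCost n u + 3 ≤ F * r * n ^ 2 * t := by
      have hR1 : 1 ≤ r * t := Nat.mul_pos hr ht1
      have h1 : readCost n u + 3 ≤ (105 + u * 6 + 3) * n ^ 2 := by
        unfold readCost
        have a1 : 1 ≤ n ^ 2 := Nat.one_le_pow _ _ hn
        have a2 := Nat.le_mul_of_pos_right u a1
        have a3 : n ≤ n ^ 2 := Nat.le_self_pow (by norm_num) n
        linarith
      have h2 : (105 + u * 6 + 3) * n ^ 2 ≤ F * n ^ 2 :=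
        Nat.mul_le_mul_right _ (by rw [hF]; unfold timeFactor; omega)
      calc _ ≤ F * n ^ 2 := h1.trans h2
        _ ≤ F * n ^ 2 * (r * t) := Nat.le_mul_of_pos_right _ hR1
        _ = _ := by ring
    refine ⟨h.halts hB, fun _ => h.outcomeProb_of_forall hB fun _ h => h, fun hall => ?_⟩
    exfalso
    obtain ⟨S, hS, hSc⟩ := hG.exists_cover ∅
    have h0 : I.cand ∅ = I.m := by simp [EdgeData.cand, EdgeData.unc]
    rw [h0] at hSc
    have h1 := hall S hS
    have h2 : (S.card : ℝ) ≤ I.m := by exact_mod_cast hSc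
    have h3 : (q * I.m : ℝ) ≤ u * k := by exact_mod_cast hle
    have h4 : (u / q : ℝ) * k < (1 + δ') * k := mul_lt_mul_of_pos_right hρ' hk'
    have h5 : (I.m : ℝ) ≤ u / q * k := by
      rw [div_mul_eq_mul_div, le_div_iff₀ hq']; linarith
    linarith
  · rw [not_le] at hle
    -- This uses that ρ is at least 1. It also shows that there are edges, and it bounds the block
    -- size in terms of the graph alone.
    have hkm : k ≤ I.m := by
      by_contra hcon
      exact absurd (hle.trans_le (Nat.mul_le_mul huq (not_le.1 hcon).le)) (lt_irrefl _)
    have hmd := hG.m_le hdeg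
    have hn0 : 1 ≤ I.n := by
      rcases Nat.eq_zero_or_pos I.n with h0 | h0
      · rw [h0] at hmd; omega
      · exact h0
    have hℓn : I.n ≤ I.ℓ := hIℓ ▸ Nat.le_mul_of_pos_left _ hC1
    have : Nonempty (Fin I.m) := ⟨⟨0, by omega⟩⟩
    have : Nonempty (Fin (4 * I.ℓ)) := ⟨⟨0, by omega⟩⟩
    have hlaw := hno hle hG.valid
    set s := I.blockSize k ^ r with hs
    have hst : g s ≤ t := by
      refine hg (Nat.pow_le_pow_left ((I.blockSize_le hn hG.card_le hmd hIℓ hkm).trans ?_) r)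
      exact Nat.mul_le_mul_right _ (by rw [hF]; unfold timeFactor; omega)
    have hB := (I.cost_le (u := u) (c := c) hn hr (hg1 s) hG.card_le hmd hIℓ hkm).trans
      (Nat.mul_le_mul_left _ hst)
    refine ⟨hlaw.halts hB, ?_, fun hall => hlaw.outcomeProb_of_forall hB fun σ hσ =>
      hσ.eq_zero fun W => ?_⟩
    · rintro ⟨S, hS, hSk⟩
      obtain ⟨hN, hs'⟩ := I.admissible hr hn0 hG.n_le hmd hℓn hkm
      obtain ⟨us, hus, husn, hcov⟩ := hG.exists_list hS
      obtain ⟨T₀, hT₀, hT₀'⟩ :=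
        EdgeData.exists_tree hG.valid (hus.trans hSk) husn hcov r (le_refl (r * I.width))
      refine (hL _ _ hN hs' (I.goal r) (I.examples r) ⟨T₀, hT₀, hT₀'⟩).2.trans
        (hlaw.learner_success (fun j => ?_) hB fun σ hσ hE hw => ?_)
      · rfl
      · obtain ⟨T, hT, hTs, hTd⟩ := hE
        refine hσ.eq_one hG.valid hn0 hle hT hw hε.le hTs hTd ?_
        have hmk : I.m ≤ d * k := (hG.m_le_of_cover hdeg hS).trans (Nat.mul_le_mul_left _ hSk)
        refine size_lt hr hε hA hδ hη hρ hρ'.le hn0 hk hmk hIℓ (hn0.trans hℓn) ?_ hC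
        -- Here κ is the least integer above ρk, as used by the test.
        have h1 : u * k < q * (u * k / q + 1) := Nat.lt_mul_div_succ _ hq
        have h2 : (u * k : ℝ) < q * ((u * k / q + 1 : ℕ) : ℝ) := by exact_mod_cast h1
        rw [div_mul_eq_mul_div, div_le_iff₀ hq']
        linarith
    -- In a No instance no set of labels can pass the test, so the answer does not depend on the
    -- learner or on the random choices.
    · obtain ⟨S, hS, hSc⟩ := hG.exists_cover W
      have h1 := hall S hS
      have h2 : (S.card : ℝ) ≤ I.cand W := by exact_mod_cast hSc
      have h4 : (u / q : ℝ) * k < (1 + δ') * k := mul_lt_mul_of_pos_right hρ' hk'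
      rw [div_mul_eq_mul_div, div_lt_iff₀ hq'] at h4
      have h5 : (1 + δ') * k * q ≤ I.cand W * q :=
        mul_le_mul_of_nonneg_right (h1.trans h2) hq'.le
      have h6 : (u * k : ℝ) < q * I.cand W := by linarith
      exact_mod_cast h6

theorem mainTheorem3 (d : ℕ) (δ' η : ℝ) (hη : 0 < η) :
    ∃ K : ℕ, ∀ c : ℕ, ∃ C : ℕ,
      ∀ (r : ℕ) (ε A : ℝ), 1 ≤ r → 0 < ε → ε < 2 ^ (-(3 * r : ℝ)) → 1 < A →
        (A ^ (1 / r : ℝ) - 1 + 8 * ε ^ (1 / r : ℝ)) * d + A ^ (1 / r : ℝ) - 1 + η ≤ δ' →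
        ∀ t : ℕ → ℝ → ℕ,
          Monotone (fun s => t s (1 / ε)) →
          (∀ s, 1 ≤ t s (1 / ε)) →
          TimeConstructible c (fun s => t s (1 / ε)) →
          (∃ L : Prog LearnCall, ∀ n s : ℕ, n ≤ K * s → s ≤ (K * n) ^ r →
            SolvesDTLearn L A ε (fun s => t s (1 / ε)) n s) →
          ∃ P : PlainProg, ApproximatesVertexCover P (1 + δ') d
            (fun n => C * r * n ^ 2 * t ((C * n ^ 2) ^ r) (1 / ε)) := by
  -- Since A^(1/r) is at least 1, the assumption on `δ'` forces `η ≤ δ'`. The first case is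
  -- therefore vacuous, with dummy constants, and in the second one ρ exceeds 1.
  rcases lt_or_ge δ' η with hlt | hge
  · refine ⟨0, fun c => ⟨0, fun r ε A hr hε _ hA hδ => ?_⟩⟩
    have h1 : 1 ≤ A ^ (1 / r : ℝ) := Real.one_le_rpow hA.le (by positivity)
    have h2 : 0 < ε ^ (1 / r : ℝ) := Real.rpow_pos_of_pos hε _
    have h3 : 0 ≤ (A ^ (1 / r : ℝ) - 1 + 8 * ε ^ (1 / r : ℝ)) * d :=
      mul_nonneg (by linarith) (Nat.cast_nonneg d)
    linarith
  · obtain ⟨ρ, hρ, hρ'⟩ := exists_rat_btwn (show 1 + δ' - η / 2 < 1 + δ' by linarith)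
    obtain ⟨C₀, hC₀⟩ := exists_nat_gt (2 * ((1 + δ') * (3 + 2 * d) + d) / η)
    have hρ1 : (1 : ℝ) ≤ ρ := by linarith
    have hρ0 : (0 : ℚ) ≤ ρ := by
      have : (0 : ℝ) ≤ ρ := by linarith
      exact_mod_cast this
    have huq : ((ρ.num.toNat : ℝ) / ρ.den) = ρ := by
      have h1 : ((ρ.num.toNat : ℤ) : ℝ) = ρ.num := by
        rw [Int.toNat_of_nonneg (Rat.num_nonneg.2 hρ0)]
      rw [Rat.cast_def, ← h1, Int.cast_natCast]
    have hden : (0 : ℝ) < ρ.den := by exact_mod_cast ρ.den_pos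
    -- The constant `3 * d + 2` is the one from `EdgeData.admissible`.
    refine ⟨3 * d + 2, fun c => ⟨timeFactor d ρ.num.toNat (C₀ + 1) c,
      fun r ε A hr hε _ hA hδ t hmono ht1 ⟨p, hp⟩ ⟨L, hL⟩ =>
        ⟨mainProg L p r ρ.num.toNat ρ.den (C₀ + 1), ?_⟩⟩⟩
    refine mainProg_approximates (g := fun s => t s (1 / ε)) hη ρ.den_pos ?_ ?_ ?_ (by omega) ?_
      hr hε hA hδ hmono ht1 hp hL
    · rw [← huq, le_div_iff₀ hden, one_mul] at hρ1
      exact_mod_cast hρ1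
    · rw [huq]; exact hρ.le
    · rw [huq]; exact hρ'
    · rw [div_lt_iff₀ hη] at hC₀
      push_cast
      linarith
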